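/- Fix an infinite set of names. Processes are given by $P ::= 0 \mid x?(y_1,\dots,y_n)\Rightarrow P \mid x!(y_1,\dots,y_n)\mid (\mathsf{new}\,x)P\mid P|Q$ with $n\ge 0$; the parameters $y_1,\dots,y_n$ of an input are pairwise distinct and bound in $P$, $\mathsf{new}\,x$ binds $x$, and $\mathrm{FN}(P)$ denotes the set of free names. Structural congruence $\equiv$ is the least congruence containing $\alpha$-equivalence, making $|,0$ a commutative monoid and satisfying $(\mathsf{new}\,x)(\mathsf{new}\,x)P\equiv(\mathsf{new}\,x)P$, $(\mathsf{new}\,x)(\mathsf{new}\,y)P\equiv(\mathsf{new}\,y)(\mathsf{new}\,x)P$, and $((\mathsf{new}\,x)P)|Q\equiv(\mathsf{new}\,x)(P|Q)$ if $x\notin\mathrm{FN}(Q)$. Reduction $\to$ is generated by $x?(\vec y)\Rightarrow P\,|\,x!(\vec z)\to P\{\vec z/\vec y\}$ for $|\vec y|=|\vec z|$ (capture-avoiding substitution) and closed under $-|Q$, under $(\mathsf{new}\,x)-$ and under $\equiv$ on both sides. The barb relation $P\downarrow x$ is the least relation such that $x!(\vec y)\downarrow x$; $P\downarrow x$ or $Q\downarrow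 x$ implies $P|Q\downarrow x$; and $P\downarrow x$, $x\neq u$ imply $(\mathsf{new}\,u)P\downarrow x$. Barbed bisimilarity is the union of all symmetric relations $S$ such that $P\,S\,Q$ implies: if $P\to P'$ then $Q\to Q'$ with $P'\,S\,Q'$ for some $Q'$; and if $P\downarrow x$ then $Q\downarrow x$. A context $C$ is a process with one hole (which may lie under any constructor), and $C[P]$ is the result of filling the hole, where binders of $C$ may capture names of $P$. Write $P\simeq Q$ if $C[P]$ and $C[Q]$ are barbed bisimilar for every context $C$. Let $\mathcal T$ be the free symmetric monoidal closed 2-category on objects $\mathcal N,\mathcal P$; 1-morphisms $\Delta:\mathcal N\to\mathcal N\otimes\mathcal N$, $\delta:\mathcal N\to I$, $|:\mathcal P\otimes\mathcal P\to\mathcal P$, $0:I\to\mathcal P$, $?_n:\mathcal N\otimes(\mathcal N^{\otimes n}\multimap\mathcal P)\to\mathcal P$ and $!_n:\mathcal N\otimes\mathcal N^{\otimes n}\to\mathcal P$ ($n\ge0$), $\mathit{fresh}:I\to\mathcal N$, $\mathit{COMM}:I\to\mathcal P$, and $\llbracket x\rrbracket:I\to\mathcal N$ for each name $x$; equations making $(\mathcal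 P,|,0)$ a commutative monoid and $(\mathcal N,\Delta,\delta)$ a cocommutative comonoid; and, for each $n\ge 0$, a 2-morphism $comm_n$ between 1-morphisms $\mathcal N\otimes\mathcal N^{\otimes n}\otimes(\mathcal N^{\otimes n}\multimap\mathcal P)\to\mathcal P$, from $(x,\vec z,f)\mapsto(\,!_n(x,\vec z)\,|\,?_n(x,f)\,)\,|\,\mathit{COMM}$ (with $x$ duplicated by $\Delta$) to $(x,\vec z,f)\mapsto ev(\vec z,f)\,|\,\mathit{COMM}$ (with $x$ deleted by $\delta$). For a finite list $\Gamma$ of names with $\mathrm{FN}(P)\subseteq\Gamma$ let $\llbracket P\rrbracket_\Gamma:\mathcal N^{\otimes|\Gamma|}\to\mathcal P$ be the interpretation in which each free name denotes its (first) place in $\Gamma$, names are shared by $\Delta$ and unused ones deleted by $\delta$: $0$, $|$ and output are interpreted by $0$, $|$ and $!_n$; $\llbracket x?(\vec y)\Rightarrow P\rrbracket_\Gamma$ is $?_n$ applied to $x$ and to the currying of $\llbracket P\rrbracket_{\vec y,\Gamma}$ in the variables $\vec y$; and $\llbracket(\mathsf{new}\,x)P\rrbracket_\Gamma=\llbracket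 P\rrbracket_{x,\Gamma}\circ(\mathit{fresh}\otimes\mathrm{id})$. By the same clauses, a context $C$ is interpreted as a functor of hom-categories $\llbracket C\rrbracket_{\Lambda,\Gamma}:\mathcal T(\mathcal N^{\otimes|\Lambda|},\mathcal P)\to\mathcal T(\mathcal N^{\otimes|\Gamma|},\mathcal P)$, where $\Gamma$ lists the free names of $C$ and every name of $\Lambda$ is in $\Gamma$ or bound by $C$ around the hole; the hole is interpreted as precomposition with the map that supplies the values of the names in $\Lambda$. For $f:\mathcal N^{\otimes|\Gamma|}\to\mathcal P$ let $\bar f:I\to\mathcal P$ be $f$ precomposed with the tensor product of the $\llbracket x\rrbracket$, $x\in\Gamma$, and let $f_{top}=\bar f\,|\,\mathit{COMM}$. Write $f\Rightarrow^{comm}g$ if there is a 2-morphism $f_{top}\Rightarrow g_{top}$ generated by exactly one top-level occurrence (not under currying) of some $comm_n$ and compositions and tensor products with identity 2-morphisms. Let $\Downarrow$ be the least relation between 1-morphisms $I\to\mathcal P$ and $I\to\mathcal N$ such that (each list $\Gamma$ containing the free names involved) $\overline{\llbracket x!(\vec y)\rrbracket_\Gamma}\Downarrow\llbracket x\rrbracket$;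 $\overline{\llbracket P\rrbracket_\Gamma}\Downarrow\llbracket x\rrbracket$ or $\overline{\llbracket Q\rrbracket_\Gamma}\Downarrow\llbracket x\rrbracket$ implies $\overline{\llbracket P|Q\rrbracket_\Gamma}\Downarrow\llbracket x\rrbracket$; and $\overline{\llbracket P\rrbracket_{u,\Gamma}}\Downarrow\llbracket x\rrbracket$, $x\ne u$ imply $\overline{\llbracket(\mathsf{new}\,u)P\rrbracket_\Gamma}\Downarrow\llbracket x\rrbracket$. Semantic bisimilarity on $\mathcal T(\mathcal N^{\otimes|\Gamma|},\mathcal P)$ is the union of all symmetric relations $S$ such that $f\,S\,g$ implies: if $f\Rightarrow^{comm}\llbracket P'\rrbracket_\Gamma$ for a process $P'$ then $g\Rightarrow^{comm}\llbracket Q'\rrbracket_\Gamma$ with $\llbracket P'\rrbracket_\Gamma\,S\,\llbracket Q'\rrbracket_\Gamma$ for some process $Q'$; and if $\bar f\Downarrow\llbracket x\rrbracket$ then $\bar g\Downarrow\llbracket x\rrbracket$. For $f,g:\mathcal N^{\otimes|\Lambda|}\to\mathcal P$ write $f\stackrel{\centerdot}{\simeq}g$ if $\llbracket C\rrbracket_{\Lambda,\Gamma}(f)$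 and $\llbracket C\rrbracket_{\Lambda,\Gamma}(g)$ are semantically bisimilar for every context $C$ and every $\Gamma$ as above. Then for all processes $P,Q$ and every finite list $\Lambda$ of names containing $\mathrm{FN}(P)\cup\mathrm{FN}(Q)$, $$P\simeq Q\iff\llbracket P\rrbracket_\Lambda\stackrel{\centerdot}{\simeq}\llbracket Q\rrbracket_\Lambda .$$ -/

import Mathlib

open CategoryTheory MonoidalCategory

noncomputable section

namespace PiCalc

universe u

/-! ## The calculus -/

/-- Processes over a set of names. The parameters of an input are pairwise distinct. -/
inductive Proc (Name : Type u) : Type u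
  /-- the stopped process -/
  | nil : Proc Name
  /-- the input `x?(y₁, …, yₙ) ⇒ P` -/
  | inp (x : Name) (ys : List Name) (nodup : ys.Nodup) (P : Proc Name) : Proc Name
  /-- the output `x!(y₁, …, yₙ)` -/
  | out (x : Name) (ys : List Name) : Proc Name
  /-- the new channel `(new x) P` -/
  | new (x : Name) (P : Proc Name) : Proc Name
  /-- the parallel composition `P | Q` -/
  | par (P Q : Proc Name) : Proc Name

/-- Process contexts: processes with exactly one hole. -/
inductive Ctx (Name : Type u) : Type u
  | hole : Ctx Name
  | inp (x : Name) (ys : List Name) (nodup : ys.Nodup) (C : Ctx Name) : Ctx Name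
  | new (x : Name) (C : Ctx Name) : Ctx Name
  | parL (C : Ctx Name) (Q : Proc Name) : Ctx Name
  | parR (Q : Proc Name) (C : Ctx Name) : Ctx Name

section Calculus

variable {Name : Type u}

/-- `C[P]`; the binders of `C` around the hole capture names of `P`. -/
def Ctx.fill : Ctx Name → Proc Name → Proc Name
  | .hole, P => P
  | .inp x ys nd C, P => .inp x ys nd (C.fill P)
  | .new x C, P => .new x (C.fill P)
  | .parL C Q, P => .par (C.fill P) Q
  | .parR Q C, P => .par Q (C.fill P)

variable [DecidableEq Name]

/-- The free names of a process. -/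
def Proc.fn : Proc Name → Finset Name
  | .nil => ∅
  | .inp x ys _ P => insert x (P.fn \ ys.toFinset)
  | .out x ys => insert x ys.toFinset
  | .new x P => P.fn.erase x
  | .par P Q => P.fn ∪ Q.fn

/-- The map sending `ys` to `zs` entry by entry, and any other name `w` to `σ w`. -/
def assign (σ : Name → Name) : List Name → List Name → Name → Name
  | y :: ys, z :: zs => Function.update (assign σ ys zs) y z
  | _, _ => σ

variable [Infinite Name]

set_option linter.unusedSectionVars false

/-- A name outside a finite set. -/
def freshName (s : Finset Name) : Name := (Infinite.exists_notMem_finset s).choose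

theorem freshName_notMem (s : Finset Name) : freshName s ∉ s :=
  (Infinite.exists_notMem_finset s).choose_spec

/-- `n` pairwise distinct names outside a finite set. -/
def freshList (s : Finset Name) : ℕ → List Name
  | 0 => []
  | n + 1 => freshName s :: freshList (insert (freshName s) s) n

theorem freshList_notMem (n : ℕ) : ∀ (s : Finset Name), ∀ x ∈ freshList s n, x ∉ s := by
  induction n with
  | zero => intro s x hx; simp [freshList] at hx
  | succ n ih =>
    intro s x hx
    rcases List.mem_cons.1 hx with rfl | hx
    · exact freshName_notMem s
    · exact fun h => ih _ x hx (Finset.mem_insert_of_mem h)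

theorem freshList_nodup (n : ℕ) : ∀ s : Finset Name, (freshList s n).Nodup := by
  induction n with
  | zero => intro s; simp [freshList]
  | succ n ih =>
    intro s
    exact List.nodup_cons.2
      ⟨fun h => freshList_notMem n _ _ h (Finset.mem_insert_self _ _), ih _⟩

/-- Simultaneous capture-avoiding substitution of names: every free name `w` becomes `σ w`, and
every binder is renamed to names that do not clash. -/
def Proc.subst : (Name → Name) → Proc Name → Proc Name
  | _, .nil => .nil
  | σ, .inp x ys _ P =>
      let zs := freshList ((P.fn \ ys.toFinset).image σ) ys.length
      .inp (σ x) zs (freshList_nodup _ _) (P.subst (assign σ ys zs))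
  | σ, .out x ys => .out (σ x) (ys.map σ)
  | σ, .new x P =>
      let z := freshName ((P.fn.erase x).image σ)
      .new z (P.subst (Function.update σ x z))
  | σ, .par P Q => .par (P.subst σ) (Q.subst σ)

/-- `P{zs/ys}`. -/
def Proc.subs (P : Proc Name) (ys zs : List Name) : Proc Name := P.subst (assign id ys zs)

/-- α-equivalence: the least congruence that allows the renaming of bound names. -/
inductive AlphaEq : Proc Name → Proc Name → Prop
  | refl (P) : AlphaEq P P
  | symm {P Q} : AlphaEq P Q → AlphaEq Q P
  | trans {P Q R} : AlphaEq P Q → AlphaEq Q R → AlphaEq P R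
  | inp {P Q} (x ys nd) : AlphaEq P Q → AlphaEq (.inp x ys nd P) (.inp x ys nd Q)
  | new {P Q} (x) : AlphaEq P Q → AlphaEq (.new x P) (.new x Q)
  | par {P P' Q Q'} : AlphaEq P P' → AlphaEq Q Q' → AlphaEq (.par P Q) (.par P' Q')
  | inp_rename (x ys nd P zs) (nd' : zs.Nodup) : ys.length = zs.length →
      (∀ z ∈ zs, z ∈ P.fn → z ∈ ys) → AlphaEq (.inp x ys nd P) (.inp x zs nd' (P.subs ys zs))
  | new_rename (x P z) : (z ∈ P.fn → z = x) → AlphaEq (.new x P) (.new z (P.subs [x] [z]))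

/-- Structural congruence. -/
inductive StructCong : Proc Name → Proc Name → Prop
  | refl (P) : StructCong P P
  | symm {P Q} : StructCong P Q → StructCong Q P
  | trans {P Q R} : StructCong P Q → StructCong Q R → StructCong P R
  | inp {P Q} (x ys nd) : StructCong P Q → StructCong (.inp x ys nd P) (.inp x ys nd Q)
  | new {P Q} (x) : StructCong P Q → StructCong (.new x P) (.new x Q)
  | par {P P' Q Q'} : StructCong P P' → StructCong Q Q' → StructCong (.par P Q) (.par P' Q')
  | alpha {P Q} : AlphaEq P Q → StructCong P Q
  | par_assoc (P Q R) : StructCong (.par (.par P Q) R) (.par P (.par Q R))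
  | par_comm (P Q) : StructCong (.par P Q) (.par Q P)
  | par_nil (P) : StructCong (.par P .nil) P
  | new_idem (x P) : StructCong (.new x (.new x P)) (.new x P)
  | new_swap (x y P) : StructCong (.new x (.new y P)) (.new y (.new x P))
  | new_par (x P Q) : x ∉ Q.fn → StructCong (.par (.new x P) Q) (.new x (.par P Q))

/-- The reduction relation. -/
inductive Red : Proc Name → Proc Name → Prop
  | comm (x ys nd P zs) : ys.length = zs.length →
      Red (.par (.inp x ys nd P) (.out x zs)) (P.subs ys zs)
  | par {P P'} (Q) : Red P P' → Red (.par P Q) (.par P' Q)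
  | new {P P'} (x) : Red P P' → Red (.new x P) (.new x P')
  | equiv {P P' Q Q'} : StructCong P P' → Red P' Q' → StructCong Q' Q → Red P Q

/-- The observation relation `P ↓ x`. -/
inductive Barb : Proc Name → Name → Prop
  | out (x ys) : Barb (.out x ys) x
  | par_left {P x} (Q) : Barb P x → Barb (.par P Q) x
  | par_right {Q x} (P) : Barb Q x → Barb (.par P Q) x
  | new {P x} (y) : Barb P x → x ≠ y → Barb (.new y P) x

/-- Barbed bisimulations. -/
def IsBarbedBisimulation (S : Proc Name → Proc Name → Prop) : Prop :=
  (∀ P Q, S P Q → S Q P) ∧ ∀ P Q, S P Q →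
    (∀ P', Red P P' → ∃ Q', Red Q Q' ∧ S P' Q') ∧ ∀ x, Barb P x → Barb Q x

/-- Barbed bisimilarity. -/
def Bisimilar (P Q : Proc Name) : Prop := ∃ S, IsBarbedBisimulation S ∧ S P Q

/-- Syntactic contextual congruence. -/
def ContextualCongruent (P Q : Proc Name) : Prop :=
  ∀ C : Ctx Name, Bisimilar (C.fill P) (C.fill Q)

end Calculus

/-! ## The theory: a free symmetric monoidal closed 2-category -/

/-- Objects: freely generated by `N` (names) and `P` (processes) under unit, tensor and
internal hom. -/
inductive Ob (Name : Type u) : Type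
  | N : Ob Name
  | P : Ob Name
  | unit : Ob Name
  | tensor (X Y : Ob Name) : Ob Name
  | hom (X Y : Ob Name) : Ob Name

section Theory

variable {Name : Type u}

/-- The tensor power `N^{⊗ n}`. -/
def Ob.pow : ℕ → Ob Name
  | 0 => .unit
  | n + 1 => .tensor .N (Ob.pow n)

/-- Formal 1-morphisms. -/
inductive Term : Ob Name → Ob Name → Type u
  -- category structure
  | id (X) : Term X X
  | comp {X Y Z} (f : Term X Y) (g : Term Y Z) : Term X Z
  -- symmetric monoidal structure
  | tensor {X Y X' Y'} (f : Term X Y) (g : Term X' Y') : Term (.tensor X X') (.tensor Y Y')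
  | assocHom (X Y Z) : Term (.tensor (.tensor X Y) Z) (.tensor X (.tensor Y Z))
  | assocInv (X Y Z) : Term (.tensor X (.tensor Y Z)) (.tensor (.tensor X Y) Z)
  | leftHom (X) : Term (.tensor .unit X) X
  | leftInv (X) : Term X (.tensor .unit X)
  | rightHom (X) : Term (.tensor X .unit) X
  | rightInv (X) : Term X (.tensor X .unit)
  | braid (X Y) : Term (.tensor X Y) (.tensor Y X)
  -- closed structure
  | ev (X Y) : Term (.tensor X (.hom X Y)) Y
  | curry {X Y Z} (f : Term (.tensor X Y) Z) : Term Y (.hom X Z)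
  -- generators
  | dup : Term .N (.tensor .N .N)
  | del : Term .N .unit
  | par : Term (.tensor .P .P) .P
  | nil : Term .unit .P
  | inp (n : ℕ) : Term (.tensor .N (.hom (Ob.pow n) .P)) .P
  | out (n : ℕ) : Term (.tensor .N (Ob.pow n)) .P
  | fresh : Term .unit .N
  | COMM : Term .unit .P
  | name (x : Name) : Term .unit .N

/-- The equations between formal 1-morphisms: those of a symmetric monoidal closed category,
those making `(P, |, 0)` a commutative monoid, and those making `(N, dup, del)` a cocommutative
comonoid. -/
inductive TermEq : ∀ {X Y : Ob Name}, Term X Y → Term X Y → Prop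
  | refl {X Y} (f : Term X Y) : TermEq f f
  | symm {X Y} {f g : Term X Y} : TermEq f g → TermEq g f
  | trans {X Y} {f g h : Term X Y} : TermEq f g → TermEq g h → TermEq f h
  | comp {X Y Z} {f f' : Term X Y} {g g' : Term Y Z} :
      TermEq f f' → TermEq g g' → TermEq (f.comp g) (f'.comp g')
  | tensor {X Y X' Y'} {f f' : Term X Y} {g g' : Term X' Y'} :
      TermEq f f' → TermEq g g' → TermEq (f.tensor g) (f'.tensor g')
  | curry {X Y Z} {f f' : Term (.tensor X Y) Z} : TermEq f f' → TermEq f.curry f'.curry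
  -- category
  | id_comp {X Y} (f : Term X Y) : TermEq ((Term.id X).comp f) f
  | comp_id {X Y} (f : Term X Y) : TermEq (f.comp (Term.id Y)) f
  | assoc {W X Y Z} (f : Term W X) (g : Term X Y) (h : Term Y Z) :
      TermEq ((f.comp g).comp h) (f.comp (g.comp h))
  -- monoidal category
  | tensor_id (X Y) : TermEq ((Term.id X).tensor (Term.id Y)) (Term.id (.tensor X Y))
  | tensor_comp {X Y Z X' Y' Z'} (f : Term X Y) (f' : Term X' Y') (g : Term Y Z)
      (g' : Term Y' Z') :
      TermEq ((f.tensor f').comp (g.tensor g')) ((f.comp g).tensor (f'.comp g'))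
  | assoc_hom_inv (X Y Z) : TermEq ((Term.assocHom X Y Z).comp (Term.assocInv X Y Z)) (Term.id _)
  | assoc_inv_hom (X Y Z) : TermEq ((Term.assocInv X Y Z).comp (Term.assocHom X Y Z)) (Term.id _)
  | left_hom_inv (X) : TermEq ((Term.leftHom X).comp (Term.leftInv X)) (Term.id _)
  | left_inv_hom (X) : TermEq ((Term.leftInv X).comp (Term.leftHom X)) (Term.id _)
  | right_hom_inv (X) : TermEq ((Term.rightHom X).comp (Term.rightInv X)) (Term.id _)
  | right_inv_hom (X) : TermEq ((Term.rightInv X).comp (Term.rightHom X)) (Term.id _)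
  | assoc_nat {X Y X' Y' X'' Y''} (f : Term X Y) (f' : Term X' Y') (f'' : Term X'' Y'') :
      TermEq (((f.tensor f').tensor f'').comp (Term.assocHom Y Y' Y''))
        ((Term.assocHom X X' X'').comp (f.tensor (f'.tensor f'')))
  | left_nat {X Y} (f : Term X Y) :
      TermEq (((Term.id .unit).tensor f).comp (Term.leftHom Y)) ((Term.leftHom X).comp f)
  | right_nat {X Y} (f : Term X Y) :
      TermEq ((f.tensor (Term.id .unit)).comp (Term.rightHom Y)) ((Term.rightHom X).comp f)
  | pentagon (W X Y Z) :
      TermEq (((Term.assocHom W X Y).tensor (Term.id Z)).comp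
          ((Term.assocHom W (.tensor X Y) Z).comp ((Term.id W).tensor (Term.assocHom X Y Z))))
        ((Term.assocHom (.tensor W X) Y Z).comp (Term.assocHom W X (.tensor Y Z)))
  | triangle (X Y) :
      TermEq ((Term.assocHom X .unit Y).comp ((Term.id X).tensor (Term.leftHom Y)))
        ((Term.rightHom X).tensor (Term.id Y))
  -- symmetry
  | braid_nat {X Y X' Y'} (f : Term X Y) (f' : Term X' Y') :
      TermEq ((f.tensor f').comp (Term.braid Y Y')) ((Term.braid X X').comp (f'.tensor f))
  | braid_braid (X Y) : TermEq ((Term.braid X Y).comp (Term.braid Y X)) (Term.id _)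
  | hexagon (X Y Z) :
      TermEq ((Term.assocHom X Y Z).comp
          ((Term.braid X (.tensor Y Z)).comp (Term.assocHom Y Z X)))
        (((Term.braid X Y).tensor (Term.id Z)).comp
          ((Term.assocHom Y X Z).comp ((Term.id Y).tensor (Term.braid X Z))))
  | hexagon_rev (X Y Z) :
      TermEq ((Term.assocInv X Y Z).comp
          ((Term.braid (.tensor X Y) Z).comp (Term.assocInv Z X Y)))
        (((Term.id X).tensor (Term.braid Y Z)).comp
          ((Term.assocInv X Z Y).comp ((Term.braid X Z).tensor (Term.id Y))))
  -- closedness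
  | curry_beta {X Y Z} (f : Term (.tensor X Y) Z) :
      TermEq (((Term.id X).tensor f.curry).comp (Term.ev X Z)) f
  | curry_eta {X Y Z} (g : Term Y (.hom X Z)) :
      TermEq (((Term.id X).tensor g).comp (Term.ev X Z)).curry g
  -- `(P, |, 0)` is a commutative monoid
  | par_nil : TermEq (((Term.id .P).tensor Term.nil).comp Term.par) (Term.rightHom .P)
  | par_assoc : TermEq ((Term.par.tensor (Term.id .P)).comp Term.par)
      ((Term.assocHom .P .P .P).comp (((Term.id .P).tensor Term.par).comp Term.par))
  | par_comm : TermEq ((Term.braid .P .P).comp Term.par) Term.par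
  -- `(N, dup, del)` is a cocommutative comonoid
  | dup_del : TermEq (Term.dup.comp ((Term.id .N).tensor Term.del)) (Term.rightInv .N)
  | dup_assoc : TermEq (Term.dup.comp ((Term.dup.tensor (Term.id .N)).comp
      (Term.assocHom .N .N .N))) (Term.dup.comp ((Term.id .N).tensor Term.dup))
  | dup_comm : TermEq (Term.dup.comp (Term.braid .N .N)) Term.dup

instance termSetoid (X Y : Ob Name) : Setoid (Term X Y) :=
  ⟨TermEq, ⟨TermEq.refl, TermEq.symm, TermEq.trans⟩⟩

/-- The underlying category: 1-morphisms are formal 1-morphisms modulo the equations. -/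
instance : Category.{u} (Ob Name) where
  Hom X Y := Quotient (termSetoid X Y)
  id X := ⟦Term.id X⟧
  comp := Quotient.map₂ Term.comp fun _ _ hf _ _ hg => TermEq.comp hf hg
  id_comp := by
    rintro X Y ⟨f⟩
    exact Quotient.sound (TermEq.id_comp f)
  comp_id := by
    rintro X Y ⟨f⟩
    exact Quotient.sound (TermEq.comp_id f)
  assoc := by
    rintro W X Y Z ⟨f⟩ ⟨g⟩ ⟨h⟩
    exact Quotient.sound (TermEq.assoc f g h)

/-- The class of a formal 1-morphism. -/
def Term.mk {X Y : Ob Name} (f : Term X Y) : X ⟶ Y := Quotient.mk _ f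

instance : MonoidalCategoryStruct (Ob Name) where
  tensorObj := Ob.tensor
  tensorUnit := Ob.unit
  tensorHom := Quotient.map₂ Term.tensor fun _ _ hf _ _ hg => TermEq.tensor hf hg
  whiskerLeft X _ _ := Quotient.map (Term.tensor (Term.id X)) fun _ _ h =>
    TermEq.tensor (TermEq.refl _) h
  whiskerRight f Y := Quotient.map (fun f => Term.tensor f (Term.id Y)) (fun _ _ h =>
    TermEq.tensor h (TermEq.refl _)) f
  associator X Y Z := ⟨(Term.assocHom X Y Z).mk, (Term.assocInv X Y Z).mk,
    Quotient.sound (TermEq.assoc_hom_inv X Y Z), Quotient.sound (TermEq.assoc_inv_hom X Y Z)⟩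
  leftUnitor X := ⟨(Term.leftHom X).mk, (Term.leftInv X).mk,
    Quotient.sound (TermEq.left_hom_inv X), Quotient.sound (TermEq.left_inv_hom X)⟩
  rightUnitor X := ⟨(Term.rightHom X).mk, (Term.rightInv X).mk,
    Quotient.sound (TermEq.right_hom_inv X), Quotient.sound (TermEq.right_inv_hom X)⟩

instance : MonoidalCategory (Ob Name) :=
  MonoidalCategory.ofTensorHom
    (id_tensorHom_id := fun X Y => Quotient.sound (TermEq.tensor_id X Y))
    (id_tensorHom := by
      rintro X Y Z ⟨f⟩
      rfl)
    (tensorHom_id := by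
      rintro X Y ⟨f⟩ Z
      rfl)
    (tensorHom_comp_tensorHom := by
      rintro X Y Z X' Y' Z' ⟨f⟩ ⟨f'⟩ ⟨g⟩ ⟨g'⟩
      exact Quotient.sound (TermEq.tensor_comp f f' g g'))
    (associator_naturality := by
      rintro X X' X'' Y Y' Y'' ⟨f⟩ ⟨f'⟩ ⟨f''⟩
      exact Quotient.sound (TermEq.assoc_nat f f' f''))
    (leftUnitor_naturality := by
      rintro X Y ⟨f⟩
      exact Quotient.sound (TermEq.left_nat f))
    (rightUnitor_naturality := by
      rintro X Y ⟨f⟩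
      exact Quotient.sound (TermEq.right_nat f))
    (pentagon := fun W X Y Z => Quotient.sound (TermEq.pentagon W X Y Z))
    (triangle := fun X Y => Quotient.sound (TermEq.triangle X Y))

instance : SymmetricCategory (Ob Name) where
  braiding X Y := ⟨(Term.braid X Y).mk, (Term.braid Y X).mk,
    Quotient.sound (TermEq.braid_braid X Y), Quotient.sound (TermEq.braid_braid Y X)⟩
  braiding_naturality_right := by
    rintro X Y Z ⟨f⟩
    exact Quotient.sound (TermEq.braid_nat (Term.id X) f)
  braiding_naturality_left := by
    rintro X Y ⟨f⟩ Z
    exact Quotient.sound (TermEq.braid_nat f (Term.id Z))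
  hexagon_forward := fun X Y Z => Quotient.sound (TermEq.hexagon X Y Z)
  hexagon_reverse := fun X Y Z => Quotient.sound (TermEq.hexagon_rev X Y Z)
  symmetry := fun X Y => Quotient.sound (TermEq.braid_braid X Y)

/-- Evaluation. -/
def ev (X Y : Ob Name) : X ⊗ Ob.hom X Y ⟶ Y := (Term.ev X Y).mk

/-- Currying of 1-morphisms. -/
def curry {X Y Z : Ob Name} : (X ⊗ Y ⟶ Z) → (Y ⟶ Ob.hom X Z) :=
  Quotient.map Term.curry fun _ _ h => TermEq.curry h

theorem curry_beta {X Y Z : Ob Name} (f : X ⊗ Y ⟶ Z) : (X ◁ curry f) ≫ ev X Z = f := by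
  revert f
  rintro ⟨f⟩
  exact Quotient.sound (TermEq.curry_beta f)

theorem curry_eta {X Y Z : Ob Name} (g : Y ⟶ Ob.hom X Z) : curry ((X ◁ g) ≫ ev X Z) = g := by
  revert g
  rintro ⟨g⟩
  exact Quotient.sound (TermEq.curry_eta g)

/-- The underlying category is monoidal closed, with internal hom `Ob.hom`. -/
instance : MonoidalClosed (Ob Name) where
  closed X :=
    { rightAdj := _
      adj := Adjunction.adjunctionOfEquivRight (F := tensorLeft X) (G_obj := Ob.hom X)
        (fun Y Z =>
          { toFun := curry
            invFun := fun g => (X ◁ g) ≫ ev X Z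
            left_inv := curry_beta
            right_inv := curry_eta })
        (by
          intro Y' Y Z f g
          change curry ((X ◁ f) ≫ g) = f ≫ curry g
          rw [← curry_eta (f ≫ curry g), MonoidalCategory.whiskerLeft_comp, Category.assoc,
            curry_beta]) }

/-! The generating 1-morphisms. -/

/-- Comultiplication `N ⟶ N ⊗ N`. -/
def dup : (Ob.N : Ob Name) ⟶ .N ⊗ .N := Term.dup.mk
/-- Counit `N ⟶ I`. -/
def del : (Ob.N : Ob Name) ⟶ 𝟙_ _ := Term.del.mk
/-- Parallel composition `P ⊗ P ⟶ P`. -/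
def par : (Ob.P : Ob Name) ⊗ .P ⟶ .P := Term.par.mk
/-- The stopped process `I ⟶ P`. -/
def nil : 𝟙_ (Ob Name) ⟶ .P := Term.nil.mk
/-- Input `N ⊗ (N^{⊗ n} ⊸ P) ⟶ P`. -/
def inp (n : ℕ) : (Ob.N : Ob Name) ⊗ Ob.hom (Ob.pow n) .P ⟶ .P := (Term.inp n).mk
/-- Output `N ⊗ N^{⊗ n} ⟶ P`. -/
def out (n : ℕ) : (Ob.N : Ob Name) ⊗ Ob.pow n ⟶ .P := (Term.out n).mk
/-- The source of new names `I ⟶ N`. -/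
def fresh : 𝟙_ (Ob Name) ⟶ .N := Term.fresh.mk
/-- The catalyst `I ⟶ P`. -/
def COMM : 𝟙_ (Ob Name) ⟶ .P := Term.COMM.mk
/-- The 1-morphism `I ⟶ N` which picks out the name `x`. -/
def name (x : Name) : 𝟙_ (Ob Name) ⟶ .N := (Term.name x).mk

/-- `f | COMM`. -/
def withCOMM {X : Ob Name} (f : X ⟶ .P) : X ⟶ .P := f ≫ (ρ_ Ob.P).inv ≫ (Ob.P ◁ COMM) ≫ par

/-- The source of `comm_n`: on a channel, an `n`-tuple of names and a continuation, it is
`(output | input) | COMM`, with output and input on the same channel. -/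
def commSrc (n : ℕ) :
    (Ob.N : Ob Name) ⊗ (Ob.pow n ⊗ Ob.hom (Ob.pow n) .P) ⟶ .P :=
  withCOMM ((dup ▷ (Ob.pow n ⊗ Ob.hom (Ob.pow n) .P)) ≫
    tensorμ .N .N (Ob.pow n) (Ob.hom (Ob.pow n) .P) ≫ (out n ⊗ₘ inp n) ≫ par)

/-- The target of `comm_n`: the channel is deleted, and the continuation is evaluated at the
tuple of names, in parallel with `COMM`. -/
def commTgt (n : ℕ) :
    (Ob.N : Ob Name) ⊗ (Ob.pow n ⊗ Ob.hom (Ob.pow n) .P) ⟶ .P :=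
  withCOMM ((del ⊗ₘ ev (Ob.pow n) .P) ≫ (λ_ Ob.P).hom)

/-- Formal 2-morphisms. -/
inductive Cell : ∀ {X Y : Ob Name}, (X ⟶ Y) → (X ⟶ Y) → Type u
  | id {X Y : Ob Name} (f : X ⟶ Y) : Cell f f
  /-- the generating 2-morphisms -/
  | comm (n : ℕ) : Cell (commSrc n) (commTgt n)
  /-- vertical composition -/
  | vcomp {X Y : Ob Name} {f g h : X ⟶ Y} (s : Cell f g) (t : Cell g h) : Cell f h
  /-- horizontal composition -/
  | hcomp {X Y Z : Ob Name} {f g : X ⟶ Y} {f' g' : Y ⟶ Z} (s : Cell f g) (t : Cell f' g') :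
      Cell (f ≫ f') (g ≫ g')
  | tensor {X Y X' Y' : Ob Name} {f g : X ⟶ Y} {f' g' : X' ⟶ Y'} (s : Cell f g)
      (t : Cell f' g') : Cell (f ⊗ₘ f') (g ⊗ₘ g')
  | curry {X Y Z : Ob Name} {f g : X ⊗ Y ⟶ Z} (s : Cell f g) : Cell (curry f) (curry g)

/-- The equations between formal 2-morphisms: those of a 2-category with 2-functorial tensor,
2-natural structure isomorphisms and a 2-natural currying bijection. The two sides of some of
these equations have sources and targets that are equal 1-morphisms, but not definitionally so. -/
inductive CellEq : ∀ {X Y : Ob Name} {f g f' g' : X ⟶ Y}, Cell f g → Cell f' g' → Prop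
  | refl {X Y : Ob Name} {f g : X ⟶ Y} (s : Cell f g) : CellEq s s
  | symm {X Y : Ob Name} {f g f' g' : X ⟶ Y} {s : Cell f g} {t : Cell f' g'} :
      CellEq s t → CellEq t s
  | trans {X Y : Ob Name} {f g f' g' f'' g'' : X ⟶ Y} {s : Cell f g} {t : Cell f' g'}
      {r : Cell f'' g''} : CellEq s t → CellEq t r → CellEq s r
  | vcomp {X Y : Ob Name} {f g h f' g' h' : X ⟶ Y} {s : Cell f g} {t : Cell g h}
      {s' : Cell f' g'} {t' : Cell g' h'} :
      CellEq s s' → CellEq t t' → CellEq (s.vcomp t) (s'.vcomp t')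
  | hcomp {X Y Z : Ob Name} {f g f' g' : X ⟶ Y} {h k h' k' : Y ⟶ Z} {s : Cell f g}
      {s' : Cell f' g'} {t : Cell h k} {t' : Cell h' k'} :
      CellEq s s' → CellEq t t' → CellEq (s.hcomp t) (s'.hcomp t')
  | tensor {X Y X' Y' : Ob Name} {f g f' g' : X ⟶ Y} {h k h' k' : X' ⟶ Y'} {s : Cell f g}
      {s' : Cell f' g'} {t : Cell h k} {t' : Cell h' k'} :
      CellEq s s' → CellEq t t' → CellEq (s.tensor t) (s'.tensor t')
  | curry {X Y Z : Ob Name} {f g f' g' : X ⊗ Y ⟶ Z} {s : Cell f g} {s' : Cell f' g'} :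
      CellEq s s' → CellEq s.curry s'.curry
  -- vertical composition makes every hom-set a category
  | id_vcomp {X Y : Ob Name} {f g : X ⟶ Y} (s : Cell f g) : CellEq ((Cell.id f).vcomp s) s
  | vcomp_id {X Y : Ob Name} {f g : X ⟶ Y} (s : Cell f g) : CellEq (s.vcomp (Cell.id g)) s
  | vcomp_assoc {X Y : Ob Name} {f g h k : X ⟶ Y} (s : Cell f g) (t : Cell g h) (r : Cell h k) :
      CellEq ((s.vcomp t).vcomp r) (s.vcomp (t.vcomp r))
  -- horizontal composition is functorial, unital and associative
  | hcomp_id {X Y Z : Ob Name} (f : X ⟶ Y) (g : Y ⟶ Z) :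
      CellEq ((Cell.id f).hcomp (Cell.id g)) (Cell.id (f ≫ g))
  | hcomp_vcomp {X Y Z : Ob Name} {f g h : X ⟶ Y} {f' g' h' : Y ⟶ Z} (s : Cell f g)
      (t : Cell g h) (s' : Cell f' g') (t' : Cell g' h') :
      CellEq ((s.vcomp t).hcomp (s'.vcomp t')) ((s.hcomp s').vcomp (t.hcomp t'))
  | id_hcomp {X Y : Ob Name} {f g : X ⟶ Y} (s : Cell f g) :
      CellEq ((Cell.id (𝟙 X)).hcomp s) s
  | hcomp_id_one {X Y : Ob Name} {f g : X ⟶ Y} (s : Cell f g) :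
      CellEq (s.hcomp (Cell.id (𝟙 Y))) s
  | hcomp_assoc {W X Y Z : Ob Name} {f g : W ⟶ X} {f' g' : X ⟶ Y} {f'' g'' : Y ⟶ Z}
      (s : Cell f g) (t : Cell f' g') (r : Cell f'' g'') :
      CellEq ((s.hcomp t).hcomp r) (s.hcomp (t.hcomp r))
  -- the tensor is a 2-functor
  | tensor_id {X Y X' Y' : Ob Name} (f : X ⟶ Y) (g : X' ⟶ Y') :
      CellEq ((Cell.id f).tensor (Cell.id g)) (Cell.id (f ⊗ₘ g))
  | tensor_vcomp {X Y X' Y' : Ob Name} {f g h : X ⟶ Y} {f' g' h' : X' ⟶ Y'} (s : Cell f g)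
      (t : Cell g h) (s' : Cell f' g') (t' : Cell g' h') :
      CellEq ((s.vcomp t).tensor (s'.vcomp t')) ((s.tensor s').vcomp (t.tensor t'))
  | tensor_hcomp {X Y Z X' Y' Z' : Ob Name} {f g : X ⟶ Y} {h k : Y ⟶ Z} {f' g' : X' ⟶ Y'}
      {h' k' : Y' ⟶ Z'} (s : Cell f g) (t : Cell h k) (s' : Cell f' g') (t' : Cell h' k') :
      CellEq ((s.hcomp t).tensor (s'.hcomp t')) ((s.tensor s').hcomp (t.tensor t'))
  -- the structure isomorphisms are 2-natural
  | assoc_nat {X Y X' Y' X'' Y'' : Ob Name} {f g : X ⟶ Y} {f' g' : X' ⟶ Y'} {f'' g'' : X'' ⟶ Y''}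
      (s : Cell f g) (t : Cell f' g') (r : Cell f'' g'') :
      CellEq (((s.tensor t).tensor r).hcomp (Cell.id (α_ Y Y' Y'').hom))
        ((Cell.id (α_ X X' X'').hom).hcomp (s.tensor (t.tensor r)))
  | left_nat {X Y : Ob Name} {f g : X ⟶ Y} (s : Cell f g) :
      CellEq (((Cell.id (𝟙 (𝟙_ (Ob Name)))).tensor s).hcomp (Cell.id (λ_ Y).hom))
        ((Cell.id (λ_ X).hom).hcomp s)
  | right_nat {X Y : Ob Name} {f g : X ⟶ Y} (s : Cell f g) :
      CellEq ((s.tensor (Cell.id (𝟙 (𝟙_ (Ob Name))))).hcomp (Cell.id (ρ_ Y).hom))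
        ((Cell.id (ρ_ X).hom).hcomp s)
  | braid_nat {X Y X' Y' : Ob Name} {f g : X ⟶ Y} {f' g' : X' ⟶ Y'} (s : Cell f g)
      (t : Cell f' g') :
      CellEq ((s.tensor t).hcomp (Cell.id (β_ Y Y').hom))
        ((Cell.id (β_ X X').hom).hcomp (t.tensor s))
  -- currying is an isomorphism of hom-categories
  | curry_id {X Y Z : Ob Name} (f : X ⊗ Y ⟶ Z) :
      CellEq (Cell.id f).curry (Cell.id (PiCalc.curry f))
  | curry_vcomp {X Y Z : Ob Name} {f g h : X ⊗ Y ⟶ Z} (s : Cell f g) (t : Cell g h) :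
      CellEq (s.vcomp t).curry (s.curry.vcomp t.curry)
  | curry_beta {X Y Z : Ob Name} {f g : X ⊗ Y ⟶ Z} (s : Cell f g) :
      CellEq (((Cell.id (𝟙 X)).tensor s.curry).hcomp (Cell.id (ev X Z))) s
  | curry_eta {X Y Z : Ob Name} {f g : Y ⟶ Ob.hom X Z} (s : Cell f g) :
      CellEq (((Cell.id (𝟙 X)).tensor s).hcomp (Cell.id (ev X Z))).curry s

instance cellSetoid {X Y : Ob Name} (f g : X ⟶ Y) : Setoid (Cell f g) :=
  ⟨CellEq, ⟨CellEq.refl, CellEq.symm, CellEq.trans⟩⟩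

/-- The hom-categories: 2-morphisms are formal 2-morphisms modulo the equations, with vertical
composition. -/
instance homCategory (X Y : Ob Name) : Category.{u} (X ⟶ Y) where
  Hom f g := Quotient (cellSetoid f g)
  id f := ⟦Cell.id f⟧
  comp := Quotient.map₂ Cell.vcomp fun _ _ hs _ _ ht => CellEq.vcomp hs ht
  id_comp := by
    rintro f g ⟨s⟩
    exact Quotient.sound (CellEq.id_vcomp s)
  comp_id := by
    rintro f g ⟨s⟩
    exact Quotient.sound (CellEq.vcomp_id s)
  assoc := by
    rintro f g h k ⟨s⟩ ⟨t⟩ ⟨r⟩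
    exact Quotient.sound (CellEq.vcomp_assoc s t r)

/-- Horizontal composition as a functor on hom-categories. -/
def hcompFunctor (X Y Z : Ob Name) : (X ⟶ Y) × (Y ⟶ Z) ⥤ (X ⟶ Z) where
  obj p := p.1 ≫ p.2
  map a := Quotient.map₂ Cell.hcomp (fun _ _ hs _ _ ht => CellEq.hcomp hs ht) a.1 a.2
  map_id p := Quotient.sound (CellEq.hcomp_id p.1 p.2)
  map_comp := by
    rintro ⟨f, f'⟩ ⟨g, g'⟩ ⟨h, h'⟩ ⟨⟨s⟩, ⟨s'⟩⟩ ⟨⟨t⟩, ⟨t'⟩⟩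
    exact Quotient.sound (CellEq.hcomp_vcomp s t s' t')

/-- The tensor product as a functor on hom-categories. -/
def tensorFunctor (X Y X' Y' : Ob Name) : (X ⟶ Y) × (X' ⟶ Y') ⥤ (X ⊗ X' ⟶ Y ⊗ Y') where
  obj p := p.1 ⊗ₘ p.2
  map a := Quotient.map₂ Cell.tensor (fun _ _ hs _ _ ht => CellEq.tensor hs ht) a.1 a.2
  map_id p := Quotient.sound (CellEq.tensor_id p.1 p.2)
  map_comp := by
    rintro ⟨f, f'⟩ ⟨g, g'⟩ ⟨h, h'⟩ ⟨⟨s⟩, ⟨s'⟩⟩ ⟨⟨t⟩, ⟨t'⟩⟩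
    exact Quotient.sound (CellEq.tensor_vcomp s t s' t')

/-- Currying as a functor on hom-categories. -/
def curryFunctor (X Y Z : Ob Name) : (X ⊗ Y ⟶ Z) ⥤ (Y ⟶ Ob.hom X Z) where
  obj f := curry f
  map := Quotient.map Cell.curry fun _ _ hs => CellEq.curry hs
  map_id f := Quotient.sound (CellEq.curry_id f)
  map_comp := by
    rintro f g h ⟨s⟩ ⟨t⟩
    exact Quotient.sound (CellEq.curry_vcomp s t)

/-- `f ↦ h ≫ f`. -/
def precomp {W X : Ob Name} (h : W ⟶ X) (Y : Ob Name) : (X ⟶ Y) ⥤ (W ⟶ Y) :=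
  Functor.prod' ((Functor.const _).obj h) (𝟭 _) ⋙ hcompFunctor W X Y

/-- `f ↦ f ≫ h`. -/
def postcomp (X : Ob Name) {Y Z : Ob Name} (h : Y ⟶ Z) : (X ⟶ Y) ⥤ (X ⟶ Z) :=
  Functor.prod' (𝟭 _) ((Functor.const _).obj h) ⋙ hcompFunctor X Y Z

/-- `f ↦ h ⊗ f`. -/
def tensorOnLeft {X Y : Ob Name} (h : X ⟶ Y) (X' Y' : Ob Name) :
    (X' ⟶ Y') ⥤ (X ⊗ X' ⟶ Y ⊗ Y') :=
  Functor.prod' ((Functor.const _).obj h) (𝟭 _) ⋙ tensorFunctor X Y X' Y'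

/-- `f ↦ f ⊗ h`. -/
def tensorOnRight (X Y : Ob Name) {X' Y' : Ob Name} (h : X' ⟶ Y') :
    (X ⟶ Y) ⥤ (X ⊗ X' ⟶ Y ⊗ Y') :=
  Functor.prod' (𝟭 _) ((Functor.const _).obj h) ⋙ tensorFunctor X Y X' Y'

/-- The number of occurrences of generating 2-morphisms in a formal 2-morphism. -/
def Cell.commCount {X Y : Ob Name} {f g : X ⟶ Y} : Cell f g → ℕ
  | .id _ => 0
  | .comm _ => 1
  | .vcomp s t => s.commCount + t.commCount
  | .hcomp s t => s.commCount + t.commCount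
  | .tensor s t => s.commCount + t.commCount
  | .curry s => s.commCount

/-- All occurrences of generating 2-morphisms are at top level, that is, not under currying. -/
def Cell.TopLevel {X Y : Ob Name} {f g : X ⟶ Y} : Cell f g → Prop
  | .id _ => True
  | .comm _ => True
  | .vcomp s t => s.TopLevel ∧ t.TopLevel
  | .hcomp s t => s.TopLevel ∧ t.TopLevel
  | .tensor s t => s.TopLevel ∧ t.TopLevel
  | .curry s => s.commCount = 0

/-- The 2-morphism is generated by exactly one top-level occurrence of some `comm_n` and
compositions and tensor products with identity 2-morphisms. -/
def IsSingleComm {X Y : Ob Name} {f g : X ⟶ Y} (a : f ⟶ g) : Prop :=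
  ∃ s : Cell f g, Quotient.mk _ s = a ∧ s.commCount = 1 ∧ s.TopLevel

/-! ## The interpretation -/

/-- Deletion of a tuple of names. -/
def delPow : (n : ℕ) → ((Ob.pow n : Ob Name) ⟶ 𝟙_ (Ob Name))
  | 0 => 𝟙 _
  | n + 1 => (del ⊗ₘ delPow n) ≫ (λ_ _).hom

/-- Duplication of a tuple of names. -/
def dupPow : (n : ℕ) → ((Ob.pow n : Ob Name) ⟶ Ob.pow n ⊗ Ob.pow n)
  | 0 => (λ_ (𝟙_ (Ob Name))).inv
  | n + 1 => (dup ⊗ₘ dupPow n) ≫ tensorμ .N .N (Ob.pow n) (Ob.pow n)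

/-- The object `N^{⊗ |Γ|}` of values for the names in a list `Γ`. -/
abbrev env (Γ : List Name) : Ob Name := Ob.pow Γ.length

/-- Concatenation of tuples. -/
def concat : (ys Γ : List Name) → (env ys ⊗ env Γ ⟶ env (ys ++ Γ))
  | [], _ => (λ_ _).hom
  | _ :: ys, Γ => (α_ Ob.N (env ys) (env Γ)).hom ≫ (Ob.N ◁ concat ys Γ)

/-- The tuple of the names of `Γ`. -/
def names : (Γ : List Name) → (𝟙_ (Ob Name) ⟶ env Γ)
  | [] => 𝟙 _
  | x :: Γ => (λ_ _).inv ≫ (name x ⊗ₘ names Γ)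

variable [DecidableEq Name]

/-- The value of the name `x` in `Γ`: the first entry of `Γ` equal to `x` is selected and all
others are deleted. If `x` is not in `Γ`, the constant `name x` is returned. -/
def lookup : (Γ : List Name) → (x : Name) → (env Γ ⟶ Ob.N)
  | [], x => name x
  | y :: Γ, x =>
      if x = y then (Ob.N ◁ delPow Γ.length) ≫ (ρ_ _).hom
      else (del ▷ env Γ) ≫ (λ_ _).hom ≫ lookup Γ x

/-- The values in `Γ` of a list of names. -/
def lookups (Γ : List Name) : (ys : List Name) → (env Γ ⟶ env ys)
  | [] => delPow Γ.length
  | y :: ys => dupPow Γ.length ≫ (lookup Γ y ⊗ₘ lookups Γ ys)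

/-- `f | g`, where `f` and `g` share their names. -/
def parHom {Γ : List Name} (f g : env Γ ⟶ Ob.P) : env Γ ⟶ Ob.P :=
  dupPow Γ.length ≫ (f ⊗ₘ g) ≫ par

/-- The interpretation of a process whose free names are listed in `Γ`. -/
def Proc.den : Proc Name → (Γ : List Name) → (env Γ ⟶ Ob.P)
  | .nil, Γ => delPow Γ.length ≫ PiCalc.nil
  | .inp x ys _ P, Γ =>
      dupPow Γ.length ≫ (lookup Γ x ⊗ₘ curry (concat ys Γ ≫ P.den (ys ++ Γ))) ≫
        PiCalc.inp ys.length
  | .out x ys, Γ => dupPow Γ.length ≫ (lookup Γ x ⊗ₘ lookups Γ ys) ≫ PiCalc.out ys.length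
  | .new x P, Γ => (λ_ _).inv ≫ (fresh ▷ env Γ) ≫ P.den (x :: Γ)
  | .par P Q, Γ => parHom (P.den Γ) (Q.den Γ)

/-- The names `Γ` are available for `P`. -/
def Proc.InScope (P : Proc Name) (Γ : List Name) : Prop := ∀ x ∈ P.fn, x ∈ Γ

/-- With the names `Γ` available outside `C`, those of `Δ` are available at the hole, and `Γ` lists
all the free names of `C`. -/
def Ctx.InScope (Δ : List Name) : Ctx Name → List Name → Prop
  | .hole, Γ => ∀ x ∈ Δ, x ∈ Γ
  | .inp x ys _ C, Γ => x ∈ Γ ∧ C.InScope Δ (ys ++ Γ)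
  | .new x C, Γ => C.InScope Δ (x :: Γ)
  | .parL C Q, Γ => C.InScope Δ Γ ∧ Q.InScope Γ
  | .parR Q C, Γ => Q.InScope Γ ∧ C.InScope Δ Γ

/-- The interpretation of a context: a functor from the hom-category in which processes with free
names in `Δ` are interpreted to the one for free names in `Γ`. -/
def Ctx.den (Δ : List Name) : Ctx Name → (Γ : List Name) → ((env Δ ⟶ Ob.P) ⥤ (env Γ ⟶ Ob.P))
  | .hole, Γ => precomp (lookups Γ Δ) .P
  | .inp x ys _ C, Γ =>
      C.den Δ (ys ++ Γ) ⋙ precomp (concat ys Γ) .P ⋙ curryFunctor (env ys) (env Γ) .P ⋙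
        tensorOnLeft (lookup Γ x) (env Γ) (Ob.hom (env ys) .P) ⋙
          postcomp (env Γ ⊗ env Γ) (PiCalc.inp ys.length) ⋙ precomp (dupPow Γ.length) .P
  | .new x C, Γ =>
      C.den Δ (x :: Γ) ⋙ precomp (fresh ▷ env Γ) .P ⋙ precomp (λ_ (env Γ)).inv .P
  | .parL C Q, Γ =>
      C.den Δ Γ ⋙ tensorOnRight (env Γ) .P (Q.den Γ) ⋙ postcomp (env Γ ⊗ env Γ) PiCalc.par ⋙
        precomp (dupPow Γ.length) .P
  | .parR Q C, Γ =>
      C.den Δ Γ ⋙ tensorOnLeft (Q.den Γ) (env Γ) .P ⋙ postcomp (env Γ ⊗ env Γ) PiCalc.par ⋙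
        precomp (dupPow Γ.length) .P

/-! ## Semantic bisimilarity and contextual congruence -/

/-- `f` with the names `Γ` supplied. -/
def close (Γ : List Name) (f : env Γ ⟶ Ob.P) : 𝟙_ (Ob Name) ⟶ Ob.P := names Γ ≫ f

/-- The top-level interpretation: the names are supplied and `COMM` is put in parallel. -/
def top (Γ : List Name) (f : env Γ ⟶ Ob.P) : 𝟙_ (Ob Name) ⟶ Ob.P := withCOMM (close Γ f)

/-- The semantic reduction relation. -/
def CommStep (Γ : List Name) (f g : env Γ ⟶ Ob.P) : Prop :=
  ∃ a : top Γ f ⟶ top Γ g, IsSingleComm a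

/-- The semantic observation relation. -/
inductive SemBarb : (𝟙_ (Ob Name) ⟶ Ob.P) → (𝟙_ (Ob Name) ⟶ Ob.N) → Prop
  | out (Γ x ys) : (Proc.out x ys).InScope Γ →
      SemBarb (close Γ ((Proc.out x ys).den Γ)) (name x)
  | par_left {P x} (Q Γ) : (Proc.par P Q).InScope Γ → SemBarb (close Γ (P.den Γ)) (name x) →
      SemBarb (close Γ (parHom (P.den Γ) (Q.den Γ))) (name x)
  | par_right {Q x} (P Γ) : (Proc.par P Q).InScope Γ → SemBarb (close Γ (Q.den Γ)) (name x) →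
      SemBarb (close Γ (parHom (P.den Γ) (Q.den Γ))) (name x)
  | new {P x} (y Γ) : (Proc.new y P).InScope Γ → SemBarb (close (y :: Γ) (P.den (y :: Γ))) (name x) →
      x ≠ y → SemBarb (close Γ ((Proc.new y P).den Γ)) (name x)

/-- Semantic bisimulations between 1-morphisms with names `Γ`. -/
def IsSemBisimulation (Γ : List Name) (S : (env Γ ⟶ Ob.P) → (env Γ ⟶ Ob.P) → Prop) : Prop :=
  (∀ f g, S f g → S g f) ∧ ∀ f g, S f g →
    (∀ P' : Proc Name, P'.InScope Γ → CommStep Γ f (P'.den Γ) →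
      ∃ Q' : Proc Name, Q'.InScope Γ ∧ CommStep Γ g (Q'.den Γ) ∧ S (P'.den Γ) (Q'.den Γ)) ∧
    ∀ x : Name, SemBarb (close Γ f) (name x) → SemBarb (close Γ g) (name x)

/-- Semantic bisimilarity. -/
def SemBisimilar (Γ : List Name) (f g : env Γ ⟶ Ob.P) : Prop :=
  ∃ S, IsSemBisimulation Γ S ∧ S f g

/-- Semantic contextual congruence. -/
def SemContextualCongruent (Δ : List Name) (f g : env Δ ⟶ Ob.P) : Prop :=
  ∀ (C : Ctx Name) (Γ : List Name), C.InScope Δ Γ →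
    SemBisimilar Γ ((C.den Δ Γ).obj f) ((C.den Δ Γ).obj g)

end Theory

end PiCalc

end

/-!
A context is interpreted by the functor that maps the interpretation of `P` to the interpretation
of the filled context (`Ctx.den_obj_den`), and every context is in scope for some list of names. So
it suffices that two processes are barbed bisimilar if and only if their interpretations are
semantically bisimilar (`bisimilar_iff_semBisimilar`). For this, reductions and barbs of a process
are compared with those of its interpretation. The interpretation is not invariant under structural
congruence: the theory does not say that an unused new name, or an unused name, may be forgotten.
Conversely a 2-morphism is only known to exist between given 1-morphisms, whose representatives by
formal expressions are far from unique. Both difficulties are resolved by a model of the theory.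

*The model.* Names are interpreted by elements of `Name ⊕ ℕ`, the right summand being a supply of
new names, and processes by behaviours (`Beh`): multisets of outputs, inputs with functions as
continuations, and catalysts. These form a cancellative commutative monoid. Objects of the theory
become sets with a relation, 1-morphisms become functions that preserve the relations and depend on
a stream of new names, and two such functions are identified when they agree after a suitable
matching of their streams (`Same`); this is an equivalence relation by amalgamation of injections
(`exists_amalgam`). The relation on behaviours is communication in the presence of the catalyst.
The equations between 1-morphisms hold in the model (`TermEq.same_eval`), and a single top-level
`comm_n` is a step (`Cell.exists_rel`). As processes contain no catalyst, a step from a process in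
parallel with one catalyst is a communication at top level (`CommStep.exists_comm`).

*From behaviours to processes.* The behaviour `Proc.beh` of a process is invariant under structural
congruence, and reductions induce communications (`Red.comm_beh`). Conversely a communication of
the behaviour, for distinct new names, comes from a redex that can be exposed by the sound part
`Rearr` of structural congruence: bring the binders `new` to the front, then the output and the
input (`Proc.exists_surface`). It follows that processes with equal behaviours are bisimilar
(`BehEquiv.bisimilar`), and that barbs are determined by the interpretation (`semBarb_iff`).

*From processes to the theory.* The laws of `Rearr` are equations of the theory
(`Rearr.denote_eq`), and a communication at the surface is a single top-level `comm_n`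
(`Surface.oneComm`). Both are shown for an interpretation `Proc.denote` over an arbitrary
cocommutative comonoid instead of a tensor power of `N`, which is natural in the comonoid and
compatible with substitution.

Together, reductions and semantic reductions correspond up to bisimilarity of their results
(`Red.exists_commStep`, `CommStep.exists_red`), which is enough.
-/

namespace PiCalc

universe u

/-! ### Streams of names -/

section Streams

variable {A B C : Type*}

/-- The embedding of `ℕ` in `ℕ` onto the even numbers; `a ∘ evens` is the first half of the
stream `a`. -/
def evens (n : ℕ) : ℕ := 2 * n

/-- The embedding of `ℕ` in `ℕ` onto the odd numbers; `a ∘ odds` is the second half of the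
stream `a`. -/
def odds (n : ℕ) : ℕ := 2 * n + 1

theorem evens_injective : Function.Injective evens := fun m n h => by
  simp only [evens] at h; omega

theorem odds_injective : Function.Injective odds := fun m n h => by
  simp only [odds] at h; omega

/-- The stream with given halves. -/
def join (f g : ℕ → A) (m : ℕ) : A := if m % 2 = 0 then f (m / 2) else g (m / 2)

@[simp] theorem join_comp_evens (f g : ℕ → A) : join f g ∘ evens = f := by
  funext n; simp [join, evens]

@[simp] theorem join_comp_odds (f g : ℕ → A) : join f g ∘ odds = g := by
  funext n
  have h1 : (2 * n + 1) / 2 = n := by omega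
  simp [join, odds, h1]

theorem comp_join (h : A → B) (f g : ℕ → A) : h ∘ join f g = join (h ∘ f) (h ∘ g) := by
  funext n; simp only [join, Function.comp]; split <;> rfl

theorem join_injective {f g : ℕ → A} (h : Function.Injective (Sum.elim f g)) :
    Function.Injective (join f g) := by
  intro m n hmn
  simp only [join] at hmn
  have key : ∀ x y : ℕ ⊕ ℕ, Sum.elim f g x = Sum.elim f g y → x = y := fun x y hxy => h hxy
  split_ifs at hmn with h1 h2 h2
  · have := key (.inl (m / 2)) (.inl (n / 2)) hmn
    simp at this; omega
  · exact absurd (key (.inl (m / 2)) (.inr (n / 2)) hmn) (by simp)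
  · exact absurd (key (.inr (m / 2)) (.inl (n / 2)) hmn) (by simp)
  · have := key (.inr (m / 2)) (.inr (n / 2)) hmn
    simp at this; omega

/-- The stream with a given head and tail. -/
def scons (x : A) (f : ℕ → A) : ℕ → A
  | 0 => x
  | n + 1 => f n

theorem scons_injective {x : A} {f : ℕ → A} (hf : Function.Injective f) (hx : ∀ n, f n ≠ x) :
    Function.Injective (scons x f) := by
  intro m n h
  cases m <;> cases n <;> simp only [scons] at h
  · rfl
  · exact absurd h.symm (hx _)
  · exact absurd h (hx _)
  · rw [hf h]

@[simp] theorem scons_comp_succ (x : A) (f : ℕ → A) : scons x f ∘ Nat.succ = f := rfl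

/-- Amalgamation: two injections of one set into `ℕ` become equal after further injections
of `ℕ` into itself. -/
theorem exists_amalgam {s t : A → ℕ} (hs : Function.Injective s) (ht : Function.Injective t) :
    ∃ i j : ℕ → ℕ, Function.Injective i ∧ Function.Injective j ∧ ∀ k, i (s k) = j (t k) := by
  classical
  refine ⟨fun m => if h : ∃ k, s k = m then evens (t h.choose) else odds m, evens, ?_,
    evens_injective, ?_⟩
  · intro m n hmn
    by_cases h1 : ∃ k, s k = m <;> by_cases h2 : ∃ k, s k = n <;> simp only [h1, h2, dite_true,
      dite_false] at hmn
    · rw [← h1.choose_spec, ← h2.choose_spec, ht (evens_injective hmn)]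
    · simp only [evens, odds] at hmn; omega
    · simp only [evens, odds] at hmn; omega
    · exact odds_injective hmn
  · intro k
    have h : ∃ k', s k' = s k := ⟨k, rfl⟩
    simp only [h, dite_true]
    rw [hs h.choose_spec]

/-- Two quantities that depend on a stream of fresh names are the same if they agree once the
entries of the stream are matched suitably; entries that are not used may be dropped or added. -/
def Same (Φ Ψ : (ℕ → B) → A) : Prop :=
  ∃ i j : ℕ → ℕ, Function.Injective i ∧ Function.Injective j ∧ ∀ a, Φ (a ∘ i) = Ψ (a ∘ j)

theorem Same.refl (Φ : (ℕ → B) → A) : Same Φ Φ :=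
  ⟨_, _, Function.injective_id, Function.injective_id, fun _ => rfl⟩

theorem Same.of_eq {Φ Ψ : (ℕ → B) → A} (h : ∀ a, Φ a = Ψ a) : Same Φ Ψ :=
  ⟨_, _, Function.injective_id, Function.injective_id, h⟩

theorem Same.symm {Φ Ψ : (ℕ → B) → A} : Same Φ Ψ → Same Ψ Φ :=
  fun ⟨i, j, hi, hj, h⟩ => ⟨j, i, hj, hi, fun a => (h a).symm⟩

theorem Same.trans {Φ Ψ Θ : (ℕ → B) → A} : Same Φ Ψ → Same Ψ Θ → Same Φ Θ := by
  rintro ⟨i, j, hi, hj, h⟩ ⟨k, l, hk, hl, h'⟩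
  obtain ⟨p, q, hp, hq, hpq⟩ := exists_amalgam hj hk
  refine ⟨p ∘ i, q ∘ l, hp.comp hi, hq.comp hl, fun a => ?_⟩
  have e : (a ∘ p) ∘ j = (a ∘ q) ∘ k := funext fun n => congrArg a (hpq n)
  exact (h (a ∘ p)).trans ((congrArg Ψ e).trans (h' (a ∘ q)))

theorem Same.map {Φ Ψ : (ℕ → B) → A} (g : A → C) (h : Same Φ Ψ) :
    Same (fun a => g (Φ a)) fun a => g (Ψ a) :=
  let ⟨i, j, hi, hj, h⟩ := h
  ⟨i, j, hi, hj, fun a => congrArg g (h a)⟩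

theorem Same.reindex (Φ : (ℕ → B) → A) {s : ℕ → ℕ} (hs : Function.Injective s) :
    Same (fun a => Φ (a ∘ s)) Φ :=
  ⟨id, s, Function.injective_id, hs, fun _ => rfl⟩

theorem Same.map₂ {A' : Type*} {Φ Ψ : (ℕ → B) → A} {Φ' Ψ' : (ℕ → B) → A'} (g : A → A' → C)
    (h : Same Φ Ψ) (h' : Same Φ' Ψ') :
    Same (fun a => g (Φ (a ∘ evens)) (Φ' (a ∘ odds)))
      fun a => g (Ψ (a ∘ evens)) (Ψ' (a ∘ odds)) := by
  obtain ⟨i, j, hi, hj, h⟩ := h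
  obtain ⟨k, l, hk, hl, h'⟩ := h'
  have inj : ∀ {f g : ℕ → ℕ}, Function.Injective f → Function.Injective g →
      Function.Injective (join (evens ∘ f) (odds ∘ g)) := fun hf hg => join_injective <|
    (evens_injective.comp hf).sumElim (odds_injective.comp hg) fun m n e => by
      simp only [Function.comp, evens, odds] at e; omega
  refine ⟨join (evens ∘ i) (odds ∘ k), join (evens ∘ j) (odds ∘ l), inj hi hk, inj hj hl,
    fun a => ?_⟩
  simp only [Function.comp_assoc, join_comp_evens, join_comp_odds]
  exact congrArg₂ g (h (a ∘ evens)) (h' (a ∘ odds))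

theorem evens_odds_injective : Function.Injective (Sum.elim evens odds) :=
  evens_injective.sumElim odds_injective fun m n => by simp only [evens, odds]; omega

/-- The two halves of the stream may be exchanged. -/
theorem Same.swap (Θ : (ℕ → B) → (ℕ → B) → A) :
    Same (fun a => Θ (a ∘ evens) (a ∘ odds)) fun a => Θ (a ∘ odds) (a ∘ evens) := by
  refine ⟨join odds evens, id, ?_, Function.injective_id, fun a => ?_⟩
  · exact join_injective <| odds_injective.sumElim evens_injective fun m n => by
      simp only [evens, odds]; omega
  · simp [Function.comp_assoc]

/-- A stream that is split in three may be split in another way. -/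
theorem Same.assoc (Θ : (ℕ → B) → (ℕ → B) → (ℕ → B) → A) :
    Same (fun a => Θ (a ∘ evens ∘ evens) (a ∘ evens ∘ odds) (a ∘ odds))
      fun a => Θ (a ∘ evens) (a ∘ odds ∘ evens) (a ∘ odds ∘ odds) := by
  refine ⟨id, join (evens ∘ evens) (join (evens ∘ odds) odds), Function.injective_id, ?_,
    fun a => ?_⟩
  · intro m n h
    simp only [join, evens, odds, Function.comp] at h
    split_ifs at h <;> omega
  · simp only [Function.comp_assoc, join_comp_evens, Function.comp_id,
      ← Function.comp_assoc (join _ _), join_comp_odds]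

/-- The middle two quarters of the stream may be exchanged. -/
theorem Same.interchange (Θ : (ℕ → B) → (ℕ → B) → (ℕ → B) → (ℕ → B) → A) :
    Same (fun a => Θ (a ∘ evens ∘ evens) (a ∘ evens ∘ odds) (a ∘ odds ∘ evens) (a ∘ odds ∘ odds))
      fun a => Θ (a ∘ evens ∘ evens) (a ∘ odds ∘ evens) (a ∘ evens ∘ odds) (a ∘ odds ∘ odds) := by
  refine ⟨id, join (join (evens ∘ evens) (odds ∘ evens)) (join (evens ∘ odds) (odds ∘ odds)),
    Function.injective_id, ?_, fun a => ?_⟩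
  · intro m n h
    simp only [join, evens, odds, Function.comp] at h
    split_ifs at h <;> omega
  · simp only [Function.comp_assoc, join_comp_evens, Function.comp_id,
      ← Function.comp_assoc (join _ _), join_comp_odds]

end Streams

/-! ### Simultaneous assignment -/

section Assign

variable {Name : Type u} [DecidableEq Name] {B C : Type*}

/-- The map sending the entries of `ys` to the entries of the stream `s` (the first occurrence
counts), and any other name `w` to `ρ w`. -/
def asg (ρ : Name → B) : List Name → (ℕ → B) → Name → B
  | [], _ => ρ
  | y :: ys, s => Function.update (asg ρ ys (s ∘ Nat.succ)) y (s 0)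

theorem asg_congr {ρ ρ' : Name → B} {w : Name} : ∀ (ys : List Name) (s : ℕ → B),
    (w ∉ ys → ρ w = ρ' w) → asg ρ ys s w = asg ρ' ys s w
  | [], _, h => h (by simp)
  | y :: ys, s, h => by
      by_cases hw : w = y
      · subst hw; simp [asg]
      · rw [asg, asg, Function.update_of_ne hw, Function.update_of_ne hw]
        exact asg_congr ys _ fun h' => h (by simp [hw, h'])

/-- Assignments are natural in the set of values. -/
theorem map_asg (g : B → C) (ρ : Name → B) : ∀ (ys : List Name) (s : ℕ → B) (w : Name),
    g (asg ρ ys s w) = asg (g ∘ ρ) ys (g ∘ s) w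
  | [], _, _ => rfl
  | y :: ys, s, w => by
      by_cases hw : w = y
      · subst hw; simp [asg]
      · rw [asg, asg, Function.update_of_ne hw, Function.update_of_ne hw, map_asg g ρ ys]
        rfl

/-- The stream of the entries of a list, continued by a default value. -/
def streamOf (d : B) (zs : List B) (n : ℕ) : B := zs.getD n d

theorem asg_streamOf (ρ : Name → B) (d : B) (σ : Name → Name) : ∀ (ys zs : List Name) (w : Name),
    ys.length = zs.length →
    asg (ρ ∘ σ) ys (streamOf d (zs.map ρ)) w = ρ (assign σ ys zs w)
  | [], [], _, _ => rfl
  | y :: ys, z :: zs, w, h => by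
      by_cases hw : w = y
      · subst hw; simp [asg, assign, streamOf]
      · rw [asg, assign, Function.update_of_ne hw, Function.update_of_ne hw,
          ← asg_streamOf ρ d σ ys zs w (by simpa using h)]
        rfl

theorem assign_of_notMem (σ : Name → Name) {w : Name} : ∀ ys zs : List Name, w ∉ ys →
    assign σ ys zs w = σ w
  | [], _, _ => by simp [assign]
  | _ :: _, [], _ => by simp [assign]
  | y :: ys, z :: zs, h => by
      rw [List.mem_cons, not_or] at h
      rw [assign, Function.update_of_ne h.1, assign_of_notMem σ ys zs h.2]

theorem assign_mem (σ : Name → Name) {w : Name} : ∀ ys zs : List Name, ys.length = zs.length →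
    w ∈ ys → assign σ ys zs w ∈ zs
  | [], _, _, h => by simp at h
  | _ :: _, [], h, _ => by simp at h
  | y :: ys, z :: zs, h, hw => by
      by_cases hwy : w = y
      · subst hwy; simp [assign]
      · rw [assign, Function.update_of_ne hwy]
        exact List.mem_cons_of_mem _
          (assign_mem σ ys zs (by simpa using h) (by simpa [hwy] using hw))

/-- Assignment to `zs` after renaming `ys` to `zs` without clashes. -/
theorem asg_assign (ρ : Name → B) (σ : Name → Name) {w : Name} :
    ∀ (ys zs : List Name) (s : ℕ → B), ys.length = zs.length → zs.Nodup →
    (w ∉ ys → σ w ∉ zs) → asg ρ zs s (assign σ ys zs w) = asg (ρ ∘ σ) ys s w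
  | [], [], _, _, _, _ => rfl
  | y :: ys, z :: zs, s, hl, hz, h => by
      have hl' : ys.length = zs.length := by simpa using hl
      by_cases hw : w = y
      · subst hw; simp [asg, assign]
      · rw [assign, asg, asg, Function.update_of_ne hw, Function.update_of_ne hw,
          Function.update_of_ne]
        · refine asg_assign ρ σ ys zs _ hl' (List.nodup_cons.1 hz).2 fun h' h'' => ?_
          exact h (by simp [hw, h']) (List.mem_cons_of_mem _ h'')
        · rintro e
          by_cases hwy : w ∈ ys
          · exact (List.nodup_cons.1 hz).1 (e ▸ assign_mem σ ys zs hl' hwy)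
          · rw [assign_of_notMem σ ys zs hwy] at e
            exact h (by simp [hw, hwy]) (by simp [e])

theorem freshList_length [Infinite Name] (n : ℕ) : ∀ s : Finset Name,
    (freshList s n).length = n := by
  induction n with
  | zero => intro s; rfl
  | succ n ih => intro s; simp [freshList, ih]

theorem update_eq_assign (σ : Name → Name) (x z : Name) :
    Function.update σ x z = assign σ [x] [z] := by simp [assign]

theorem update_eq_asg (ρ : Name → B) (x : Name) (c : B) :
    Function.update ρ x c = asg ρ [x] fun _ => c := by simp [asg]

end Assign

/-! ### Behaviours -/

section Behaviours

variable {B : Type u}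

/-- Formal behaviours over a set `B` of values. The continuation of an input is a function of the
values received, of which the first `n` in a stream are meant; no variables are involved. -/
inductive Tree (B : Type u) : Type u
  | nil : Tree B
  | par (s t : Tree B) : Tree B
  | out (x : B) (zs : List B) : Tree B
  | inp (x : B) (n : ℕ) (k : (ℕ → B) → Tree B) : Tree B
  | cat : Tree B

/-- The congruence on formal behaviours that makes `par` and `nil` a commutative monoid. -/
inductive TreeEq : Tree B → Tree B → Prop
  | refl (s) : TreeEq s s
  | symm {s t} : TreeEq s t → TreeEq t s
  | trans {s t r} : TreeEq s t → TreeEq t r → TreeEq s r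
  | par {s s' t t'} : TreeEq s s' → TreeEq t t' → TreeEq (.par s t) (.par s' t')
  | inp (x n) {k k'} : (∀ v, TreeEq (k v) (k' v)) → TreeEq (.inp x n k) (.inp x n k')
  | par_assoc (s t r) : TreeEq (.par (.par s t) r) (.par s (.par t r))
  | par_comm (s t) : TreeEq (.par s t) (.par t s)
  | par_nil (s) : TreeEq (.par s .nil) s

instance treeSetoid (B : Type u) : Setoid (Tree B) :=
  ⟨TreeEq, ⟨TreeEq.refl, TreeEq.symm, TreeEq.trans⟩⟩

/-- Behaviours: the least solution of `M ≅ Multiset (Atom M)`. -/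
def Beh (B : Type u) : Type u := Quotient (treeSetoid B)

namespace Beh

/-- The behaviour that a formal behaviour denotes. -/
def mk (t : Tree B) : Beh B := Quotient.mk _ t

instance : Zero (Beh B) := ⟨mk .nil⟩

instance : Add (Beh B) := ⟨Quotient.map₂ Tree.par fun _ _ h _ _ h' => TreeEq.par h h'⟩

instance : AddCommMonoid (Beh B) where
  nsmul := nsmulRec
  add_assoc := by
    rintro ⟨a⟩ ⟨b⟩ ⟨c⟩
    exact Quotient.sound (TreeEq.par_assoc a b c)
  add_comm := by
    rintro ⟨a⟩ ⟨b⟩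
    exact Quotient.sound (TreeEq.par_comm a b)
  add_zero := by
    rintro ⟨a⟩
    exact Quotient.sound (TreeEq.par_nil a)
  zero_add := by
    rintro ⟨a⟩
    exact Quotient.sound ((TreeEq.par_comm _ a).trans (TreeEq.par_nil a))

/-- An output. -/
def out (x : B) (zs : List B) : Beh B := mk (.out x zs)

/-- An input. -/
noncomputable def inp (x : B) (n : ℕ) (k : (ℕ → B) → Beh B) : Beh B :=
  mk (.inp x n fun v => Quotient.out (k v))

/-- The behaviour of the catalyst. -/
def cat : Beh B := mk .cat

theorem mk_inp (x : B) (n : ℕ) (k : (ℕ → B) → Tree B) :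
    mk (.inp x n k) = inp x n fun v => mk (k v) :=
  Quotient.sound (TreeEq.inp x n fun v => TreeEq.symm (Quotient.mk_out (k v)))

theorem mk_par (s t : Tree B) : mk (.par s t) = mk s + mk t := rfl

end Beh

/-- The atomic behaviours: every behaviour is a multiset of these. -/
inductive Atom (B : Type u) : Type u
  | out (x : B) (zs : List B) : Atom B
  | inp (x : B) (n : ℕ) (k : (ℕ → B) → Beh B) : Atom B
  | cat : Atom B

/-- The atoms of a formal behaviour. -/
def Tree.flat : Tree B → Multiset (Atom B)
  | .nil => 0
  | .par s t => s.flat + t.flat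
  | .out x zs => {.out x zs}
  | .inp x n k => {.inp x n fun v => Beh.mk (k v)}
  | .cat => {.cat}

theorem TreeEq.flat_eq {s t : Tree B} (h : TreeEq s t) : s.flat = t.flat := by
  induction h with
  | refl => rfl
  | symm _ ih => exact ih.symm
  | trans _ _ ih ih' => exact ih.trans ih'
  | par _ _ ih ih' => simp [Tree.flat, ih, ih']
  | inp x n h _ =>
    exact congrArg (fun k => ({Atom.inp x n k} : Multiset (Atom B)))
      (funext fun v => Quotient.sound (h v))
  | par_assoc => simp [Tree.flat, add_assoc]
  | par_comm => simp [Tree.flat, add_comm]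
  | par_nil => simp [Tree.flat]

namespace Beh

/-- The atoms of a behaviour. -/
def flat : Beh B → Multiset (Atom B) := Quotient.lift Tree.flat fun _ _ h => TreeEq.flat_eq h

@[simp] theorem flat_zero : (0 : Beh B).flat = 0 := rfl

@[simp] theorem flat_add (m m' : Beh B) : (m + m').flat = m.flat + m'.flat := by
  revert m m'
  rintro ⟨s⟩ ⟨t⟩
  rfl

@[simp] theorem flat_out (x : B) (zs : List B) : (out x zs).flat = {.out x zs} := rfl

@[simp] theorem flat_cat : (cat : Beh B).flat = {.cat} := rfl

@[simp] theorem flat_inp (x : B) (n : ℕ) (k : (ℕ → B) → Beh B) :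
    (inp x n k).flat = {.inp x n k} := by
  change ({Atom.inp x n fun v => mk (Quotient.out (k v))} : Multiset (Atom B)) = _
  rw [show (fun v => mk (Quotient.out (k v))) = k from funext fun v => Quotient.out_eq (k v)]

/-- An atom as a behaviour. -/
noncomputable def ofAtom : Atom B → Beh B
  | .out x zs => out x zs
  | .inp x n k => inp x n k
  | .cat => cat

theorem sum_flat (m : Beh B) : (m.flat.map ofAtom).sum = m := by
  induction m using Quotient.inductionOn with
  | h t =>
  change (t.flat.map ofAtom).sum = mk t
  induction t with
  | nil => rfl
  | par s t ihs iht => simp [Tree.flat, ihs, iht, mk_par]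
  | out x zs => simp [Tree.flat, ofAtom, out]
  | inp x n k _ => simp [Tree.flat, ofAtom, mk_inp]
  | cat => simp [Tree.flat, ofAtom, cat]

/-- A behaviour is determined by its atoms. Hence addition of behaviours is cancellative. -/
theorem flat_injective : Function.Injective (flat : Beh B → _) := fun m m' h => by
  rw [← sum_flat m, h, sum_flat]

instance : IsCancelAdd (Beh B) := by
  have : IsLeftCancelAdd (Beh B) := ⟨fun a b c h => by
    apply flat_injective
    simpa using congrArg flat h⟩
  exact AddCommMagma.IsLeftCancelAdd.toIsCancelAdd _

/-- One communication between an output and an input at top level. The stream that the input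
receives is padded with `d`. -/
def Comm (d : B) (m m' : Beh B) : Prop :=
  ∃ x zs k r, m = out x zs + inp x zs.length k + r ∧ m' = k (streamOf d zs) + r

/-- One communication that uses up an adjacent catalyst, and returns it. It may take place under
inputs, whatever values are received. -/
inductive Fire (d : B) : Beh B → Beh B → Prop
  | comm (x zs k r) :
      Fire d (out x zs + inp x zs.length k + cat + r) (k (streamOf d zs) + cat + r)
  | inp (x n r) {k k' : (ℕ → B) → Beh B} : (∀ v, Fire d (k v) (k' v)) →
      Fire d (inp x n k + r) (inp x n k' + r)

theorem Fire.add_right {d : B} {m m' : Beh B} (h : Fire d m m') (s : Beh B) :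
    Fire d (m + s) (m' + s) := by
  cases h with
  | comm x zs k r => rw [add_assoc, add_assoc _ r]; exact .comm x zs k (r + s)
  | inp x n r h => rw [add_assoc, add_assoc _ r]; exact .inp x n (r + s) h

/-- The catalyst occurs at top level or under inputs. -/
inductive HasCat : Beh B → Prop
  | top {m} : .cat ∈ m.flat → HasCat m
  | inp {m x n k v} : .inp x n k ∈ m.flat → HasCat (k v) → HasCat m

theorem Fire.hasCat {d : B} {m m' : Beh B} (h : Fire d m m') : HasCat m := by
  induction h with
  | comm x zs k r => exact .top (by simp)
  | inp x n r h ih => exact .inp (x := x) (n := n) (by simp) (ih fun _ => d)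

theorem hasCat_add {m m' : Beh B} : HasCat (m + m') ↔ HasCat m ∨ HasCat m' := by
  constructor
  · intro h
    cases h with
    | top h =>
      rw [flat_add, Multiset.mem_add] at h
      exact h.imp .top .top
    | inp h h' =>
      rw [flat_add, Multiset.mem_add] at h
      exact h.imp (.inp · h') (.inp · h')
  · rintro (h | h) <;> cases h with
    | top h => exact .top (by simp [h])
    | inp h h' => exact .inp (by rw [flat_add, Multiset.mem_add]; tauto) h'

/-- When the only catalyst is at top level, so is the communication. -/
theorem Fire.comm_of_not_hasCat {d : B} {m m' : Beh B} (hm : ¬ HasCat m)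
    (h : Fire d (m + cat) (m' + cat)) : Comm d m m' := by
  generalize e : m + cat = n at h
  generalize e' : m' + cat = n' at h
  cases h with
  | comm x zs k r =>
    refine ⟨x, zs, k, r, add_right_cancel (e.trans ?_), add_right_cancel (e'.trans ?_)⟩ <;>
      rw [add_right_comm]
  | @inp x n r k k' h =>
    have : Atom.inp x n k ∈ (m + cat).flat := by rw [e]; simp
    simp only [flat_add, flat_cat, Multiset.mem_add, Multiset.mem_singleton, reduceCtorEq,
      or_false] at this
    exact absurd (.inp this (h fun _ => d).hasCat) hm

end Beh

end Behaviours

/-! ### The behaviour of a process -/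

section Processes

variable {Name : Type u}

/-- Values for names: the free names themselves, and a supply of new ones. -/
abbrev Val (Name : Type u) : Type u := Name ⊕ ℕ

/-- The value that pads streams. -/
def Val.default : Val Name := .inr 0

variable [DecidableEq Name]

/-- The behaviour of a process whose free names have the values `ρ` and whose binders `new` draw
their values from the stream `a`. An input does not use the second half of its stream. -/
noncomputable def Proc.beh : Proc Name → (Name → Val Name) → (ℕ → Val Name) → Beh (Val Name)
  | .nil, _, _ => 0
  | .inp x ys _ P, ρ, a => Beh.inp (ρ x) ys.length fun s => P.beh (asg ρ ys s) (a ∘ evens)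
  | .out x ys, ρ, _ => Beh.out (ρ x) (ys.map ρ)
  | .new x P, ρ, a => P.beh (Function.update ρ x (a 0)) (a ∘ Nat.succ)
  | .par P Q, ρ, a => P.beh ρ (a ∘ evens) + Q.beh ρ (a ∘ odds)

theorem Proc.beh_congr (P : Proc Name) : ∀ {ρ ρ' : Name → Val Name} (a : ℕ → Val Name),
    (∀ w ∈ P.fn, ρ w = ρ' w) → P.beh ρ a = P.beh ρ' a := by
  induction P with
  | nil => intros; rfl
  | inp x ys nd P ih =>
    intro ρ ρ' a h
    have hx : ρ x = ρ' x := h x (by simp [fn])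
    simp only [beh, hx]
    congr 1
    funext s
    exact ih _ fun w hw => asg_congr ys s fun hwy => h w (by simp [fn, hw, hwy])
  | out x ys =>
    intro ρ ρ' a h
    have hx : ρ x = ρ' x := h x (by simp [fn])
    simp only [beh, hx]
    congr 1
    exact List.map_congr_left fun w hw => h w (by simp [fn, hw])
  | new x P ih =>
    intro ρ ρ' a h
    refine ih _ fun w hw => ?_
    by_cases hwx : w = x
    · subst hwx; simp
    · simp [hwx, h w (by simp [fn, hw, hwx])]
  | par P Q ihP ihQ =>
    intro ρ ρ' a h
    simp only [beh]
    rw [ihP _ fun w hw => h w (by simp [fn, hw]), ihQ _ fun w hw => h w (by simp [fn, hw])]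

/-- The behaviours of two processes as functions of the values of their free names. -/
def SameBeh (P Q : Proc Name) : Prop := Same (fun a ρ => P.beh ρ a) fun a ρ => Q.beh ρ a

theorem SameBeh.inp {P Q : Proc Name} (x ys nd) (h : SameBeh P Q) :
    SameBeh (.inp x ys nd P) (.inp x ys nd Q) := by
  have h' := (Same.reindex _ evens_injective).trans (h.trans (Same.reindex _ evens_injective).symm)
  have := h'.map fun f ρ => Beh.inp (ρ x) ys.length fun s => f (asg ρ ys s)
  exact this

theorem SameBeh.new {P Q : Proc Name} (x) (h : SameBeh P Q) :
    SameBeh (.new x P) (.new x Q) := by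
  obtain ⟨i, j, hi, hj, h⟩ := h
  have inj : ∀ {f : ℕ → ℕ}, Function.Injective f → Function.Injective (scons 0 (Nat.succ ∘ f)) :=
    fun hf => scons_injective (Nat.succ_injective.comp hf) (by simp)
  refine ⟨_, _, inj hi, inj hj, fun a => funext fun ρ => ?_⟩
  exact congrFun (h (a ∘ Nat.succ)) (Function.update ρ x (a 0))

theorem SameBeh.par {P P' Q Q' : Proc Name} (h : SameBeh P P') (h' : SameBeh Q Q') :
    SameBeh (.par P Q) (.par P' Q') := by
  have := h.map₂ (fun f g ρ => f ρ + g ρ) h'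
  exact this

/-- How the stream of `(new x) P | Q` is rearranged for `(new x) (P | Q)`. -/
def extrude : ℕ → ℕ := scons (evens 0) (join (evens ∘ Nat.succ) odds)

theorem extrude_injective : Function.Injective extrude := by
  refine scons_injective (join_injective ?_) fun n => ?_
  · exact (evens_injective.comp Nat.succ_injective).sumElim odds_injective fun m n => by
      simp only [evens, odds, Function.comp]; omega
  · simp only [join, evens, odds, Function.comp]
    split_ifs <;> omega

theorem Proc.beh_new_par {x : Name} (P : Proc Name) {Q : Proc Name} (hx : x ∉ Q.fn)
    (ρ : Name → Val Name) (a : ℕ → Val Name) :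
    (Proc.par (.new x P) Q).beh ρ a = (Proc.new x (.par P Q)).beh ρ (a ∘ extrude) := by
  have h1 : (a ∘ extrude) ∘ Nat.succ = join ((a ∘ evens) ∘ Nat.succ) (a ∘ odds) := by
    rw [Function.comp_assoc, extrude, scons_comp_succ, comp_join]
    rfl
  simp only [beh, h1, join_comp_evens, join_comp_odds]
  congr 1
  refine Q.beh_congr _ fun w hw => ?_
  rw [Function.update_of_ne]
  rintro rfl
  exact hx hw

/-- The barbs of a process are the channels of the outputs among the atoms of its behaviour. -/
theorem Barb.mem_flat {P : Proc Name} {x : Name} (h : Barb P x) : ∀ (ρ : Name → Val Name)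
    (a : ℕ → Val Name), ∃ zs, .out (ρ x) zs ∈ (P.beh ρ a).flat := by
  induction h with
  | out x ys => intro ρ a; exact ⟨ys.map ρ, by simp [Proc.beh]⟩
  | par_left Q _ ih =>
    intro ρ a
    obtain ⟨zs, h⟩ := ih ρ (a ∘ evens)
    exact ⟨zs, by simp [Proc.beh, h]⟩
  | par_right P _ ih =>
    intro ρ a
    obtain ⟨zs, h⟩ := ih ρ (a ∘ odds)
    exact ⟨zs, by simp [Proc.beh, h]⟩
  | new y _ hy ih =>
    intro ρ a
    simpa [Proc.beh, hy] using ih (Function.update ρ y (a 0)) (a ∘ Nat.succ)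

/-- Conversely, an output among the atoms is on the channel of a barb or on a new channel. -/
theorem barb_of_mem_flat {P : Proc Name} {v : Val Name} {zs : List (Val Name)} :
    ∀ {ρ : Name → Val Name} {a : ℕ → Val Name}, .out v zs ∈ (P.beh ρ a).flat →
    (∃ x, ρ x = v ∧ Barb P x) ∨ v ∈ Set.range a := by
  induction P with
  | nil => intro ρ a h; simp [Proc.beh] at h
  | inp x ys nd P _ => intro ρ a h; simp [Proc.beh] at h
  | out x ys =>
    intro ρ a h
    simp only [Proc.beh, Beh.flat_out, Multiset.mem_singleton, Atom.out.injEq] at h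
    exact .inl ⟨x, h.1.symm, .out x ys⟩
  | new y P ih =>
    intro ρ a h
    rcases ih h with ⟨x, hx, hb⟩ | ⟨n, hn⟩
    · by_cases hxy : x = y
      · subst hxy
        exact .inr ⟨0, by simpa using hx⟩
      · exact .inl ⟨x, by simpa [hxy] using hx, .new y hb hxy⟩
    · exact .inr ⟨n.succ, hn⟩
  | par P Q ihP ihQ =>
    intro ρ a h
    simp only [Proc.beh, Beh.flat_add, Multiset.mem_add] at h
    rcases h with h | h
    · rcases ihP h with ⟨x, hx, hb⟩ | ⟨n, hn⟩
      · exact .inl ⟨x, hx, .par_left Q hb⟩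
      · exact .inr ⟨_, hn⟩
    · rcases ihQ h with ⟨x, hx, hb⟩ | ⟨n, hn⟩
      · exact .inl ⟨x, hx, .par_right P hb⟩
      · exact .inr ⟨_, hn⟩

/-- No process contains the catalyst. -/
theorem Proc.not_hasCat_beh (P : Proc Name) : ∀ (ρ : Name → Val Name) (a : ℕ → Val Name),
    ¬ (P.beh ρ a).HasCat := by
  induction P with
  | nil => rintro ρ a (h | h) <;> simp [beh] at h
  | inp x ys nd P ih =>
    intro ρ a h
    cases h with
    | top h => simp [beh] at h
    | inp h h' =>
      simp only [beh, Beh.flat_inp, Multiset.mem_singleton, Atom.inp.injEq] at h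
      obtain ⟨-, -, rfl⟩ := h
      exact ih _ _ h'
  | out x ys => rintro ρ a (h | h) <;> simp [beh] at h
  | new y P ih => intro ρ a; exact ih _ _
  | par P Q ihP ihQ =>
    intro ρ a h
    exact (Beh.hasCat_add.1 h).elim (ihP _ _) (ihQ _ _)

variable [Infinite Name]

theorem Proc.beh_subst (P : Proc Name) : ∀ (σ : Name → Name) (ρ : Name → Val Name)
    (a : ℕ → Val Name), (P.subst σ).beh ρ a = P.beh (ρ ∘ σ) a := by
  induction P with
  | nil => intros; rfl
  | inp x ys nd P ih =>
    intro σ ρ a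
    simp only [subst, beh, freshList_length, Function.comp]
    congr 1
    funext s
    rw [ih]
    refine P.beh_congr _ fun w hw => asg_assign ρ σ ys _ s (freshList_length _ _).symm
      (freshList_nodup _ _) fun hwy hz => ?_
    exact freshList_notMem _ _ _ hz (Finset.mem_image_of_mem σ (by simp [hw, hwy]))
  | out x ys => intro σ ρ a; simp [subst, beh]
  | new x P ih =>
    intro σ ρ a
    simp only [subst, beh]
    rw [ih]
    refine P.beh_congr _ fun w hw => ?_
    by_cases hwx : w = x
    · subst hwx; simp
    · have : σ w ≠ freshName ((P.fn.erase x).image σ) := fun e =>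
        freshName_notMem _ (e ▸ Finset.mem_image_of_mem σ (Finset.mem_erase.2 ⟨hwx, hw⟩))
      simp [hwx, this]
  | par P Q ihP ihQ => intro σ ρ a; simp only [subst, beh, ihP, ihQ]

theorem Proc.beh_subs (P : Proc Name) {ys zs : List Name} (h : ys.length = zs.length)
    (ρ : Name → Val Name) (a : ℕ → Val Name) :
    (P.subs ys zs).beh ρ a = P.beh (asg ρ ys (streamOf Val.default (zs.map ρ))) a := by
  rw [subs, beh_subst]
  exact P.beh_congr _ fun w _ => (asg_streamOf ρ Val.default id ys zs w h).symm

theorem AlphaEq.sameBeh {P Q : Proc Name} (h : AlphaEq P Q) : SameBeh P Q := by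
  induction h with
  | refl => exact Same.refl _
  | symm _ ih => exact ih.symm
  | trans _ _ ih ih' => exact ih.trans ih'
  | inp x ys nd _ ih => exact ih.inp x ys nd
  | new x _ ih => exact ih.new x
  | par _ _ ih ih' => exact ih.par ih'
  | inp_rename x ys nd P zs nd' hl hz =>
    refine Same.of_eq fun a => funext fun ρ => ?_
    simp only [Proc.beh, hl, Proc.subs, Proc.beh_subst]
    congr 1
    funext s
    refine P.beh_congr _ fun w hw => (asg_assign ρ id ys zs s hl nd' fun hwy hwz => ?_).symm
    exact hwy (hz w hwz hw)
  | new_rename x P z hz =>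
    refine Same.of_eq fun a => funext fun ρ => ?_
    simp only [Proc.beh, Proc.subs, Proc.beh_subst]
    refine P.beh_congr _ fun w hw => ?_
    by_cases hwx : w = x
    · subst hwx; simp [assign]
    · have : w ≠ z := fun e => hwx (e.trans (hz (e ▸ hw)))
      simp [assign, hwx, this]

/-- Behaviours are invariant under structural congruence, up to the choice of the new names. For
`new_idem` it is essential that unused entries of the stream may be dropped. -/
theorem StructCong.sameBeh {P Q : Proc Name} (h : StructCong P Q) : SameBeh P Q := by
  induction h with
  | refl => exact Same.refl _
  | symm _ ih => exact ih.symm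
  | trans _ _ ih ih' => exact ih.trans ih'
  | inp x ys nd _ ih => exact ih.inp x ys nd
  | new x _ ih => exact ih.new x
  | par _ _ ih ih' => exact ih.par ih'
  | alpha h => exact h.sameBeh
  | par_assoc P Q R =>
    have := Same.assoc (B := Val Name) fun a b c ρ => P.beh ρ a + Q.beh ρ b + R.beh ρ c
    refine this.trans (Same.of_eq fun a => funext fun ρ => add_assoc _ _ _)
  | par_comm P Q =>
    have := Same.swap (B := Val Name) fun a b ρ => P.beh ρ a + Q.beh ρ b
    refine this.trans (Same.of_eq fun a => funext fun ρ => add_comm _ _)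
  | par_nil P =>
    refine (Same.of_eq fun a => funext fun ρ => add_zero _).trans
      (Same.reindex (fun a ρ => P.beh ρ a) evens_injective)
  | new_idem x P =>
    refine ⟨id, Nat.succ, Function.injective_id, Nat.succ_injective, fun a => funext fun ρ => ?_⟩
    simp only [Proc.beh, Function.update_idem]
    rfl
  | new_swap x y P =>
    by_cases hxy : x = y
    · subst hxy
      exact Same.refl _
    refine ⟨id, Equiv.swap 0 1, Function.injective_id, (Equiv.swap 0 1).injective,
      fun a => funext fun ρ => ?_⟩
    have h1 : (((a ∘ Equiv.swap 0 1) ∘ Nat.succ) ∘ Nat.succ) = (a ∘ Nat.succ) ∘ Nat.succ := by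
      funext n
      simp only [Function.comp]
      rw [Equiv.swap_apply_of_ne_of_ne (by simp) (by simp)]
    simp only [Proc.beh, h1, Function.comp_id]
    rw [Function.update_comm (Ne.symm hxy)]
    simp
  | new_par x P Q hx =>
    exact ⟨id, extrude, Function.injective_id, extrude_injective,
      fun a => funext fun ρ => P.beh_new_par hx ρ a⟩

/-- A reduction of a process is a communication of its behaviour, the same one for all values of
the free names. -/
theorem Red.comm_beh {P P' : Proc Name} (h : Red P P') : ∃ i j : ℕ → ℕ, Function.Injective i ∧
    Function.Injective j ∧ ∀ a ρ, Beh.Comm Val.default (P.beh ρ (a ∘ i)) (P'.beh ρ (a ∘ j)) := by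
  induction h with
  | comm x ys nd P zs hl =>
    refine ⟨id, evens ∘ evens, Function.injective_id, evens_injective.comp evens_injective,
      fun a ρ => ?_⟩
    refine ⟨ρ x, zs.map ρ, fun s => P.beh (asg ρ ys s) (a ∘ evens ∘ evens), 0, ?_, ?_⟩
    · simp only [Proc.beh, List.length_map, hl, add_zero]
      exact add_comm _ _
    · rw [P.beh_subs hl, add_zero]
  | par Q _ ih =>
    obtain ⟨i, j, hi, hj, h⟩ := ih
    have inj : ∀ {f : ℕ → ℕ}, Function.Injective f →
        Function.Injective (join (evens ∘ f) odds) := fun hf => join_injective <|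
      (evens_injective.comp hf).sumElim odds_injective fun m n => by
        simp only [evens, odds, Function.comp]; omega
    refine ⟨_, _, inj hi, inj hj, fun a ρ => ?_⟩
    simp only [Proc.beh, Function.comp_assoc, join_comp_evens, join_comp_odds]
    obtain ⟨x, zs, k, r, e, e'⟩ := h (a ∘ evens) ρ
    refine ⟨x, zs, k, r + Q.beh ρ (a ∘ odds), ?_, ?_⟩
    · rw [← add_assoc, ← e]; rfl
    · rw [← add_assoc, ← e']; rfl
  | new x _ ih =>
    obtain ⟨i, j, hi, hj, h⟩ := ih
    have inj : ∀ {f : ℕ → ℕ}, Function.Injective f → Function.Injective (scons 0 (Nat.succ ∘ f)) :=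
      fun hf => scons_injective (Nat.succ_injective.comp hf) (by simp)
    exact ⟨_, _, inj hi, inj hj, fun a ρ => h (a ∘ Nat.succ) (Function.update ρ x (a 0))⟩
  | equiv hP _ hQ ih =>
    obtain ⟨i, j, hi, hj, h⟩ := ih
    obtain ⟨i₁, j₁, hi₁, hj₁, h₁⟩ := hP.sameBeh
    obtain ⟨i₂, j₂, hi₂, hj₂, h₂⟩ := hQ.sameBeh
    -- The streams of the two congruences are matched with those of the reduction in the middle.
    obtain ⟨p, q, hp, hq, hpq⟩ := exists_amalgam hj₁ hi
    obtain ⟨p', q', hp', hq', hpq'⟩ := exists_amalgam (hq.comp hj) hi₂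
    refine ⟨p' ∘ p ∘ i₁, q' ∘ j₂, hp'.comp (hp.comp hi₁), hq'.comp hj₂, fun a ρ => ?_⟩
    have e₁ := congrFun (h₁ (a ∘ p' ∘ p)) ρ
    have e₂ := congrFun (h₂ (a ∘ q')) ρ
    have e₃ := h (a ∘ p' ∘ q) ρ
    have h₃ : (a ∘ p' ∘ p) ∘ j₁ = (a ∘ p' ∘ q) ∘ i :=
      funext fun n => congrArg (fun m => a (p' m)) (hpq n)
    have h₄ : (a ∘ p' ∘ q) ∘ j = (a ∘ q') ∘ i₂ := funext fun n => congrArg a (hpq' n)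
    simp only [h₃] at e₁
    simp only at e₂
    rw [h₄, ← e₁, e₂] at e₃
    exact e₃

end Processes

/-! ### Exposing a redex -/

section Redex

variable {Name : Type u}

/-- The names of the calculus and the entries of the stream have pairwise distinct values. -/
def Apart (ρ : Name → Val Name) (a : ℕ → Val Name) : Prop := Function.Injective (Sum.elim ρ a)

theorem apart_iff {ρ : Name → Val Name} {a : ℕ → Val Name} : Apart ρ a ↔
    Function.Injective ρ ∧ Function.Injective a ∧ ∀ x n, ρ x ≠ a n :=
  ⟨fun h => ⟨fun _ _ e => Sum.inl_injective (h e), fun _ _ e => Sum.inr_injective (h e),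
      fun x n e => Sum.inl_ne_inr (h (a₁ := .inl x) (a₂ := .inr n) e)⟩,
    fun ⟨h₁, h₂, h₃⟩ => h₁.sumElim h₂ h₃⟩

theorem Apart.comp {ρ : Name → Val Name} {a : ℕ → Val Name} (h : Apart ρ a) {t : ℕ → ℕ}
    (ht : Function.Injective t) : Apart ρ (a ∘ t) :=
  let ⟨h₁, h₂, h₃⟩ := apart_iff.1 h
  apart_iff.2 ⟨h₁, h₂.comp ht, fun x n => h₃ x (t n)⟩

/-- No `new` occurs outside inputs. -/
def Proc.NewFree : Proc Name → Prop
  | .new _ _ => False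
  | .par P Q => P.NewFree ∧ Q.NewFree
  | _ => True

/-- The process consists of `n` binders `new` in front of a process without `new` outside
inputs. -/
def Proc.Prenex : ℕ → Proc Name → Prop
  | 0, P => P.NewFree
  | n + 1, .new _ P => P.Prenex n
  | _ + 1, _ => False

theorem Proc.Prenex.exists_new {n : ℕ} {P : Proc Name} (h : P.Prenex (n + 1)) :
    ∃ x P', P = .new x P' ∧ P'.Prenex n := by
  cases P with
  | new x P => exact ⟨x, P, rfl, h⟩
  | _ => exact h.elim

variable [DecidableEq Name]

theorem Apart.update {ρ : Name → Val Name} {a : ℕ → Val Name} (h : Apart ρ a) (x : Name) :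
    Apart (Function.update ρ x (a 0)) (a ∘ Nat.succ) := by
  obtain ⟨hρ, ha, hne⟩ := apart_iff.1 h
  refine Function.Injective.sumElim ?_ (ha.comp Nat.succ_injective) fun y n => ?_
  · intro y z e
    by_cases hy : y = x <;> by_cases hz : z = x
    · rw [hy, hz]
    · subst hy
      rw [Function.update_self, Function.update_of_ne hz] at e
      exact absurd e.symm (hne _ _)
    · subst hz
      rw [Function.update_self, Function.update_of_ne hy] at e
      exact absurd e (hne _ _)
    · rw [Function.update_of_ne hy, Function.update_of_ne hz] at e
      exact hρ e
  · by_cases hy : y = x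
    · subst hy
      rw [Function.update_self]
      exact fun e => absurd (ha e) (by simp)
    · rw [Function.update_of_ne hy]
      exact hne _ _

variable [Infinite Name]

theorem Proc.fn_subst_subset (P : Proc Name) : ∀ σ : Name → Name,
    (P.subst σ).fn ⊆ P.fn.image σ := by
  induction P with
  | nil => intro σ; simp [subst, fn]
  | inp x ys nd P ih =>
    intro σ w hw
    simp only [subst, fn, Finset.mem_insert, Finset.mem_sdiff, List.mem_toFinset] at hw
    rcases hw with rfl | ⟨hw, hw'⟩
    · simp [fn]
    · obtain ⟨v, hv, rfl⟩ := Finset.mem_image.1 (ih _ hw)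
      by_cases hvy : v ∈ ys
      · exact absurd (assign_mem σ ys _ (freshList_length _ _).symm hvy) hw'
      · rw [assign_of_notMem σ ys _ hvy]
        exact Finset.mem_image_of_mem σ (by simp [fn, hv, hvy])
  | out x ys =>
    intro σ w hw
    simpa [subst, fn, eq_comm] using hw
  | new x P ih =>
    intro σ w hw
    simp only [subst, fn, Finset.mem_erase] at hw
    obtain ⟨v, hv, rfl⟩ := Finset.mem_image.1 (ih _ hw.2)
    by_cases hvx : v = x
    · subst hvx; simp at hw
    · rw [Function.update_of_ne hvx]
      exact Finset.mem_image_of_mem σ (by simp [fn, hv, hvx])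
  | par P Q ihP ihQ =>
    intro σ
    simp only [subst, fn, Finset.image_union]
    exact Finset.union_subset_union (ihP σ) (ihQ σ)

/-- The part of structural congruence, oriented, that brings a redex to the surface. Unlike
`(new x)(new x) P ≡ (new x) P`, all of its laws hold for the interpretation in the theory. -/
inductive Rearr : Proc Name → Proc Name → Prop
  | refl (P) : Rearr P P
  | trans {P Q R} : Rearr P Q → Rearr Q R → Rearr P R
  | new {P Q} (x) : Rearr P Q → Rearr (.new x P) (.new x Q)
  | par {P P'} (Q) : Rearr P P' → Rearr (.par P Q) (.par P' Q)
  | rename (x P z) : (z ∈ P.fn → z = x) → Rearr (.new x P) (.new z (P.subs [x] [z]))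
  | par_assoc (P Q R) : Rearr (.par (.par P Q) R) (.par P (.par Q R))
  | par_comm (P Q) : Rearr (.par P Q) (.par Q P)
  | par_nil (P) : Rearr P (.par P .nil)
  | new_par (x P Q) : x ∉ Q.fn → Rearr (.par (.new x P) Q) (.new x (.par P Q))

theorem Rearr.structCong {P Q : Proc Name} (h : Rearr P Q) : StructCong P Q := by
  induction h with
  | refl P => exact .refl P
  | trans _ _ ih ih' => exact ih.trans ih'
  | new x _ ih => exact ih.new x
  | par Q _ ih => exact ih.par (.refl Q)
  | rename x P z h => exact .alpha (.new_rename x P z h)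
  | par_assoc P Q R => exact .par_assoc P Q R
  | par_comm P Q => exact .par_comm P Q
  | par_nil P => exact (StructCong.par_nil P).symm
  | new_par x P Q h => exact .new_par x P Q h

theorem Proc.fn_subs_subset (P : Proc Name) {ys zs : List Name} (h : ys.length = zs.length) :
    (P.subs ys zs).fn ⊆ (P.fn \ ys.toFinset) ∪ zs.toFinset := by
  intro w hw
  obtain ⟨v, hv, rfl⟩ := Finset.mem_image.1 (P.fn_subst_subset _ hw)
  by_cases hvy : v ∈ ys
  · simp [assign_mem id ys zs h hvy]
  · simp [assign_of_notMem id ys zs hvy, hv, hvy]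

theorem Rearr.fn_subset {P Q : Proc Name} (h : Rearr P Q) : Q.fn ⊆ P.fn := by
  induction h with
  | refl P => exact subset_rfl
  | trans _ _ ih ih' => exact ih'.trans ih
  | new x _ ih => exact Finset.erase_subset_erase x ih
  | par Q _ ih => exact Finset.union_subset_union ih subset_rfl
  | rename x P z h =>
    intro w hw
    simp only [Proc.fn, Finset.mem_erase] at hw ⊢
    have := P.fn_subs_subset (ys := [x]) (zs := [z]) rfl hw.2
    simp [hw.1] at this
    tauto
  | par_assoc P Q R => simp [Proc.fn, Finset.union_assoc]
  | par_comm P Q => simp [Proc.fn, Finset.union_comm]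
  | par_nil P => simp [Proc.fn]
  | new_par x P Q h =>
    intro w hw
    simp only [Proc.fn, Finset.mem_erase, Finset.mem_union] at hw ⊢
    tauto

/-- `P` can be rearranged to `N`, which moreover draws on the stream of new names that `P` has. -/
def Lead (P N : Proc Name) : Prop :=
  Rearr P N ∧ ∃ t : ℕ → ℕ, Function.Injective t ∧ ∀ ρ a, P.beh ρ a = N.beh ρ (a ∘ t)

theorem Lead.refl (P : Proc Name) : Lead P P :=
  ⟨.refl P, id, Function.injective_id, fun _ _ => rfl⟩

theorem Lead.trans {P Q R : Proc Name} : Lead P Q → Lead Q R → Lead P R := by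
  rintro ⟨h, t, ht, e⟩ ⟨h', t', ht', e'⟩
  exact ⟨h.trans h', t ∘ t', ht.comp ht', fun ρ a => (e ρ a).trans (e' ρ _)⟩

theorem Lead.new {P Q : Proc Name} (x) : Lead P Q → Lead (.new x P) (.new x Q) := by
  rintro ⟨h, t, ht, e⟩
  refine ⟨h.new x, scons 0 (Nat.succ ∘ t),
    scons_injective (Nat.succ_injective.comp ht) (by simp), fun ρ a => ?_⟩
  exact e _ _

theorem Lead.par {P P' : Proc Name} (Q) : Lead P P' → Lead (.par P Q) (.par P' Q) := by
  rintro ⟨h, t, ht, e⟩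
  refine ⟨h.par Q, join (evens ∘ t) odds, join_injective <|
    (evens_injective.comp ht).sumElim odds_injective fun m n => by
      simp only [evens, odds, Function.comp]; omega, fun ρ a => ?_⟩
  simp only [Proc.beh, Function.comp_assoc, join_comp_evens, join_comp_odds]
  rw [e]
  rfl

theorem Lead.par_comm (P Q : Proc Name) : Lead (.par P Q) (.par Q P) := by
  refine ⟨.par_comm P Q, join odds evens, join_injective <|
    odds_injective.sumElim evens_injective fun m n => by simp only [evens, odds]; omega,
    fun ρ a => ?_⟩
  simp only [Proc.beh, Function.comp_assoc, join_comp_evens, join_comp_odds]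
  exact add_comm _ _

theorem Lead.rename (x : Name) (P : Proc Name) {z : Name} (hz : z ∉ P.fn) :
    Lead (.new x P) (.new z (P.subs [x] [z])) := by
  refine ⟨.rename x P z fun h => absurd h hz, id, Function.injective_id, fun ρ a => ?_⟩
  simp only [Proc.beh, Proc.subs, Proc.beh_subst]
  refine P.beh_congr _ fun w hw => ?_
  by_cases hwx : w = x
  · subst hwx; simp [assign]
  · have : w ≠ z := fun e => hz (e ▸ hw)
    simp [assign, hwx, this]

theorem Lead.new_par {x : Name} (P : Proc Name) {Q : Proc Name} (hx : x ∉ Q.fn) :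
    Lead (.par (.new x P) Q) (.new x (.par P Q)) :=
  ⟨.new_par x P Q hx, extrude, extrude_injective, P.beh_new_par hx⟩

theorem Proc.NewFree.subst {P : Proc Name} : P.NewFree → ∀ σ, (P.subst σ).NewFree := by
  induction P with
  | par P Q ihP ihQ => exact fun h σ => ⟨ihP h.1 σ, ihQ h.2 σ⟩
  | new => exact fun h => h.elim
  | _ => exact fun _ _ => trivial

theorem Proc.Prenex.subst : ∀ {n : ℕ} {P : Proc Name}, P.Prenex n → ∀ σ, (P.subst σ).Prenex n
  | 0, _, h, σ => NewFree.subst h σ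
  | n + 1, P, h, σ => by
      obtain ⟨x, P, rfl, h⟩ := h.exists_new
      exact Prenex.subst (n := n) h _

theorem exists_prenex_par_newFree : ∀ (n : ℕ) {P Q : Proc Name}, P.Prenex n → Q.NewFree →
    ∃ N : Proc Name, N.Prenex n ∧ Lead (.par P Q) N
  | 0, P, Q, hP, hQ => ⟨.par P Q, ⟨hP, hQ⟩, .refl _⟩
  | n + 1, P, Q, hP, hQ => by
      obtain ⟨x, P, rfl, hP⟩ := hP.exists_new
      have hz := freshName_notMem (P.fn ∪ Q.fn)
      rw [Finset.mem_union, not_or] at hz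
      obtain ⟨N, hN, h⟩ := exists_prenex_par_newFree n
        (Proc.Prenex.subst (n := n) hP (assign id [x] [freshName (P.fn ∪ Q.fn)])) hQ
      exact ⟨.new _ N, hN, (((Lead.rename x P hz.1).par Q).trans (.new_par _ hz.2)).trans (h.new _)⟩

theorem exists_prenex_par : ∀ (n m : ℕ) {P Q : Proc Name}, P.Prenex n → Q.Prenex m →
    ∃ k, ∃ N : Proc Name, N.Prenex k ∧ Lead (.par P Q) N
  | 0, m, P, Q, hP, hQ => by
      obtain ⟨N, hN, h⟩ := exists_prenex_par_newFree m hQ hP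
      exact ⟨m, N, hN, (Lead.par_comm P Q).trans h⟩
  | n + 1, m, P, Q, hP, hQ => by
      obtain ⟨x, P, rfl, hP⟩ := hP.exists_new
      have hz := freshName_notMem (P.fn ∪ Q.fn)
      rw [Finset.mem_union, not_or] at hz
      obtain ⟨k, N, hN, h⟩ := exists_prenex_par n m
        (Proc.Prenex.subst (n := n) hP (assign id [x] [freshName (P.fn ∪ Q.fn)])) hQ
      exact ⟨k + 1, .new _ N, hN,
        (((Lead.rename x P hz.1).par Q).trans (.new_par _ hz.2)).trans (h.new _)⟩

/-- Every process can be rearranged so that all its binders `new` outside inputs are in front. -/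
theorem exists_prenex (P : Proc Name) : ∃ n, ∃ N : Proc Name, N.Prenex n ∧ Lead P N := by
  induction P with
  | new x P ih =>
    obtain ⟨n, N, hN, h⟩ := ih
    exact ⟨n + 1, .new x N, hN, h.new x⟩
  | par P Q ihP ihQ =>
    obtain ⟨n, N, hN, h⟩ := ihP
    obtain ⟨m, M, hM, h'⟩ := ihQ
    obtain ⟨k, K, hK, hk⟩ := exists_prenex_par n m hN hM
    exact ⟨k, K, hK, (((h.par Q).trans (.par_comm _ _)).trans
      ((h'.par N).trans (.par_comm _ _))).trans hk⟩
  | nil => exact ⟨0, .nil, trivial, .refl _⟩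
  | inp x ys nd P _ => exact ⟨0, .inp x ys nd P, trivial, .refl _⟩
  | out x ys => exact ⟨0, .out x ys, trivial, .refl _⟩

/-- Disjoint parts of a stream remain disjoint when the part `f` is split into `s` and `t`, and `t`
is joined to the other part. -/
theorem sumElim_split_injective {f g s t : ℕ → ℕ} (h : Function.Injective (Sum.elim f g))
    (h' : Function.Injective (Sum.elim s t)) :
    Function.Injective (Sum.elim (f ∘ s) (join (f ∘ t) g)) := by
  have hf : Function.Injective f := h.comp Sum.inl_injective
  have hg : Function.Injective g := h.comp Sum.inr_injective
  have hs : Function.Injective s := h'.comp Sum.inl_injective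
  have ht : Function.Injective t := h'.comp Sum.inr_injective
  have hfg : ∀ m n, f m ≠ g n := fun m n e =>
    Sum.inl_ne_inr (h (a₁ := .inl m) (a₂ := .inr n) e)
  have hst : ∀ m n, s m ≠ t n := fun m n e =>
    Sum.inl_ne_inr (h' (a₁ := .inl m) (a₂ := .inr n) e)
  refine (hf.comp hs).sumElim (join_injective ((hf.comp ht).sumElim hg fun _ _ => hfg _ _))
    fun m n => ?_
  simp only [join]
  split_ifs
  · exact fun e => hst _ _ (hf e)
  · exact hfg _ _

/-- An output among the atoms of a behaviour comes from an output of the process, which can be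
moved to the front. -/
theorem Proc.NewFree.exists_out {P : Proc Name} (hP : P.NewFree) {ρ : Name → Val Name}
    {v : Val Name} {vs : List (Val Name)} : ∀ {a : ℕ → Val Name}, .out v vs ∈ (P.beh ρ a).flat →
    ∃ x zs, ∃ R : Proc Name, ∃ t : ℕ → ℕ, Function.Injective t ∧ R.NewFree ∧
      Rearr P (.par (.out x zs) R) ∧ ρ x = v ∧ zs.map ρ = vs ∧
      P.beh ρ a = Beh.out v vs + R.beh ρ (a ∘ t) := by
  induction P with
  | nil => intro a h; simp [beh] at h
  | inp x ys nd P _ => intro a h; simp [beh] at h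
  | out x zs =>
    intro a h
    simp only [beh, Beh.flat_out, Multiset.mem_singleton, Atom.out.injEq] at h
    obtain ⟨rfl, rfl⟩ := h
    exact ⟨x, zs, .nil, id, Function.injective_id, trivial, .par_nil _, rfl, rfl,
      (add_zero _).symm⟩
  | new x P _ => exact hP.elim
  | par P Q ihP ihQ =>
    intro a h
    simp only [beh, Beh.flat_add, Multiset.mem_add] at h
    rcases h with h | h
    · obtain ⟨x, zs, R, t, ht, hR, hr, hx, hz, e⟩ := ihP hP.1 h
      refine ⟨x, zs, .par R Q, join (evens ∘ t) odds, join_injective <|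
        (evens_injective.comp ht).sumElim odds_injective fun m n => by
          simp only [evens, odds, Function.comp]; omega, ⟨hR, hP.2⟩,
        (hr.par Q).trans (.par_assoc _ _ _), hx, hz, ?_⟩
      simp only [beh, Function.comp_assoc, join_comp_evens, join_comp_odds, e, add_assoc]
    · obtain ⟨x, zs, R, t, ht, hR, hr, hx, hz, e⟩ := ihQ hP.2 h
      refine ⟨x, zs, .par R P, join (odds ∘ t) evens, join_injective <|
        (odds_injective.comp ht).sumElim evens_injective fun m n => by
          simp only [evens, odds, Function.comp]; omega, ⟨hR, hP.1⟩,
        (Rearr.par_comm _ _).trans ((hr.par P).trans (.par_assoc _ _ _)), hx, hz, ?_⟩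
      simp only [beh, Function.comp_assoc, join_comp_evens, join_comp_odds, e]
      rw [add_comm, add_assoc]

/-- An input among the atoms of a behaviour comes from an input of the process, which can be
moved to the front. -/
theorem Proc.NewFree.exists_inp {P : Proc Name} (hP : P.NewFree) {ρ : Name → Val Name}
    {v : Val Name} {n : ℕ} {k : (ℕ → Val Name) → Beh (Val Name)} :
    ∀ {a : ℕ → Val Name}, .inp v n k ∈ (P.beh ρ a).flat →
    ∃ x ys nd, ∃ Q R : Proc Name, ∃ s t : ℕ → ℕ, Function.Injective (Sum.elim s t) ∧
      Rearr P (.par (.inp x ys nd Q) R) ∧ ρ x = v ∧ ys.length = n ∧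
      (k = fun w => Q.beh (asg ρ ys w) (a ∘ s)) ∧
      P.beh ρ a = Beh.inp v n k + R.beh ρ (a ∘ t) := by
  induction P with
  | nil => intro a h; simp [beh] at h
  | inp x ys nd Q _ =>
    intro a h
    simp only [beh, Beh.flat_inp, Multiset.mem_singleton, Atom.inp.injEq] at h
    obtain ⟨rfl, rfl, rfl⟩ := h
    exact ⟨x, ys, nd, Q, .nil, evens, odds, evens_odds_injective, .par_nil _, rfl, rfl, rfl,
      (add_zero _).symm⟩
  | out x zs => intro a h; simp [beh] at h
  | new x P _ => exact hP.elim
  | par P Q ihP ihQ =>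
    intro a h
    have hoe : Function.Injective (Sum.elim odds evens) :=
      odds_injective.sumElim evens_injective fun m n => by simp only [evens, odds]; omega
    simp only [beh, Beh.flat_add, Multiset.mem_add] at h
    rcases h with h | h
    · obtain ⟨x, ys, nd, Q', R, s, t, hst, hr, hx, hn, hk, e⟩ := ihP hP.1 h
      refine ⟨x, ys, nd, Q', .par R Q, _, _, sumElim_split_injective evens_odds_injective hst,
        (hr.par Q).trans (.par_assoc _ _ _), hx, hn, hk, ?_⟩
      simp only [beh, Function.comp_assoc, join_comp_evens, join_comp_odds, e, add_assoc]
    · obtain ⟨x, ys, nd, Q', R, s, t, hst, hr, hx, hn, hk, e⟩ := ihQ hP.2 h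
      refine ⟨x, ys, nd, Q', .par R P, _, _, sumElim_split_injective hoe hst,
        (Rearr.par_comm _ _).trans ((hr.par P).trans (.par_assoc _ _ _)), hx, hn, hk, ?_⟩
      simp only [beh, Function.comp_assoc, join_comp_evens, join_comp_odds, e]
      rw [add_comm, add_assoc]

/-- Communication at the surface of a process: under binders `new`, an output stands next to an
input on the same channel. -/
inductive Surface : Proc Name → Proc Name → Prop
  | comm (x zs ys nd Q R) : ys.length = zs.length →
      Surface (.par (.out x zs) (.par (.inp x ys nd Q) R)) (.par (Q.subs ys zs) R)
  | new (x) {P P'} : Surface P P' → Surface (.new x P) (.new x P')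

theorem Surface.red {P P' : Proc Name} (h : Surface P P') : Red P P' := by
  induction h with
  | comm x zs ys nd Q R hl =>
    exact .equiv ((StructCong.par_assoc _ _ _).symm.trans ((StructCong.par_comm _ _).par (.refl R)))
      ((Red.comm x ys nd Q zs hl).par R) (.refl _)
  | new x _ ih => exact ih.new x

theorem Surface.fn_subset {P P' : Proc Name} (h : Surface P P') : P'.fn ⊆ P.fn := by
  induction h with
  | comm x zs ys nd Q R hl =>
    intro w hw
    simp only [Proc.fn, Finset.mem_union, Finset.mem_insert] at hw ⊢
    rcases hw with hw | hw
    · have := Q.fn_subs_subset hl hw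
      rw [Finset.mem_union] at this
      tauto
    · tauto
  | new x _ ih => exact Finset.erase_subset_erase x ih

theorem Proc.Prenex.exists_surface : ∀ {n : ℕ} {P : Proc Name}, P.Prenex n →
    ∀ {ρ : Name → Val Name} {a : ℕ → Val Name} {m : Beh (Val Name)}, Apart ρ a →
    Beh.Comm Val.default (P.beh ρ a) m →
    ∃ N N' : Proc Name, ∃ t : ℕ → ℕ, Rearr P N ∧ Surface N N' ∧ Function.Injective t ∧
      N'.beh ρ (a ∘ t) = m
  | 0, P, hP, ρ, a, m, ha, hm => by
      obtain ⟨v, vs, k, r, e, rfl⟩ := hm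
      have hρ : Function.Injective ρ := (apart_iff.1 ha).1
      obtain ⟨x, zs, R, t, ht, hR, hr, rfl, rfl, e₁⟩ := NewFree.exists_out (P := P) hP
        (v := v) (vs := vs) (by rw [e]; simp)
      have e₂ : R.beh ρ (a ∘ t) = Beh.inp (ρ x) (zs.map ρ).length k + r := by
        rw [e₁, add_assoc] at e
        exact add_left_cancel e
      obtain ⟨y, ys, nd, Q, R', s, t', hst, hr', hy, hl, hk, e₃⟩ := NewFree.exists_inp hR
        (v := ρ x) (n := (zs.map ρ).length) (k := k) (by rw [e₂]; simp)
      -- Distinct names have distinct values, so output and input are on the same channel.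
      obtain rfl : y = x := hρ hy
      rw [List.length_map] at hl
      refine ⟨_, _, t ∘ join s t', hr.trans ((Rearr.par_comm _ _).trans ((hr'.par _).trans
        (Rearr.par_comm _ _))), Surface.comm y zs ys nd Q R' hl, ht.comp (join_injective hst), ?_⟩
      · simp only [beh, Function.comp_assoc, join_comp_evens, join_comp_odds]
        rw [Q.beh_subs hl, hk]
        congr 1
        rw [e₂] at e₃
        exact (add_left_cancel e₃).symm
  | n + 1, P, hP, ρ, a, m, ha, hm => by
      obtain ⟨x, P, rfl, hP⟩ := hP.exists_new
      obtain ⟨N, N', t, hr, hs, ht, e⟩ := Prenex.exists_surface (P := P) hP (ha.update x) hm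
      exact ⟨.new x N, .new x N', scons 0 (Nat.succ ∘ t), hr.new x, hs.new x,
        scons_injective (Nat.succ_injective.comp ht) (by simp), e⟩

/-- A communication in the behaviour of a process comes from a redex of the process. -/
theorem Proc.exists_surface (P : Proc Name) {ρ : Name → Val Name} {a : ℕ → Val Name}
    {m : Beh (Val Name)} (ha : Apart ρ a) (h : Beh.Comm Val.default (P.beh ρ a) m) :
    ∃ N N' : Proc Name, ∃ t : ℕ → ℕ, Rearr P N ∧ Surface N N' ∧ Function.Injective t ∧
      N'.beh ρ (a ∘ t) = m := by
  obtain ⟨n, K, hK, hr, t, ht, e⟩ := exists_prenex P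
  rw [e] at h
  obtain ⟨N, N', t', hr', hs, ht', e'⟩ := hK.exists_surface (ha.comp ht) h
  exact ⟨N, N', t ∘ t', hr.trans hr', hs, ht.comp ht', e'⟩

end Redex

/-! ### A model of the theory -/

/-- A set with a relation, thought of as the possible steps. -/
structure RelSet : Type (u + 1) where
  /-- the elements -/
  carrier : Type u
  /-- the steps -/
  rel : carrier → carrier → Prop

/-- Functions that map steps to steps. -/
@[ext] structure RelSet.Hom (X Y : RelSet.{u}) where
  /-- the function -/
  toFun : X.carrier → Y.carrier
  map_rel : ∀ {x x'}, X.rel x x' → Y.rel (toFun x) (toFun x')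

namespace RelSet

instance (X Y : RelSet.{u}) : CoeFun (X.Hom Y) fun _ => X.carrier → Y.carrier := ⟨Hom.toFun⟩

/-- A set without steps. -/
def discrete (A : Type u) : RelSet.{u} := ⟨A, fun _ _ => False⟩

/-- Pairs; a step of a pair is a step of exactly one of its entries. This, rather than the
categorical product, makes the hom-sets with pointwise steps an internal hom. -/
def prod (X Y : RelSet.{u}) : RelSet.{u} :=
  ⟨X.carrier × Y.carrier, fun p q => (X.rel p.1 q.1 ∧ p.2 = q.2) ∨ (p.1 = q.1 ∧ Y.rel p.2 q.2)⟩

/-- Functions with pointwise steps. -/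
def hom (X Y : RelSet.{u}) : RelSet.{u} := ⟨X.Hom Y, fun f g => ∀ x, Y.rel (f x) (g x)⟩

namespace Hom

variable {X Y Z X' Y' : RelSet.{u}}

/-- The identity. -/
def id (X : RelSet.{u}) : X.Hom X := ⟨fun x => x, fun h => h⟩

/-- Composition, in diagrammatic order. -/
def comp (f : X.Hom Y) (g : Y.Hom Z) : X.Hom Z :=
  ⟨fun x => g (f x), fun h => g.map_rel (f.map_rel h)⟩

/-- The tensor product of functions. -/
def prod (f : X.Hom Y) (g : X'.Hom Y') : (X.prod X').Hom (Y.prod Y') where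
  toFun p := (f p.1, g p.2)
  map_rel h := h.imp (fun h => ⟨f.map_rel h.1, congrArg g h.2⟩)
    fun h => ⟨congrArg f h.1, g.map_rel h.2⟩

/-- Any function on a set without steps. -/
def ofDiscrete (hX : ∀ x x', ¬ X.rel x x') (f : X.carrier → Y.carrier) : X.Hom Y :=
  ⟨f, fun h => (hX _ _ h).elim⟩

/-- Evaluation. -/
def ev (X Y : RelSet.{u}) : (X.prod (X.hom Y)).Hom Y where
  toFun p := p.2.toFun p.1
  map_rel {p q} h := by
    obtain ⟨x, f⟩ := p
    obtain ⟨x', f'⟩ := q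
    obtain ⟨h, e⟩ | ⟨e, h⟩ := h
    · obtain rfl : f = f' := e
      exact f.map_rel h
    · obtain rfl : x = x' := e
      exact h x

/-- Currying. -/
def curry (f : (X.prod Y).Hom Z) : Y.Hom (X.hom Z) where
  toFun y := ⟨fun x => f (x, y), fun h => f.map_rel (.inl ⟨h, rfl⟩)⟩
  map_rel h _ := f.map_rel (.inr ⟨rfl, h⟩)

/-- The associator. -/
def assocHom (X Y Z : RelSet.{u}) : ((X.prod Y).prod Z).Hom (X.prod (Y.prod Z)) where
  toFun p := (p.1.1, p.1.2, p.2)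
  map_rel {p q} h := by
    obtain ⟨⟨h, e⟩ | ⟨e, h⟩, e'⟩ | ⟨e, h⟩ := h
    · exact .inl ⟨h, Prod.ext e e'⟩
    · exact .inr ⟨e, .inl ⟨h, e'⟩⟩
    · exact .inr ⟨congrArg (fun x => x.1) e, .inr ⟨congrArg (fun x => x.2) e, h⟩⟩

/-- The inverse of the associator. -/
def assocInv (X Y Z : RelSet.{u}) : (X.prod (Y.prod Z)).Hom ((X.prod Y).prod Z) where
  toFun p := ((p.1, p.2.1), p.2.2)
  map_rel {p q} h := by
    obtain ⟨h, e⟩ | ⟨e, ⟨h, e'⟩ | ⟨e', h⟩⟩ := h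
    · exact .inl ⟨.inl ⟨h, congrArg (fun x => x.1) e⟩, congrArg (fun x => x.2) e⟩
    · exact .inl ⟨.inr ⟨e, h⟩, e'⟩
    · exact .inr ⟨Prod.ext e e', h⟩

/-- The left unitor. -/
def leftHom (X : RelSet.{u}) : ((discrete PUnit).prod X).Hom X where
  toFun p := p.2
  map_rel h := h.elim (fun h => h.1.elim) fun h => h.2

/-- The inverse of the left unitor. -/
def leftInv (X : RelSet.{u}) : X.Hom ((discrete PUnit).prod X) where
  toFun x := (PUnit.unit, x)
  map_rel h := .inr ⟨rfl, h⟩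

/-- The right unitor. -/
def rightHom (X : RelSet.{u}) : (X.prod (discrete PUnit)).Hom X where
  toFun p := p.1
  map_rel h := h.elim (fun h => h.1) fun h => h.2.elim

/-- The inverse of the right unitor. -/
def rightInv (X : RelSet.{u}) : X.Hom (X.prod (discrete PUnit)) where
  toFun x := (x, PUnit.unit)
  map_rel h := .inl ⟨h, rfl⟩

/-- The symmetry. -/
def braid (X Y : RelSet.{u}) : (X.prod Y).Hom (Y.prod X) where
  toFun p := (p.2, p.1)
  map_rel h := h.elim (fun h => .inr ⟨h.2, h.1⟩) fun h => .inl ⟨h.2, h.1⟩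

end Hom

end RelSet

section Model

variable {Name : Type u}

open RelSet

/-- The interpretation of objects: names are their values, processes their behaviours. -/
def Ob.sem : Ob Name → RelSet.{u}
  | .N => discrete (Val Name)
  | .P => ⟨Beh (Val Name), Beh.Fire Val.default⟩
  | .unit => discrete PUnit
  | .tensor X Y => X.sem.prod Y.sem
  | .hom X Y => X.sem.hom Y.sem

theorem not_rel_pow (n : ℕ) : ∀ x x', ¬ (Ob.pow n : Ob Name).sem.rel x x' := by
  induction n with
  | zero => exact fun _ _ h => h
  | succ n ih => exact fun _ _ h => h.elim (fun h => h.1) fun h => ih _ _ h.2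

/-- The entries of a tuple. -/
def toVals : (n : ℕ) → (Ob.pow n : Ob Name).sem.carrier → List (Val Name)
  | 0, _ => []
  | n + 1, v => v.1 :: toVals n v.2

/-- The tuple of the first entries of a stream. -/
def ofVals : (n : ℕ) → (ℕ → Val Name) → (Ob.pow n : Ob Name).sem.carrier
  | 0, _ => PUnit.unit
  | n + 1, s => (s 0, ofVals n (s ∘ Nat.succ))

theorem length_toVals : ∀ (n : ℕ) (v : (Ob.pow n : Ob Name).sem.carrier), (toVals n v).length = n
  | 0, _ => rfl
  | n + 1, v => congrArg Nat.succ (length_toVals n v.2)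

theorem ofVals_toVals : ∀ (n : ℕ) (v : (Ob.pow n : Ob Name).sem.carrier),
    ofVals n (streamOf Val.default (toVals n v)) = v
  | 0, _ => rfl
  | n + 1, v => Prod.ext rfl (ofVals_toVals n v.2)

/-- Parallel composition of behaviours. -/
def parSem : ((Ob.P : Ob Name).sem.prod (Ob.P : Ob Name).sem).Hom (Ob.P : Ob Name).sem where
  toFun := fun (p : Beh (Val Name) × Beh (Val Name)) => p.1 + p.2
  map_rel {p q} h := by
    obtain ⟨m, r⟩ := p
    obtain ⟨m', r'⟩ := q
    obtain ⟨h, e⟩ | ⟨e, h⟩ := h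
    · obtain rfl : r = r' := e
      exact Beh.Fire.add_right h r
    · obtain rfl : m = m' := e
      have := Beh.Fire.add_right h m
      rwa [@add_comm (Beh (Val Name)) _ r m, @add_comm (Beh (Val Name)) _ r' m] at this

/-- Input. -/
noncomputable def inpSem (n : ℕ) :
    ((Ob.N : Ob Name).sem.prod ((Ob.pow n : Ob Name).sem.hom (Ob.P : Ob Name).sem)).Hom
      (Ob.P : Ob Name).sem where
  toFun p := Beh.inp p.1 n fun s => p.2.toFun (ofVals n s)
  map_rel {p q} h := by
    obtain ⟨x, f⟩ := p
    obtain ⟨x', f'⟩ := q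
    obtain ⟨h, -⟩ | ⟨e, h⟩ := h
    · exact h.elim
    · obtain rfl : x = x' := e
      have := Beh.Fire.inp (d := Val.default) x n 0 fun s => h (ofVals n s)
      rwa [add_zero, add_zero] at this

/-- The interpretation of formal 1-morphisms: functions that depend on a stream of values for the
new names; every part of a formal 1-morphism has its own part of the stream. -/
noncomputable def Term.eval : ∀ {X Y : Ob Name}, Term X Y → (ℕ → Val Name) → X.sem.Hom Y.sem
  | _, _, .id X, _ => Hom.id X.sem
  | _, _, .comp f g, a => (f.eval (a ∘ evens)).comp (g.eval (a ∘ odds))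
  | _, _, .tensor f g, a => (f.eval (a ∘ evens)).prod (g.eval (a ∘ odds))
  | _, _, .assocHom X Y Z, _ => Hom.assocHom X.sem Y.sem Z.sem
  | _, _, .assocInv X Y Z, _ => Hom.assocInv X.sem Y.sem Z.sem
  | _, _, .leftHom X, _ => Hom.leftHom X.sem
  | _, _, .leftInv X, _ => Hom.leftInv X.sem
  | _, _, .rightHom X, _ => Hom.rightHom X.sem
  | _, _, .rightInv X, _ => Hom.rightInv X.sem
  | _, _, .braid X Y, _ => Hom.braid X.sem Y.sem
  | _, _, .ev X Y, _ => Hom.ev X.sem Y.sem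
  | _, _, .curry f, a => (f.eval a).curry
  | _, _, .dup, _ => Hom.ofDiscrete (fun _ _ h => h) fun x => (x, x)
  | _, _, .del, _ => Hom.ofDiscrete (fun _ _ h => h) fun _ => PUnit.unit
  | _, _, .par, _ => parSem
  | _, _, .nil, _ => Hom.ofDiscrete (fun _ _ h => h) fun _ => (0 : Beh (Val Name))
  | _, _, .inp n, _ => inpSem n
  | _, _, .out n, _ => Hom.ofDiscrete (not_rel_pow (n + 1)) fun p => Beh.out p.1 (toVals n p.2)
  | _, _, .fresh, a => Hom.ofDiscrete (fun _ _ h => h) fun _ => a 0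
  | _, _, .COMM, _ => Hom.ofDiscrete (fun _ _ h => h) fun _ => Beh.cat
  | _, _, .name x, _ => Hom.ofDiscrete (fun _ _ h => h) fun _ => Sum.inl x

/-- Equal 1-morphisms have the same interpretation, up to the choice of the new names. -/
theorem TermEq.same_eval {X Y : Ob Name} {f g : Term X Y} (h : TermEq f g) :
    Same f.eval g.eval := by
  have triv : ∀ {X Y : Ob Name} (f g : Term X Y), (∀ a x, f.eval a x = g.eval a x) →
      Same f.eval g.eval := fun f g h => Same.of_eq fun a => Hom.ext (funext (h a))
  induction h with
  | refl f => exact Same.refl _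
  | symm _ ih => exact ih.symm
  | trans _ _ ih ih' => exact ih.trans ih'
  | comp _ _ ih ih' => exact ih.map₂ Hom.comp ih'
  | tensor _ _ ih ih' => exact ih.map₂ Hom.prod ih'
  | curry _ ih => exact ih.map Hom.curry
  | id_comp f => exact Same.reindex f.eval odds_injective
  | comp_id f => exact Same.reindex f.eval evens_injective
  | assoc f g h => exact Same.assoc fun a b c => ((f.eval a).comp (g.eval b)).comp (h.eval c)
  | tensor_comp f f' g g' =>
    exact Same.interchange fun a b c d =>
      ((f.eval a).prod (f'.eval b)).comp ((g.eval c).prod (g'.eval d))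
  | assoc_nat f f' f'' =>
    have := Same.assoc fun a b c => (((f.eval a).prod (f'.eval b)).prod (f''.eval c)).comp
      (Hom.assocHom _ _ _)
    exact (Same.reindex _ evens_injective).trans
      (this.trans (Same.reindex _ odds_injective).symm)
  | left_nat f =>
    have key := fun {s} hs => Same.reindex (s := s) (fun a => (Hom.leftHom _).comp (f.eval a)) hs
    exact (key (evens_injective.comp odds_injective)).trans (key odds_injective).symm
  | right_nat f =>
    have key := fun {s} hs => Same.reindex (s := s) (fun a => (Hom.rightHom _).comp (f.eval a)) hs
    exact (key (evens_injective.comp evens_injective)).trans (key odds_injective).symm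
  | braid_nat f f' =>
    have := Same.swap fun a b => ((f.eval a).prod (f'.eval b)).comp (Hom.braid _ _)
    exact (Same.reindex _ evens_injective).trans
      (this.trans (Same.reindex _ odds_injective).symm)
  | curry_beta f =>
    exact Same.reindex f.eval (evens_injective.comp odds_injective)
  | curry_eta g =>
    exact Same.reindex g.eval (evens_injective.comp odds_injective)
  | par_assoc => exact triv _ _ fun _ _ => add_assoc (G := Beh (Val Name)) _ _ _
  | par_comm => exact triv _ _ fun _ _ => add_comm (G := Beh (Val Name)) _ _
  | par_nil => exact triv _ _ fun _ _ => add_zero (M := Beh (Val Name)) _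
  | _ => exact triv _ _ fun _ _ => rfl

/-- An element of the interpretation of `P`, as a behaviour. -/
abbrev asBeh (m : (Ob.P : Ob Name).sem.carrier) : Beh (Val Name) := m

/-- The 1-morphism `f` is interpreted by `F`, up to the use that is made of the stream. -/
def Interp {X Y : Ob Name} (f : X ⟶ Y) (F : (ℕ → Val Name) → X.sem.carrier → Y.sem.carrier) :
    Prop :=
  ∃ t : Term X Y, t.mk = f ∧ ∃ Φ : (ℕ → Val Name) → X.sem.Hom Y.sem,
    Same t.eval Φ ∧ ∀ a x, Φ a x = F a x

namespace Interp

variable {X Y Z X' Y' : Ob Name}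

/-- The interpretation of a 1-morphism is determined up to the choice of the new names. -/
theorem same {f : X ⟶ Y} {F G : (ℕ → Val Name) → X.sem.carrier → Y.sem.carrier}
    (hF : Interp f F) (hG : Interp f G) : Same F G := by
  obtain ⟨t, rfl, Φ, h, e⟩ := hF
  obtain ⟨t', ht, Ψ, h', e'⟩ := hG
  have := ((h.symm.trans (Quotient.exact ht).same_eval.symm).trans h').map Hom.toFun
  rwa [show (fun a => (Φ a).toFun) = F from funext fun a => funext (e a),
    show (fun a => (Ψ a).toFun) = G from funext fun a => funext (e' a)] at this

theorem congr {f : X ⟶ Y} {F G : (ℕ → Val Name) → X.sem.carrier → Y.sem.carrier}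
    (hF : Interp f F) (h : ∀ a x, F a x = G a x) : Interp f G :=
  (funext fun a => funext (h a) : F = G) ▸ hF

theorem of_term (t : Term X Y) : Interp t.mk fun a => t.eval a :=
  ⟨t, rfl, _, Same.refl _, fun _ _ => rfl⟩

theorem exists_interp (f : X ⟶ Y) : ∃ F, Interp f F := by
  revert f
  rintro ⟨t⟩
  exact ⟨_, Interp.of_term t⟩

theorem map_rel {f : X ⟶ Y} {F : (ℕ → Val Name) → X.sem.carrier → Y.sem.carrier}
    (hF : Interp f F) (a : ℕ → Val Name) {x x' : X.sem.carrier} (h : X.sem.rel x x') :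
    Y.sem.rel (F a x) (F a x') := by
  obtain ⟨-, -, Φ, -, e⟩ := hF
  rw [← e, ← e]
  exact (Φ a).map_rel h

theorem comp {f : X ⟶ Y} {g : Y ⟶ Z} {F G} (hF : Interp f F) (hG : Interp g G) :
    Interp (f ≫ g) fun a x => G (a ∘ odds) (F (a ∘ evens) x) := by
  obtain ⟨t, rfl, Φ, h, e⟩ := hF
  obtain ⟨t', rfl, Ψ, h', e'⟩ := hG
  refine ⟨t.comp t', rfl, fun a => (Φ (a ∘ evens)).comp (Ψ (a ∘ odds)), h.map₂ Hom.comp h',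
    fun a x => ?_⟩
  exact (congrArg (Ψ (a ∘ odds)).toFun (e _ _)).trans (e' _ _)

theorem tensor {f : X ⟶ Y} {g : X' ⟶ Y'} {F G} (hF : Interp f F) (hG : Interp g G) :
    Interp (f ⊗ₘ g) fun a x => (F (a ∘ evens) x.1, G (a ∘ odds) x.2) := by
  obtain ⟨t, rfl, Φ, h, e⟩ := hF
  obtain ⟨t', rfl, Ψ, h', e'⟩ := hG
  refine ⟨t.tensor t', rfl, fun a => (Φ (a ∘ evens)).prod (Ψ (a ∘ odds)), h.map₂ Hom.prod h',
    fun a x => ?_⟩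
  exact Prod.ext (e _ _) (e' _ _)

theorem reindex {f : X ⟶ Y} {F} (hF : Interp f F) {s : ℕ → ℕ} (hs : Function.Injective s) :
    Interp f fun a => F (a ∘ s) := by
  obtain ⟨t, rfl, Φ, h, e⟩ := hF
  exact ⟨t, rfl, _, h.trans (Same.reindex Φ hs).symm, fun a x => e _ x⟩

/-- Only a part of the stream need be used. The domain has no steps, so that it does not matter
whether `F a` maps steps to steps for every `a`. -/
theorem of_reindex {n : ℕ} {f : Ob.pow n ⟶ Y} {F} {s : ℕ → ℕ} (hs : Function.Injective s)
    (hF : Interp f fun a => F (a ∘ s)) : Interp f F := by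
  obtain ⟨t, rfl, Φ, h, e⟩ := hF
  refine ⟨t, rfl, fun a => Hom.ofDiscrete (not_rel_pow n) (F a), h.trans (Same.trans ?_
    (Same.reindex _ hs)), fun _ _ => rfl⟩
  exact Same.of_eq fun a => Hom.ext (funext (e a))

theorem curry {f : X ⊗ Y ⟶ Z} {F} (hF : Interp f F) :
    ∃ G, Interp (X := Y) (Y := Ob.hom X Z) (PiCalc.curry f) G ∧
      ∀ a y x, Hom.toFun (X := X.sem) (Y := Z.sem) (G a y) x = F a (x, y) := by
  obtain ⟨t, rfl, Φ, h, e⟩ := hF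
  exact ⟨_, ⟨t.curry, rfl, _, h.map Hom.curry, fun _ _ => rfl⟩, fun a y x => e a (x, y)⟩

theorem id (X : Ob Name) : Interp (𝟙 X) fun _ x => x := Interp.of_term (.id X)

theorem whiskerLeft {f : X' ⟶ Y'} {F} (hF : Interp f F) :
    Interp (X ◁ f) fun a x => (x.1, F (a ∘ odds) x.2) := by
  rw [← id_tensorHom]
  exact (id X).tensor hF

theorem whiskerRight {f : X ⟶ Y} {F} (hF : Interp f F) :
    Interp (f ▷ X') fun a x => (F (a ∘ evens) x.1, x.2) := by
  rw [← tensorHom_id]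
  exact hF.tensor (id X')

theorem assocHom (X Y Z : Ob Name) : Interp (α_ X Y Z).hom fun _ x => (x.1.1, x.1.2, x.2) :=
  Interp.of_term (.assocHom X Y Z)

theorem assocInv (X Y Z : Ob Name) : Interp (α_ X Y Z).inv fun _ x => ((x.1, x.2.1), x.2.2) :=
  Interp.of_term (.assocInv X Y Z)

theorem leftHom (X : Ob Name) : Interp (λ_ X).hom fun _ x => x.2 := Interp.of_term (.leftHom X)

theorem leftInv (X : Ob Name) : Interp (λ_ X).inv fun _ x => (PUnit.unit, x) :=
  Interp.of_term (.leftInv X)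

theorem rightHom (X : Ob Name) : Interp (ρ_ X).hom fun _ x => x.1 := Interp.of_term (.rightHom X)

theorem rightInv (X : Ob Name) : Interp (ρ_ X).inv fun _ x => (x, PUnit.unit) :=
  Interp.of_term (.rightInv X)

theorem braid (X Y : Ob Name) : Interp (β_ X Y).hom fun _ x => (x.2, x.1) :=
  Interp.of_term (.braid X Y)

theorem tensorμ (X Y X' Y' : Ob Name) : Interp (MonoidalCategory.tensorμ X Y X' Y')
    fun _ x => ((x.1.1, x.2.1), (x.1.2, x.2.2)) :=
  (assocHom _ _ _).comp <| (assocInv _ _ _).whiskerLeft.comp <|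
    (braid _ _).whiskerRight.whiskerLeft.comp <| (assocHom _ _ _).whiskerLeft.comp <|
    assocInv _ _ _

theorem withCOMM {f : X ⟶ Ob.P} {F} (hF : Interp f F) : Interp (PiCalc.withCOMM f)
    fun a x => asBeh (F (a ∘ evens) x) + Beh.cat :=
  hF.comp <| (rightInv _).comp <| (Interp.of_term .COMM).whiskerLeft.comp (Interp.of_term .par)

end Interp

theorem interp_commSrc (n : ℕ) : Interp (Name := Name) (commSrc n) fun _ x =>
    (Beh.out x.1 (toVals n x.2.1) + Beh.inp x.1 n (fun s => x.2.2.toFun (ofVals n s)) + Beh.cat :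
      Beh (Val Name)) :=
  ((Interp.of_term .dup).whiskerRight.comp <| (Interp.tensorμ _ _ _ _).comp <|
    ((Interp.of_term (.out n)).tensor (Interp.of_term (.inp n))).comp
      (Interp.of_term .par)).withCOMM

theorem interp_commTgt (n : ℕ) : Interp (Name := Name) (commTgt n) fun _ x =>
    (asBeh (x.2.2.toFun x.2.1) + Beh.cat) :=
  (((Interp.of_term .del).tensor (Interp.of_term (.ev _ _))).comp (Interp.leftHom _)).withCOMM

/-- Without generating 2-morphisms, source and target agree. -/
theorem Cell.eq_of_commCount {X Y : Ob Name} {f g : X ⟶ Y} (s : Cell f g) :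
    s.commCount = 0 → f = g := by
  induction s with
  | id f => exact fun _ => rfl
  | comm n => exact fun h => absurd h one_ne_zero
  | vcomp s t ihs iht =>
    intro h
    exact (ihs (Nat.add_eq_zero_iff.1 h).1).trans (iht (Nat.add_eq_zero_iff.1 h).2)
  | hcomp s t ihs iht =>
    intro h
    rw [ihs (Nat.add_eq_zero_iff.1 h).1, iht (Nat.add_eq_zero_iff.1 h).2]
  | tensor s t ihs iht =>
    intro h
    rw [ihs (Nat.add_eq_zero_iff.1 h).1, iht (Nat.add_eq_zero_iff.1 h).2]
  | curry s ih => exact fun h => congrArg PiCalc.curry (ih h)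

/-- A single communication at top level is a step of the model. -/
theorem Cell.exists_rel {X Y : Ob Name} {f g : X ⟶ Y} (s : Cell f g) :
    s.commCount = 1 → s.TopLevel → ∃ F G, Interp f F ∧ Interp g G ∧
      ∀ a x, Y.sem.rel (F a x) (G a x) := by
  induction s with
  | id f => exact fun h => absurd h zero_ne_one
  | comm n =>
    refine fun _ _ => ⟨_, _, interp_commSrc n, interp_commTgt n, fun a x => ?_⟩
    have := Beh.Fire.comm (d := Val.default) x.1 (toVals n x.2.1)
      (fun s => x.2.2.toFun (ofVals n s)) 0
    rwa [length_toVals, ofVals_toVals, add_zero, add_zero] at this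
  | vcomp s t ihs iht =>
    intro h ht
    rcases Nat.add_eq_one_iff.1 h with ⟨h₀, h₁⟩ | ⟨h₁, h₀⟩
    · rw [s.eq_of_commCount h₀]
      exact iht h₁ ht.2
    · rw [← t.eq_of_commCount h₀]
      exact ihs h₁ ht.1
  | @hcomp X Y Z f g f' g' s t ihs iht =>
    intro h ht
    rcases Nat.add_eq_one_iff.1 h with ⟨h₀, h₁⟩ | ⟨h₁, h₀⟩
    · obtain ⟨F, G, hF, hG, hr⟩ := iht h₁ ht.2
      obtain ⟨K, hK⟩ := Interp.exists_interp f
      rw [← s.eq_of_commCount h₀]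
      exact ⟨_, _, hK.comp hF, hK.comp hG, fun a x => hr _ _⟩
    · obtain ⟨F, G, hF, hG, hr⟩ := ihs h₁ ht.1
      obtain ⟨K, hK⟩ := Interp.exists_interp f'
      rw [← t.eq_of_commCount h₀]
      exact ⟨_, _, hF.comp hK, hG.comp hK, fun a x => hK.map_rel _ (hr _ _)⟩
  | @tensor X Y X' Y' f g f' g' s t ihs iht =>
    intro h ht
    rcases Nat.add_eq_one_iff.1 h with ⟨h₀, h₁⟩ | ⟨h₁, h₀⟩
    · obtain ⟨F, G, hF, hG, hr⟩ := iht h₁ ht.2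
      obtain ⟨K, hK⟩ := Interp.exists_interp f
      rw [← s.eq_of_commCount h₀]
      exact ⟨_, _, hK.tensor hF, hK.tensor hG, fun a x => .inr ⟨rfl, hr _ _⟩⟩
    · obtain ⟨F, G, hF, hG, hr⟩ := ihs h₁ ht.1
      obtain ⟨K, hK⟩ := Interp.exists_interp f'
      rw [← t.eq_of_commCount h₀]
      exact ⟨_, _, hF.tensor hK, hG.tensor hK, fun a x => .inl ⟨hr _ _, rfl⟩⟩
  | curry s _ => exact fun h ht => absurd (h.symm.trans ht) one_ne_zero

/-! ### The model of the interpretation of processes -/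

theorem interp_delPow : ∀ n : ℕ, Interp (Name := Name) (delPow n) fun _ _ => PUnit.unit
  | 0 => Interp.id _
  | n + 1 => ((Interp.of_term .del).tensor (interp_delPow n)).comp (Interp.leftHom _)

theorem interp_dupPow : ∀ n : ℕ, Interp (Name := Name) (dupPow n) fun _ x => (x, x)
  | 0 => (Interp.leftInv _).congr fun _ _ => rfl
  | n + 1 => ((Interp.of_term .dup).tensor (interp_dupPow n)).comp (Interp.tensorμ _ _ _ _)

/-- Different names are different 1-morphisms, because the model tells them apart. -/
theorem name_injective : Function.Injective (name : Name → (𝟙_ (Ob Name) ⟶ Ob.N)) := by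
  intro x y h
  have hx := Interp.of_term (Term.name x)
  have hy := Interp.of_term (Term.name y)
  rw [show (Term.name x).mk = (Term.name y).mk from h] at hx
  obtain ⟨i, j, -, -, e⟩ := hx.same hy
  exact Sum.inl_injective (congrFun (e fun _ => Val.default) PUnit.unit)

theorem Interp.parHom {Γ : List Name} {f g : env Γ ⟶ Ob.P} {F G} (hF : Interp f F)
    (hG : Interp g G) : Interp (PiCalc.parHom f g)
      fun a v => asBeh (F (a ∘ evens) v) + asBeh (G (a ∘ odds) v) := by
  exact Interp.of_reindex (odds_injective.comp evens_injective)
    ((interp_dupPow Γ.length).comp ((hF.tensor hG).comp (Interp.of_term .par)))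

variable [DecidableEq Name]

/-- The values of the names when those in `Γ` have the values `v`. -/
def valuation : (Γ : List Name) → (env Γ).sem.carrier → Name → Val Name
  | [], _ => Sum.inl
  | y :: Γ, v => Function.update (valuation Γ v.2) y v.1

theorem interp_names : ∀ Γ : List Name, ∃ v : (env Γ).sem.carrier,
    Interp (names Γ) (fun _ _ => v) ∧ valuation Γ v = Sum.inl
  | [] => ⟨PUnit.unit, (Interp.id _).congr fun _ _ => rfl, rfl⟩
  | x :: Γ => by
      obtain ⟨v, h, e⟩ := interp_names Γ
      refine ⟨(Sum.inl x, v), (Interp.leftInv _).comp ((Interp.of_term (.name x)).tensor h), ?_⟩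
      simp only [valuation, e]
      exact Function.update_eq_self x (Sum.inl : Name → Val Name)

theorem interp_lookup : ∀ (Γ : List Name) (x : Name),
    Interp (lookup Γ x) fun _ v => valuation Γ v x
  | [], x => Interp.of_term (.name x)
  | y :: Γ, x => by
      by_cases h : x = y
      · subst h
        rw [lookup, if_pos rfl]
        refine ((interp_delPow _).whiskerLeft.comp (Interp.rightHom _)).congr fun a v => ?_
        exact (Function.update_self x v.1 (valuation Γ v.2)).symm
      · rw [lookup, if_neg h]
        refine ((Interp.of_term .del).whiskerRight.comp <| (Interp.leftHom _).comp
          (interp_lookup Γ x)).congr fun a v => ?_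
        exact (Function.update_of_ne h v.1 (valuation Γ v.2)).symm

theorem interp_lookups (Γ : List Name) : ∀ ys : List Name,
    ∃ F : (env Γ).sem.carrier → (env ys).sem.carrier, Interp (lookups Γ ys) (fun _ v => F v) ∧
      ∀ v, toVals ys.length (F v) = ys.map (valuation Γ v)
  | [] => ⟨_, interp_delPow _, fun _ => rfl⟩
  | y :: ys => by
      obtain ⟨F, h, e⟩ := interp_lookups Γ ys
      exact ⟨_, (interp_dupPow _).comp ((interp_lookup Γ y).tensor h),
        fun v => congrArg (valuation Γ v y :: ·) (e v)⟩

theorem interp_concat (Γ : List Name) : ∀ ys : List Name,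
    ∃ F : (env ys).sem.carrier × (env Γ).sem.carrier → (env (ys ++ Γ)).sem.carrier,
      Interp (concat ys Γ) (fun _ p => F p) ∧
      ∀ s v, valuation (ys ++ Γ) (F (ofVals ys.length s, v)) = asg (valuation Γ v) ys s
  | [] => ⟨_, Interp.leftHom _, fun _ _ => rfl⟩
  | y :: ys => by
      obtain ⟨F, h, e⟩ := interp_concat Γ ys
      exact ⟨_, (Interp.assocHom _ _ _).comp h.whiskerLeft,
        fun s v => congrArg (fun ρ : Name → Val Name => Function.update ρ y (s 0)) (e _ v)⟩

/-- The model interprets a process by its behaviour. -/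
theorem Proc.interp_den (P : Proc Name) : ∀ Γ : List Name,
    Interp (P.den Γ) fun a v => P.beh (valuation Γ v) a := by
  induction P with
  | nil => exact fun Γ => (interp_delPow _).comp (Interp.of_term .nil)
  | inp x ys nd P ih =>
    intro Γ
    obtain ⟨F, hF, e⟩ := interp_concat Γ ys
    obtain ⟨G, hG, e'⟩ := (hF.comp (ih (ys ++ Γ))).curry
    refine Interp.reindex (Y := Ob.P) (F := fun a v => Beh.inp (valuation Γ v x) ys.length fun s =>
      P.beh (asg (valuation Γ v) ys s) a) (Interp.of_reindex (s := odds ∘ evens ∘ odds ∘ odds)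
        (odds_injective.comp (evens_injective.comp (odds_injective.comp odds_injective)))
        (((interp_dupPow _).comp (((interp_lookup Γ x).tensor hG).comp
          (Interp.of_term (.inp ys.length)))).congr fun a v => ?_)) evens_injective
    refine congrArg (Beh.inp _ _) (funext fun s => ?_)
    refine (e' _ _ _).trans ?_
    simp only [e]
    rfl
  | out x ys =>
    intro Γ
    obtain ⟨F, hF, e⟩ := interp_lookups Γ ys
    refine ((interp_dupPow _).comp (((interp_lookup Γ x).tensor hF).comp
      (Interp.of_term (.out ys.length)))).congr fun a v => ?_
    exact congrArg (Beh.out _) (e v)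
  | new x P ih =>
    intro Γ
    have hs : Function.Injective (scons (odds (evens (evens 0))) (odds ∘ odds)) :=
      scons_injective (odds_injective.comp odds_injective) fun n => by
        simp only [evens, odds, Function.comp]; omega
    exact Interp.of_reindex hs
      ((Interp.leftInv _).comp ((Interp.of_term .fresh).whiskerRight.comp (ih (x :: Γ))))
  | par P Q ihP ihQ => exact fun Γ => (ihP Γ).parHom (ihQ Γ)

theorem Proc.interp_close_den (P : Proc Name) (Γ : List Name) :
    Interp (close Γ (P.den Γ)) fun a _ => P.beh Sum.inl a := by
  obtain ⟨v, h, e⟩ := interp_names Γ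
  have := Interp.of_reindex (n := 0) (Y := Ob.P) (s := odds)
    (F := fun a _ => P.beh (valuation Γ v) a) odds_injective (h.comp (P.interp_den Γ))
  rwa [e] at this

/-- A semantic reduction between interpretations of processes is a communication of their
behaviours, for suitable choices of the new names. -/
theorem CommStep.exists_comm {Γ : List Name} {P P' : Proc Name}
    (h : CommStep Γ (P.den Γ) (P'.den Γ)) : ∃ i j : ℕ → ℕ, Function.Injective i ∧
    Function.Injective j ∧
    ∀ a, Beh.Comm Val.default (P.beh Sum.inl (a ∘ i)) (P'.beh Sum.inl (a ∘ j)) := by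
  obtain ⟨-, s, -, hs, ht⟩ := h
  obtain ⟨F, G, hF, hG, hr⟩ := s.exists_rel hs ht
  obtain ⟨i, j, hi, hj, e⟩ := hF.same (P.interp_close_den Γ).withCOMM
  obtain ⟨k, l, hk, hl, e'⟩ := hG.same (P'.interp_close_den Γ).withCOMM
  obtain ⟨p, q, hp, hq, hpq⟩ := exists_amalgam hi hk
  refine ⟨p ∘ j ∘ evens, q ∘ l ∘ evens, hp.comp (hj.comp evens_injective),
    hq.comp (hl.comp evens_injective), fun a => ?_⟩
  refine Beh.Fire.comm_of_not_hasCat (P.not_hasCat_beh _ _) ?_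
  have h := hr ((a ∘ p) ∘ i) PUnit.unit
  have h₁ : (a ∘ p) ∘ i = (a ∘ q) ∘ k := funext fun n => congrArg a (hpq n)
  have h₂ := congrFun (e (a ∘ p)) PUnit.unit
  have h₃ := congrFun (e' (a ∘ q)) PUnit.unit
  rw [← h₁] at h₃
  rw [h₂, h₃] at h
  exact h

end Model

/-! ### Cocommutative comonoids -/

section Comonoids

open ComonObj

variable {C : Type*} [Category C] [MonoidalCategory C]

attribute [local instance] ComonObj.instTensorUnit

section

variable {X Y A A' B B' D : C} [ComonObj X] [ComonObj Y]

/-- The pairing of two morphisms out of a comonoid. -/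
def lift (f : X ⟶ A) (g : X ⟶ B) : X ⟶ A ⊗ B := Δ ≫ (f ⊗ₘ g)

theorem lift_map (f : X ⟶ A) (g : X ⟶ B) (f' : A ⟶ A') (g' : B ⟶ B') :
    lift f g ≫ (f' ⊗ₘ g') = lift (f ≫ f') (g ≫ g') := by
  simp [lift]

theorem lift_map_assoc (f : X ⟶ A) (g : X ⟶ B) (f' : A ⟶ A') (g' : B ⟶ B') (h : A' ⊗ B' ⟶ D) :
    lift f g ≫ (f' ⊗ₘ g') ≫ h = lift (f ≫ f') (g ≫ g') ≫ h := by
  rw [← Category.assoc, lift_map]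

theorem lift_whiskerLeft (f : X ⟶ A) (g : X ⟶ B) (g' : B ⟶ B') :
    lift f g ≫ A ◁ g' = lift f (g ≫ g') := by
  rw [← id_tensorHom, lift_map, Category.comp_id]

theorem lift_whiskerRight (f : X ⟶ A) (g : X ⟶ B) (f' : A ⟶ A') :
    lift f g ≫ f' ▷ B = lift (f ≫ f') g := by
  rw [← tensorHom_id, lift_map, Category.comp_id]

theorem comp_lift (h : X ⟶ Y) [IsComonHom h] (f : Y ⟶ A) (g : Y ⟶ B) :
    h ≫ lift f g = lift (h ≫ f) (h ≫ g) := by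
  simp [lift]

theorem lift_counit_left (g : X ⟶ B) : lift ε g ≫ (λ_ B).hom = g := by
  simp [lift]

theorem lift_counit_right (f : X ⟶ A) : lift f ε ≫ (ρ_ A).hom = f := by
  simp [lift]

theorem lift_assoc_hom (f : X ⟶ A) (g : X ⟶ B) (h : X ⟶ D) :
    lift (lift f g) h ≫ (α_ A B D).hom = lift f (lift g h) := by
  have h1 : lift (lift f g) h = Δ ≫ Δ ▷ X ≫ ((f ⊗ₘ g) ⊗ₘ h) := by
    simp only [lift, ← tensorHom_id, tensorHom_comp_tensorHom, Category.id_comp]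
  have h2 : lift f (lift g h) = Δ ≫ X ◁ Δ ≫ (f ⊗ₘ (g ⊗ₘ h)) := by
    simp only [lift, ← id_tensorHom, tensorHom_comp_tensorHom, Category.id_comp]
  rw [h1, h2, Category.assoc, Category.assoc, associator_naturality, comul_assoc_assoc]

theorem lift_assoc_inv (f : X ⟶ A) (g : X ⟶ B) (h : X ⟶ D) :
    lift f (lift g h) ≫ (α_ A B D).inv = lift (lift f g) h := by
  rw [← lift_assoc_hom, Category.assoc, Iso.hom_inv_id, Category.comp_id]

end

section

variable {X Y A B D : C}

/-- The second projection of a product of comonoids. -/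
def snd (A X : C) [ComonObj A] : A ⊗ X ⟶ X := (ε ⊗ₘ 𝟙 X) ≫ (λ_ X).hom

/-- The first projection of a product of comonoids. -/
def fst (A X : C) [ComonObj X] : A ⊗ X ⟶ A := (𝟙 A ⊗ₘ ε) ≫ (ρ_ A).hom

theorem isComonHom_counit [ComonObj X] : IsComonHom ε[X] where
  hom_counit := by simp
  hom_comul := by simp [unitors_inv_equal]

theorem lift_snd [ComonObj X] [ComonObj A] (f : X ⟶ A) [IsComonHom f] (g : X ⟶ B) :
    lift f g ≫ snd A B = g := by
  rw [snd, lift_map_assoc, IsComonHom.hom_counit, Category.comp_id, lift_counit_left]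

theorem lift_fst [ComonObj X] [ComonObj B] (f : X ⟶ A) (g : X ⟶ B) [IsComonHom g] :
    lift f g ≫ fst A B = f := by
  rw [fst, lift_map_assoc, IsComonHom.hom_counit, Category.comp_id, lift_counit_right]

theorem whiskerLeft_snd [ComonObj A] (f : X ⟶ Y) : A ◁ f ≫ snd A Y = snd A X ≫ f := by
  simp [snd, MonoidalCategory.tensorHom_def, whisker_exchange_assoc]

theorem whiskerLeft_fst [ComonObj X] [ComonObj Y] (f : X ⟶ Y) [IsComonHom f] :
    A ◁ f ≫ fst A Y = fst A X := by
  simp [fst, ← whiskerLeft_comp_assoc]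

theorem associator_snd [ComonObj A] : (α_ A X Y).hom ≫ snd A (X ⊗ Y) = snd A X ▷ Y := by
  simp [snd]

theorem whiskerRight_fst [ComonObj Y] (f : A ⟶ X) : f ▷ Y ≫ fst X Y = fst A Y ≫ f := by
  simp [fst, ← whisker_exchange_assoc]

theorem whiskerRight_snd [ComonObj A] [ComonObj X] (f : A ⟶ X) [IsComonHom f] :
    f ▷ Y ≫ snd X Y = snd A Y := by
  simp [snd, ← comp_whiskerRight_assoc]

end

variable [SymmetricCategory C]

section

variable {X Y A B D E : C} [ComonObj X] [ComonObj Y] [IsCommComonObj X]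

theorem lift_braid (f : X ⟶ A) (g : X ⟶ B) : lift f g ≫ (β_ A B).hom = lift g f := by
  rw [lift, Category.assoc, BraidedCategory.braiding_naturality,
    IsCommComonObj.comul_comm_assoc, lift]

theorem lift_tensorμ (f : X ⟶ A) (g : X ⟶ B) (h : X ⟶ D) (k : X ⟶ E) :
    lift (lift f g) (lift h k) ≫ tensorμ A B D E = lift (lift f h) (lift g k) := by
  simp only [tensorμ, ← Category.assoc, lift_assoc_hom, lift_whiskerLeft, lift_assoc_inv,
    lift_whiskerRight, lift_braid]

end

section

variable {X Y A B : C} [ComonObj X] [ComonObj Y] [ComonObj A] [ComonObj B]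

instance isComonHom_lift [IsCommComonObj X] (f : X ⟶ A) (g : X ⟶ B) [IsComonHom f]
    [IsComonHom g] : IsComonHom (lift f g) where
  hom_counit := by
    rw [Comon.tensorObj_counit, lift_map_assoc, IsComonHom.hom_counit, IsComonHom.hom_counit,
      lift_counit_left]
  hom_comul := by
    rw [Comon.tensorObj_comul, lift_map_assoc, IsComonHom.hom_comul, IsComonHom.hom_comul]
    exact lift_tensorμ f f g g

instance isComonHom_tensor (f : X ⟶ A) (g : Y ⟶ B) [IsComonHom f] [IsComonHom g] :
    IsComonHom (f ⊗ₘ g) where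
  hom_counit := by
    rw [Comon.tensorObj_counit, Comon.tensorObj_counit, tensorHom_comp_tensorHom_assoc,
      IsComonHom.hom_counit, IsComonHom.hom_counit]
  hom_comul := by
    rw [Comon.tensorObj_comul, Comon.tensorObj_comul, tensorHom_comp_tensorHom_assoc,
      IsComonHom.hom_comul, IsComonHom.hom_comul, Category.assoc, ← tensorμ_natural,
      tensorHom_comp_tensorHom_assoc]

instance isComonHom_whiskerLeft (f : Y ⟶ B) [IsComonHom f] : IsComonHom (X ◁ f) := by
  rw [← id_tensorHom]
  infer_instance

instance isComonHom_assoc : IsComonHom (α_ X Y A).hom where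
  hom_counit := by
    simp only [Comon.tensorObj_counit, MonoidalCategory.tensorHom_def]
    simp
  hom_comul := by
    have h := tensor_associativity X X Y Y A A
    have e1 : ((Δ[X] ⊗ₘ Δ[Y]) ≫ tensorμ X X Y Y ⊗ₘ Δ[A]) =
        ((Δ[X] ⊗ₘ Δ[Y]) ⊗ₘ Δ[A]) ≫ tensorμ X X Y Y ▷ (A ⊗ A) := by
      rw [← tensorHom_id, tensorHom_comp_tensorHom, Category.comp_id]
    have e2 : (Δ[X] ⊗ₘ (Δ[Y] ⊗ₘ Δ[A]) ≫ tensorμ Y Y A A) =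
        (Δ[X] ⊗ₘ (Δ[Y] ⊗ₘ Δ[A])) ≫ (X ⊗ X) ◁ tensorμ Y Y A A := by
      rw [← id_tensorHom, tensorHom_comp_tensorHom, Category.comp_id]
    simp only [Comon.tensorObj_comul]
    rw [e1, e2, Category.assoc, Category.assoc, Category.assoc, h, associator_naturality_assoc]

theorem isComonHom_left : IsComonHom (λ_ X).hom where
  hom_counit := by simp [Comon.tensorObj_counit, MonoidalCategory.tensorHom_def]
  hom_comul := by
    have h := tensor_left_unitality X X
    rw [Comon.tensorObj_comul, ← leftUnitor_naturality, h]
    simp [MonoidalCategory.tensorHom_def]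

theorem isComonHom_right : IsComonHom (ρ_ X).hom where
  hom_counit := by simp [Comon.tensorObj_counit, MonoidalCategory.tensorHom_def, unitors_equal]
  hom_comul := by
    have h := tensor_right_unitality X X
    rw [Comon.tensorObj_comul, ← rightUnitor_naturality, h]
    simp [MonoidalCategory.tensorHom_def]

instance isComonHom_snd : IsComonHom (snd A X) :=
  have := isComonHom_counit (X := A)
  have := isComonHom_left (X := X)
  inferInstanceAs (IsComonHom ((ε ⊗ₘ 𝟙 X) ≫ (λ_ X).hom))

instance isComonHom_fst : IsComonHom (fst A X) :=
  have := isComonHom_counit (X := X)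
  have := isComonHom_right (X := A)
  inferInstanceAs (IsComonHom ((𝟙 A ⊗ₘ ε) ≫ (ρ_ A).hom))

end

section

variable {X Y A B D : C}

theorem associator_fst [ComonObj X] [ComonObj Y] :
    (α_ A X Y).hom ≫ fst A (X ⊗ Y) = fst (A ⊗ X) Y ≫ fst A X := by
  have h : ε[X] ▷ Y ≫ (λ_ Y).hom ≫ ε[Y] = X ◁ ε[Y] ≫ (ρ_ X).hom ≫ ε[X] := by
    rw [← leftUnitor_naturality, ← whisker_exchange_assoc, unitors_equal, rightUnitor_naturality]
  have h' := congrArg (A ◁ ·) h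
  simp only [whiskerLeft_comp] at h'
  simp [fst, MonoidalCategory.tensorHom_def, reassoc_of% h']

/-- Discarding the first entry of one of two copies of a pair copies the second entry only. -/
theorem lift_id_snd [ComonObj X] [ComonObj A] :
    lift (𝟙 (A ⊗ X)) (snd A X) = A ◁ Δ ≫ (α_ A X X).inv := by
  have h : (ρ_ A).inv ▷ (X ⊗ X) ≫ tensorμ A (𝟙_ C) X X ≫ (A ⊗ X) ◁ (λ_ X).hom =
      (α_ A X X).inv := by
    simp [tensorμ]
    monoidal
  have h' := tensorμ_natural (𝟙 A) ε[A] (𝟙 X) (𝟙 X)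
  rw [id_tensorHom_id, id_tensorHom_id] at h'
  have e : (Δ[A] ⊗ₘ Δ[X]) ≫ ((𝟙 A ⊗ₘ ε[A]) ⊗ₘ 𝟙 (X ⊗ X)) = A ◁ Δ ≫ (ρ_ A).inv ▷ (X ⊗ X) := by
    rw [tensorHom_comp_tensorHom, id_tensorHom, comul_counit, Category.comp_id,
      MonoidalCategory.tensorHom_def', whisker_exchange]
  calc lift (𝟙 (A ⊗ X)) (snd A X)
      = (Δ[A] ⊗ₘ Δ[X]) ≫ (tensorμ A A X X ≫ (𝟙 (A ⊗ X) ⊗ₘ (ε[A] ⊗ₘ 𝟙 X))) ≫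
          (A ⊗ X) ◁ (λ_ X).hom := by
        rw [lift, snd, Comon.tensorObj_comul, Category.assoc, Category.assoc, ← id_tensorHom,
          tensorHom_comp_tensorHom, Category.comp_id]
    _ = _ := by
        rw [← h', ← h, Category.assoc, reassoc_of% e]

/-- A pairing in which the second morphism does not use the parameter `A`. This is the law of scope
extrusion in terms of comonoids. -/
theorem lift_snd_comp [ComonObj X] [ComonObj A] (f : A ⊗ X ⟶ B) (g : X ⟶ D) :
    lift f (snd A X ≫ g) = A ◁ Δ ≫ (α_ A X X).inv ≫ (f ⊗ₘ g) := by
  rw [← Category.assoc, ← lift_id_snd, lift_map, Category.id_comp]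

end

end Comonoids

/-! ### Interpretation over an arbitrary comonoid -/

section Denote

open ComonObj

variable {Name : Type u}

attribute [local instance] ComonObj.instTensorUnit

theorem whiskerLeft_par_par : (Ob.P : Ob Name) ◁ par ≫ par = (α_ _ _ _).inv ≫ par ▷ Ob.P ≫ par := by
  have h : par ▷ (Ob.P : Ob Name) ≫ par = (α_ _ _ _).hom ≫ Ob.P ◁ par ≫ par :=
    Quotient.sound TermEq.par_assoc
  rw [h, Iso.inv_hom_id_assoc]

theorem whiskerLeft_nil_par : (Ob.P : Ob Name) ◁ nil ≫ par = (ρ_ _).hom :=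
  Quotient.sound TermEq.par_nil

theorem braiding_par : (β_ (Ob.P : Ob Name) Ob.P).hom ≫ par = par := Quotient.sound TermEq.par_comm

instance : ComonObj (Ob.N : Ob Name) where
  counit := del
  comul := dup
  counit_comul := by
    have h : (dup : (Ob.N : Ob Name) ⟶ _) ≫ Ob.N ◁ del = (ρ_ _).inv := Quotient.sound TermEq.dup_del
    have h' : (dup : (Ob.N : Ob Name) ⟶ _) ≫ (β_ _ _).hom = dup := Quotient.sound TermEq.dup_comm
    rw [← h', Category.assoc, ← BraidedCategory.braiding_naturality_right, reassoc_of% h]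
    simp
  comul_counit := Quotient.sound TermEq.dup_del
  comul_assoc := by
    have h : (dup : (Ob.N : Ob Name) ⟶ _) ≫ dup ▷ Ob.N ≫ (α_ _ _ _).hom = dup ≫ Ob.N ◁ dup :=
      Quotient.sound TermEq.dup_assoc
    exact h.symm

instance : IsCommComonObj (Ob.N : Ob Name) where
  comul_comm := Quotient.sound TermEq.dup_comm

instance comonObjPow : (n : ℕ) → ComonObj (Ob.pow n : Ob Name)
  | 0 => ComonObj.instTensorUnit (Ob Name)
  | n + 1 =>
    have := comonObjPow n
    inferInstanceAs (ComonObj ((Ob.N : Ob Name) ⊗ Ob.pow n))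

theorem isCommComonObj_pow : ∀ n : ℕ, IsCommComonObj (Ob.pow n : Ob Name)
  | 0 => inferInstanceAs (IsCommComonObj (𝟙_ (Ob Name)))
  | n + 1 =>
    have := isCommComonObj_pow n
    inferInstanceAs (IsCommComonObj ((Ob.N : Ob Name) ⊗ Ob.pow n))

instance (n : ℕ) : IsCommComonObj (Ob.pow n : Ob Name) := isCommComonObj_pow n

theorem delPow_eq : ∀ n : ℕ, (delPow n : (Ob.pow n : Ob Name) ⟶ _) = ε
  | 0 => rfl
  | n + 1 => by
    rw [delPow, delPow_eq n]
    exact (Comon.tensorObj_counit (Ob.N : Ob Name) (Ob.pow n)).symm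

theorem dupPow_eq : ∀ n : ℕ, (dupPow n : (Ob.pow n : Ob Name) ⟶ _) = Δ
  | 0 => rfl
  | n + 1 => by
    rw [dupPow, dupPow_eq n]
    exact (Comon.tensorObj_comul (Ob.N : Ob Name) (Ob.pow n)).symm

/-- The entries of a tuple of names. From the end of the tuple on, the value is arbitrary. -/
def proj : (n : ℕ) → ℕ → ((Ob.pow n : Ob Name) ⟶ Ob.N)
  | 0, _ => fresh
  | n + 1, 0 => fst Ob.N (Ob.pow n)
  | n + 1, i + 1 => snd Ob.N (Ob.pow n) ≫ proj n i

/-- The tuple of the values of a list of names. -/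
def tuple {X : Ob Name} [ComonObj X] (σ : Name → (X ⟶ Ob.N)) : (ys : List Name) → (X ⟶ env ys)
  | [] => ε
  | y :: ys => lift (σ y) (tuple σ ys)

theorem isComonHom_tuple {X : Ob Name} [ComonObj X] [IsCommComonObj X] {σ : Name → (X ⟶ Ob.N)} :
    ∀ {ys : List Name}, (∀ y ∈ ys, IsComonHom (σ y)) → IsComonHom (tuple σ ys)
  | [], _ => isComonHom_counit
  | y :: ys, h => by
    have := h y (by simp)
    have := isComonHom_tuple fun z hz => h z (List.mem_cons_of_mem y hz)
    exact isComonHom_lift (σ y) (tuple σ ys)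

theorem tuple_proj {X : Ob Name} [ComonObj X] [IsCommComonObj X] {σ : Name → (X ⟶ Ob.N)} :
    ∀ {ys : List Name}, (∀ y ∈ ys, IsComonHom (σ y)) → ∀ i,
      tuple σ ys ≫ proj ys.length i = streamOf (ε ≫ fresh) (ys.map σ) i
  | [], _, i => by simp only [streamOf, tuple, List.map_nil, List.getD_nil]; rfl
  | y :: ys, h, i => by
    have := h y (by simp)
    have h' := fun z hz => h z (List.mem_cons_of_mem y hz)
    have := isComonHom_tuple h'
    cases i with
    | zero => exact lift_fst (σ y) (tuple σ ys)
    | succ i =>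
      refine (Category.assoc _ _ _).symm.trans ?_
      exact (congrArg (· ≫ proj ys.length i) (lift_snd (σ y) (tuple σ ys))).trans (tuple_proj h' i)

theorem comp_tuple {W X : Ob Name} [ComonObj W] [ComonObj X] (h : W ⟶ X) [IsComonHom h]
    (σ : Name → (X ⟶ Ob.N)) : ∀ ys, h ≫ tuple σ ys = tuple (fun y => h ≫ σ y) ys
  | [] => IsComonHom.hom_counit h
  | y :: ys => (comp_lift h _ _).trans (by rw [comp_tuple h σ ys]; rfl)

theorem tuple_congr {X : Ob Name} [ComonObj X] {σ σ' : Name → (X ⟶ Ob.N)} : ∀ {ys : List Name},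
    (∀ y ∈ ys, σ y = σ' y) → tuple σ ys = tuple σ' ys
  | [], _ => rfl
  | y :: ys, h => by
    rw [tuple, tuple, h y (by simp), tuple_congr fun z hz => h z (List.mem_cons_of_mem y hz)]

/-- The two sides have types that are equal, but not definitionally so. -/
theorem tuple_map {X : Ob Name} [ComonObj X] (σ : Name → (X ⟶ Ob.N)) (τ : Name → Name) :
    ∀ ys : List Name, (⟨_, tuple σ (ys.map τ)⟩ : Σ n, X ⟶ Ob.pow n) = ⟨_, tuple (σ ∘ τ) ys⟩
  | [] => rfl
  | y :: ys => congrArg (fun p : Σ n, X ⟶ Ob.pow n => (⟨p.1 + 1, lift (σ (τ y)) p.2⟩ :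
      Σ n, X ⟶ Ob.pow n)) (tuple_map σ τ ys)

theorem comp_curry {W X Y Z : Ob Name} (h : W ⟶ X) (k : Y ⊗ X ⟶ Z) :
    h ≫ curry k = curry (Y ◁ h ≫ k) := by
  rw [← curry_eta (h ≫ curry k), whiskerLeft_comp, Category.assoc, curry_beta]

variable [DecidableEq Name]

/-- The interpretation of a process in which a name `x` denotes `σ x : X ⟶ N`, for a comonoid `X`
in place of a tuple of names. -/
def Proc.denote : Proc Name → (X : Ob Name) → [ComonObj X] → (Name → (X ⟶ Ob.N)) → (X ⟶ Ob.P)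
  | .nil, _, _, _ => ε ≫ PiCalc.nil
  | .inp x ys _ P, X, _, σ =>
      lift (σ x) (curry (P.denote (Ob.pow ys.length ⊗ X)
        (asg (fun y => snd _ X ≫ σ y) ys fun i => fst _ X ≫ proj ys.length i))) ≫
        PiCalc.inp ys.length
  | .out x ys, _, _, σ => lift (σ x) (tuple σ ys) ≫ PiCalc.out ys.length
  | .new x P, X, _, σ => (λ_ X).inv ≫ fresh ▷ X ≫
      P.denote (Ob.N ⊗ X) (Function.update (fun y => snd _ X ≫ σ y) x (fst _ X))
  | .par P Q, X, _, σ => lift (P.denote X σ) (Q.denote X σ) ≫ PiCalc.par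

/-- The number of parameters of an input may be given by any expression equal to it. -/
theorem Proc.denote_inp (x : Name) (ys : List Name) (nd : ys.Nodup) (P : Proc Name) (X : Ob Name)
    [ComonObj X] (σ : Name → (X ⟶ Ob.N)) {n : ℕ} (hn : ys.length = n) :
    (Proc.inp x ys nd P).denote X σ = lift (σ x) (curry (P.denote (Ob.pow n ⊗ X)
        (asg (fun y => snd _ X ≫ σ y) ys fun i => fst _ X ≫ proj n i))) ≫ PiCalc.inp n := by
  subst hn
  rfl

theorem Proc.denote_congr (P : Proc Name) : ∀ (X : Ob Name) [ComonObj X] {σ σ' : Name → (X ⟶ Ob.N)},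
    (∀ w ∈ P.fn, σ w = σ' w) → P.denote X σ = P.denote X σ' := by
  induction P with
  | nil => intros; rfl
  | inp x ys nd P ih =>
    intro X _ σ σ' h
    have e : P.denote (Ob.pow ys.length ⊗ X) (asg (fun y => snd _ X ≫ σ y) ys _) = P.denote _ _ :=
      ih _ fun w hw => asg_congr (ρ' := fun y => snd _ X ≫ σ' y) ys
        (fun i => fst _ X ≫ proj ys.length i) fun hwy => by
          simp only [h w (by simp [fn, hw, hwy])]
    rw [denote, denote, h x (by simp [fn]), e]
  | out x ys =>
    intro X _ σ σ' h
    rw [denote, denote, h x (by simp [fn]), tuple_congr fun y hy => h y (by simp [fn, hy])]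
  | new x P ih =>
    intro X _ σ σ' h
    rw [denote, denote, ih]
    intro w hw
    by_cases hwx : w = x
    · subst hwx; simp
    · simp [hwx, h w (by simp [fn, hw, hwx])]
  | par P Q ihP ihQ =>
    intro X _ σ σ' h
    rw [denote, denote, ihP X fun w hw => h w (by simp [fn, hw]),
      ihQ X fun w hw => h w (by simp [fn, hw])]

/-- The interpretation is natural with respect to morphisms of comonoids. -/
theorem Proc.comp_denote (P : Proc Name) : ∀ {W X : Ob Name} [ComonObj W] [ComonObj X] (h : W ⟶ X)
    [IsComonHom h] (σ : Name → (X ⟶ Ob.N)), h ≫ P.denote X σ = P.denote W fun y => h ≫ σ y := by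
  induction P with
  | nil => intros; simp [denote]
  | inp x ys nd P ih =>
    intro W X _ _ h _ σ
    rw [denote, denote, ← Category.assoc, comp_lift, comp_curry, ih]
    congr 4
    funext w
    rw [map_asg fun f => Ob.pow ys.length ◁ h ≫ f]
    congr 1
    · funext y; simp only [Function.comp, ← Category.assoc, whiskerLeft_snd]
    · funext i; simp only [Function.comp, ← Category.assoc, whiskerLeft_fst]
  | out x ys =>
    intro W X _ _ h _ σ
    rw [denote, denote, ← Category.assoc, comp_lift, comp_tuple]
  | new x P ih =>
    intro W X _ _ h _ σ
    rw [denote, denote, leftUnitor_inv_naturality_assoc, whisker_exchange_assoc, ih]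
    congr 3
    funext w
    by_cases hwx : w = x
    · subst hwx; simp only [Function.update_self, whiskerLeft_fst]
    · simp only [Function.update_of_ne hwx, ← Category.assoc, whiskerLeft_snd]
  | par P Q ihP ihQ =>
    intro W X _ _ h _ σ
    rw [denote, denote, ← Category.assoc, comp_lift, ihP, ihQ]

variable [Infinite Name]

theorem Proc.denote_subst (P : Proc Name) : ∀ (τ : Name → Name) (X : Ob Name) [ComonObj X]
    (σ : Name → (X ⟶ Ob.N)), (P.subst τ).denote X σ = P.denote X (σ ∘ τ) := by
  induction P with
  | nil => intros; rfl
  | inp x ys nd P ih =>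
    intro τ X _ σ
    rw [subst, denote_inp _ _ _ _ _ _ (freshList_length _ _), denote, ih]
    congr 3
    refine P.denote_congr _ fun w hw => asg_assign (fun y => snd _ X ≫ σ y) τ ys _ _
      (freshList_length _ _).symm (freshList_nodup _ _) fun hwy hz => ?_
    exact freshList_notMem _ _ _ hz (Finset.mem_image_of_mem _ (by simp [hw, hwy]))
  | out x ys =>
    intro τ X _ σ
    exact congrArg (fun p : Σ n, X ⟶ Ob.pow n => lift (σ (τ x)) p.2 ≫ PiCalc.out p.1)
      (tuple_map σ τ ys)
  | new x P ih =>
    intro τ X _ σ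
    rw [subst, denote, denote, ih]
    congr 2
    refine P.denote_congr _ fun w hw => ?_
    have hz := freshName_notMem ((P.fn.erase x).image τ)
    rw [update_eq_assign, update_eq_asg, update_eq_asg]
    refine asg_assign (fun y => snd _ X ≫ σ y) τ [x] [_] _ rfl (List.nodup_singleton _)
      fun hwx e => ?_
    rw [List.mem_singleton] at e hwx
    exact hz (e ▸ Finset.mem_image_of_mem _ (by simp [hw, hwx]))
  | par P Q ihP ihQ =>
    intro τ X _ σ
    rw [subst, denote, denote, ihP, ihQ]

theorem Proc.denote_subs (P : Proc Name) {ys zs : List Name} (X : Ob Name) [ComonObj X]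
    (σ : Name → (X ⟶ Ob.N)) :
    (P.subs ys zs).denote X σ = P.denote X (σ ∘ assign id ys zs) := P.denote_subst _ X σ

end Denote

/-! ### The interpretation of processes and contexts -/

section Environments

variable {Name : Type u}

attribute [local instance] ComonObj.instTensorUnit

theorem isComonHom_concat (Γ : List Name) : ∀ ys : List Name, IsComonHom (concat ys Γ)
  | [] => isComonHom_left
  | _ :: ys =>
    have := isComonHom_concat Γ ys
    inferInstanceAs (IsComonHom ((α_ Ob.N (env ys) (env Γ)).hom ≫ (Ob.N ◁ concat ys Γ)))

instance (ys Γ : List Name) : IsComonHom (concat ys Γ) := isComonHom_concat Γ ys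

variable [DecidableEq Name]

theorem lookup_cons (Γ : List Name) (y : Name) : lookup (y :: Γ) =
    Function.update (fun x => snd Ob.N (env Γ) ≫ lookup Γ x) y (fst Ob.N (env Γ)) := by
  funext x
  by_cases h : x = y
  · subst h
    rw [lookup, if_pos rfl, Function.update_self, delPow_eq, fst, id_tensorHom]
    rfl
  · rw [lookup, if_neg h, Function.update_of_ne h, snd, tensorHom_id, Category.assoc]
    rfl

theorem isComonHom_lookup {x : Name} : ∀ {Γ : List Name}, x ∈ Γ → IsComonHom (lookup Γ x)
  | y :: Γ, h => by
    rw [lookup_cons]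
    by_cases hx : x = y
    · subst hx
      rw [Function.update_self]
      exact isComonHom_fst
    · rw [Function.update_of_ne hx]
      have := isComonHom_lookup ((List.mem_cons.1 h).resolve_left hx)
      exact inferInstanceAs (IsComonHom (snd Ob.N (env Γ) ≫ lookup Γ x))

theorem lookups_eq (Γ : List Name) : ∀ ys : List Name, lookups Γ ys = tuple (lookup Γ) ys
  | [] => delPow_eq _
  | y :: ys => by rw [lookups, tuple, dupPow_eq, lookups_eq Γ ys]; rfl

/-- Looking up a name after concatenation is assignment to the names in front. -/
theorem concat_lookup (Γ : List Name) (x : Name) : ∀ ys : List Name,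
    concat ys Γ ≫ lookup (ys ++ Γ) x =
      asg (fun y => snd (Ob.pow ys.length) (env Γ) ≫ lookup Γ y) ys
        (fun i => fst (Ob.pow ys.length) (env Γ) ≫ proj ys.length i) x
  | [] => by
    have h : snd (Ob.pow 0) (env Γ) = (λ_ (env Γ)).hom := by
      have e : ComonObj.counit (X := (Ob.pow 0 : Ob Name)) = 𝟙 (𝟙_ (Ob Name)) := rfl
      rw [snd, e]
      exact (congrArg (· ≫ _) (id_tensorHom_id _ _)).trans (Category.id_comp _)
    exact congrArg (· ≫ lookup Γ x) h.symm
  | y :: ys => by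
    have e : concat (y :: ys) Γ ≫ lookup (y :: (ys ++ Γ)) x =
        (α_ Ob.N (env ys) (env Γ)).hom ≫ (Ob.N ◁ concat ys Γ) ≫ lookup (y :: (ys ++ Γ)) x :=
      Category.assoc _ _ _
    refine e.trans ?_
    rw [lookup_cons]
    by_cases hx : x = y
    · subst hx
      rw [asg, Function.update_self, Function.update_self]
      refine (congrArg _ (whiskerLeft_fst (concat ys Γ))).trans ?_
      exact associator_fst
    · rw [asg, Function.update_of_ne hx, Function.update_of_ne hx]
      have e1 : (Ob.N ◁ concat ys Γ) ≫ snd Ob.N (env (ys ++ Γ)) ≫ lookup (ys ++ Γ) x =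
          snd Ob.N (env ys ⊗ env Γ) ≫ concat ys Γ ≫ lookup (ys ++ Γ) x := by
        rw [← Category.assoc, whiskerLeft_snd, Category.assoc]
      refine (congrArg _ e1).trans ?_
      rw [concat_lookup Γ x ys, ← Category.assoc, associator_snd]
      refine (map_asg (fun f => snd Ob.N (env ys) ▷ env Γ ≫ f) _ ys _ x).trans ?_
      congr 1
      · funext w
        refine (Category.assoc _ _ _).symm.trans ?_
        exact congrArg (· ≫ lookup Γ w) (whiskerRight_snd (snd Ob.N (env ys)))
      · funext i
        refine (Category.assoc _ _ _).symm.trans ?_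
        refine (congrArg (· ≫ proj ys.length i) (whiskerRight_fst (snd Ob.N (env ys)))).trans ?_
        exact Category.assoc _ _ _

/-- The interpretation in a list of names is the interpretation over the comonoid `N^{⊗ |Γ|}`. -/
theorem Proc.den_eq_denote (P : Proc Name) : ∀ Γ : List Name,
    P.den Γ = P.denote (env Γ) (lookup Γ) := by
  induction P with
  | nil => intro Γ; rw [den, denote, delPow_eq]
  | inp x ys nd P ih =>
    intro Γ
    rw [den, denote, dupPow_eq, ih, comp_denote, ← Category.assoc]
    have e : (fun y => concat ys Γ ≫ lookup (ys ++ Γ) y) = _ :=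
      funext fun w => concat_lookup Γ w ys
    rw [e]
    rfl
  | out x ys => intro Γ; rw [den, denote, dupPow_eq, lookups_eq, ← Category.assoc]; rfl
  | new x P ih =>
    intro Γ
    rw [den, denote, ih, lookup_cons]
    rfl
  | par P Q ihP ihQ => intro Γ; rw [den, denote, parHom, dupPow_eq, ihP, ihQ, ← Category.assoc]; rfl

/-- Looking up a name in a tuple of values returns its value, provided that the other values can be
deleted. -/
theorem tuple_lookup {X : Ob Name} [ComonObj X] [IsCommComonObj X] {σ : Name → (X ⟶ Ob.N)}
    {x : Name} : ∀ {ys : List Name}, (∀ y ∈ ys, IsComonHom (σ y)) → x ∈ ys →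
      tuple σ ys ≫ lookup ys x = σ x
  | y :: ys, h, hx => by
    have := h y (by simp)
    have h' := fun z hz => h z (List.mem_cons_of_mem y hz)
    have := isComonHom_tuple h'
    rw [lookup_cons]
    by_cases hxy : x = y
    · subst hxy
      rw [Function.update_self]
      exact lift_fst (σ x) (tuple σ ys)
    · rw [Function.update_of_ne hxy]
      refine (Category.assoc _ _ _).symm.trans ?_
      exact (congrArg (· ≫ lookup ys x) (lift_snd (σ y) (tuple σ ys))).trans
        (tuple_lookup h' ((List.mem_cons.1 hx).resolve_left hxy))

theorem lookups_comp_den {P : Proc Name} {Δ Γ : List Name} (hP : P.InScope Δ)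
    (h : ∀ x ∈ Δ, x ∈ Γ) : lookups Γ Δ ≫ P.den Δ = P.den Γ := by
  have hc : ∀ y ∈ Δ, IsComonHom (lookup Γ y) := fun y hy => isComonHom_lookup (h y hy)
  have := isComonHom_tuple hc
  rw [P.den_eq_denote, P.den_eq_denote, lookups_eq, Proc.comp_denote]
  exact P.denote_congr _ fun w hw => tuple_lookup hc (hP w hw)

/-- The interpretation of a context maps the interpretation of a process to that of the filled
context. -/
theorem Ctx.den_obj_den {P : Proc Name} {Δ : List Name} (hP : P.InScope Δ) (C : Ctx Name) :
    ∀ Γ, C.InScope Δ Γ → (C.den Δ Γ).obj (P.den Δ) = (C.fill P).den Γ := by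
  induction C with
  | hole => exact fun Γ h => lookups_comp_den hP h
  | inp x ys nd C ih =>
    intro Γ h
    rw [fill, Proc.den, ← ih _ h.2]
    rfl
  | new x C ih =>
    intro Γ h
    rw [fill, Proc.den, ← ih _ h]
    rfl
  | parL C Q ih =>
    intro Γ h
    rw [fill, Proc.den, ← ih _ h.1]
    rfl
  | parR Q C ih =>
    intro Γ h
    rw [fill, Proc.den, ← ih _ h.2]
    rfl

theorem Ctx.InScope.fill {P : Proc Name} {Δ : List Name} (hP : P.InScope Δ) {C : Ctx Name} :
    ∀ {Γ}, C.InScope Δ Γ → (C.fill P).InScope Γ := by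
  induction C with
  | hole => exact fun h x hx => h x (hP x hx)
  | inp x ys nd C ih =>
    intro Γ h w hw
    simp only [Ctx.fill, Proc.fn, Finset.mem_insert, Finset.mem_sdiff, List.mem_toFinset] at hw
    rcases hw with rfl | ⟨hw, hy⟩
    · exact h.1
    · exact (List.mem_append.1 (ih h.2 w hw)).resolve_left hy
  | new x C ih =>
    intro Γ h w hw
    simp only [Ctx.fill, Proc.fn, Finset.mem_erase] at hw
    exact (List.mem_cons.1 (ih h w hw.2)).resolve_left hw.1
  | parL C Q ih =>
    intro Γ h w hw
    rcases Finset.mem_union.1 hw with hw | hw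
    · exact ih h.1 w hw
    · exact h.2 w hw
  | parR Q C ih =>
    intro Γ h w hw
    rcases Finset.mem_union.1 hw with hw | hw
    · exact h.1 w hw
    · exact ih h.2 w hw

theorem Ctx.InScope.mono {Δ : List Name} {C : Ctx Name} : ∀ {Γ Γ' : List Name},
    (∀ x ∈ Γ, x ∈ Γ') → C.InScope Δ Γ → C.InScope Δ Γ' := by
  induction C with
  | hole => exact fun h h' x hx => h x (h' x hx)
  | inp x ys nd C ih =>
    exact fun h h' => ⟨h x h'.1, ih (fun w hw => by
      rcases List.mem_append.1 hw with hw | hw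
      · exact List.mem_append_left _ hw
      · exact List.mem_append_right _ (h w hw)) h'.2⟩
  | new x C ih =>
    exact fun h h' => ih (Γ := x :: _) (Γ' := x :: _) (fun w hw => by
      rcases List.mem_cons.1 hw with hw | hw
      · exact hw ▸ List.mem_cons_self
      · exact List.mem_cons_of_mem _ (h w hw)) h'
  | parL C Q ih => exact fun h h' => ⟨ih h h'.1, fun w hw => h w (h'.2 w hw)⟩
  | parR Q C ih => exact fun h h' => ⟨fun w hw => h w (h'.1 w hw), ih h h'.2⟩

theorem Ctx.exists_inScope (Δ : List Name) (C : Ctx Name) : ∃ Γ, C.InScope Δ Γ := by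
  induction C with
  | hole => exact ⟨Δ, fun _ h => h⟩
  | inp x ys nd C ih =>
    obtain ⟨Γ, h⟩ := ih
    exact ⟨x :: Γ, by simp, h.mono fun w hw => by simp [hw]⟩
  | new x C ih =>
    obtain ⟨Γ, h⟩ := ih
    exact ⟨Γ, Ctx.InScope.mono (Γ' := x :: Γ) (fun w hw => by simp [hw]) h⟩
  | parL C Q ih =>
    obtain ⟨Γ, h⟩ := ih
    exact ⟨Γ ++ Q.fn.toList, h.mono fun w hw => by simp [hw], fun w hw => by simp [hw]⟩
  | parR Q C ih =>
    obtain ⟨Γ, h⟩ := ih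
    exact ⟨Γ ++ Q.fn.toList, fun w hw => by simp [hw], h.mono fun w hw => by simp [hw]⟩

end Environments

/-! ### Rearrangements and communications in the theory -/

section Steps

variable {Name : Type u}

theorem lift_nil_par {X : Ob Name} [ComonObj X] (f : X ⟶ Ob.P) :
    lift f (ComonObj.counit ≫ nil) ≫ par = f := by
  rw [← lift_whiskerLeft, Category.assoc, whiskerLeft_nil_par, lift_counit_right]

theorem lift_par_comm {X : Ob Name} [ComonObj X] [IsCommComonObj X] (f g : X ⟶ Ob.P) :
    lift f g ≫ par = lift g f ≫ par := by
  rw [← lift_braid, Category.assoc, braiding_par]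

theorem lift_par_assoc {X : Ob Name} [ComonObj X] (f g h : X ⟶ Ob.P) :
    lift (lift f g ≫ par) h ≫ par = lift f (lift g h ≫ par) ≫ par := by
  rw [← lift_whiskerRight, ← lift_whiskerLeft, Category.assoc, Category.assoc,
    whiskerLeft_par_par, ← Category.assoc, ← Category.assoc, lift_assoc_inv, Category.assoc]

/-- There is a formal 2-morphism with exactly one generating 2-morphism, at top level. -/
def OneComm {X Y : Ob Name} (f g : X ⟶ Y) : Prop :=
  ∃ s : Cell f g, s.commCount = 1 ∧ s.TopLevel

theorem OneComm.comp_left {W X Y : Ob Name} {f g : X ⟶ Y} (h : W ⟶ X) (H : OneComm f g) :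
    OneComm (h ≫ f) (h ≫ g) := by
  obtain ⟨s, h1, h2⟩ := H
  exact ⟨(Cell.id h).hcomp s, by simp [Cell.commCount, h1], by simp [Cell.TopLevel, h2]⟩

theorem OneComm.lift_par {X : Ob Name} [ComonObj X] {f g : X ⟶ Ob.P} (H : OneComm f g)
    (r : X ⟶ Ob.P) : OneComm (lift f r ≫ par) (lift g r ≫ par) := by
  obtain ⟨s, h1, h2⟩ := H
  exact ⟨((Cell.id ComonObj.comul).hcomp (s.tensor (Cell.id r))).hcomp (Cell.id par),
    by simp [Cell.commCount, h1], by simp [Cell.TopLevel, h2]⟩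

theorem OneComm.comm (n : ℕ) : OneComm (Name := Name) (commSrc n) (commTgt n) :=
  ⟨.comm n, rfl, trivial⟩

theorem withCOMM_comp {W X : Ob Name} (h : W ⟶ X) (f : X ⟶ Ob.P) :
    withCOMM (h ≫ f) = h ≫ withCOMM f := Category.assoc _ _ _

/-- `COMM` may be attached to the first component, by the laws of a commutative monoid. -/
theorem withCOMM_lift_par {X : Ob Name} [ComonObj X] [IsCommComonObj X] (f r : X ⟶ Ob.P) :
    withCOMM (lift f r ≫ par) = lift (withCOMM f) r ≫ par := by
  have h : par ≫ (ρ_ (Ob.P : Ob Name)).inv ≫ (Ob.P ◁ COMM) ≫ par =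
      Ob.P ◁ ((ρ_ Ob.P).inv ≫ (Ob.P ◁ COMM) ≫ par) ≫ par := by
    simp only [whiskerLeft_comp, Category.assoc, whiskerLeft_par_par]
    rw [rightUnitor_inv_naturality_assoc, ← whisker_exchange_assoc]
    simp
  rw [lift_par_comm, withCOMM, Category.assoc, h, ← Category.assoc, lift_whiskerLeft, lift_par_comm]
  rfl

variable [DecidableEq Name] [Infinite Name]

/-- The laws of rearrangement are equations of the theory. -/
theorem Rearr.denote_eq {P Q : Proc Name} (h : Rearr P Q) : ∀ (X : Ob Name) [ComonObj X]
    [IsCommComonObj X] (σ : Name → (X ⟶ Ob.N)), P.denote X σ = Q.denote X σ := by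
  induction h with
  | refl P => intros; rfl
  | trans _ _ ih ih' => intro X _ _ σ; rw [ih, ih']
  | new x _ ih => intro X _ _ σ; rw [Proc.denote, Proc.denote, ih]
  | par Q _ ih => intro X _ _ σ; rw [Proc.denote, Proc.denote, ih]
  | rename x P z hz =>
    intro X _ _ σ
    rw [Proc.denote, Proc.denote, Proc.denote_subs]
    congr 2
    refine P.denote_congr _ fun w hw => ?_
    rw [update_eq_asg, update_eq_asg]
    refine (asg_assign (fun y => snd _ X ≫ σ y) id [x] [z] _ rfl (List.nodup_singleton _)
      fun hwx e => ?_).symm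
    rw [id, List.mem_singleton] at e
    rw [List.mem_singleton] at hwx
    exact hwx (e.trans (hz (e ▸ hw)))
  | par_assoc P Q R => intro X _ _ σ; simp only [Proc.denote, lift_par_assoc]
  | par_comm P Q => intro X _ _ σ; exact lift_par_comm _ _
  | par_nil P => intro X _ _ σ; exact (lift_nil_par _).symm
  | new_par x P Q hx =>
    intro X _ _ σ
    have e : Q.denote (Ob.N ⊗ X) (Function.update (fun y => snd _ X ≫ σ y) x (fst _ X)) =
        snd _ X ≫ Q.denote X σ := by
      rw [Proc.comp_denote]
      refine Q.denote_congr _ fun w hw => ?_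
      rw [Function.update_of_ne]
      rintro rfl
      exact hx hw
    simp only [Proc.denote]
    rw [e, lift_snd_comp]
    simp only [lift, MonoidalCategory.tensorHom_def, Category.assoc]
    rw [← whisker_exchange_assoc fresh]
    simp

/-- An output next to an input on the same channel is an instance of the source of `comm_n`, with
the result of the communication as target. The values of the names involved have to be comonoid
morphisms, since they are copied and deleted. -/
theorem denote_comm {X : Ob Name} [ComonObj X] [IsCommComonObj X] (x : Name) {ys zs : List Name}
    (nd : ys.Nodup) (hl : ys.length = zs.length) (Q : Proc Name) {σ : Name → (X ⟶ Ob.N)}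
    (hx : IsComonHom (σ x)) (hz : ∀ z ∈ zs, IsComonHom (σ z)) :
    OneComm (withCOMM (lift ((Proc.out x zs).denote X σ) ((Proc.inp x ys nd Q).denote X σ) ≫ par))
      (withCOMM ((Q.subs ys zs).denote X σ)) := by
  set k := Q.denote (Ob.pow zs.length ⊗ X)
    (asg (fun y => snd _ X ≫ σ y) ys fun i => fst _ X ≫ proj zs.length i) with hk
  have ht := isComonHom_tuple hz
  have h1 : lift ((Proc.out x zs).denote X σ) ((Proc.inp x ys nd Q).denote X σ) ≫ par =
      lift (σ x) (lift (tuple σ zs) (curry k)) ≫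
        (dup ▷ (Ob.pow zs.length ⊗ Ob.hom (Ob.pow zs.length) .P)) ≫
        tensorμ .N .N (Ob.pow zs.length) (Ob.hom (Ob.pow zs.length) .P) ≫
        (out zs.length ⊗ₘ inp zs.length) ≫ par := by
    have e : σ x ≫ dup = lift (σ x) (σ x) := IsComonHom.hom_comul (σ x)
    rw [← Category.assoc, lift_whiskerRight, e, ← Category.assoc, lift_tensorμ, ← Category.assoc,
      lift_map, Proc.denote_inp _ _ _ _ _ _ hl]
    rfl
  have h2 : (Q.subs ys zs).denote X σ = lift (σ x) (lift (tuple σ zs) (curry k)) ≫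
      (del ⊗ₘ ev (Ob.pow zs.length) .P) ≫ (λ_ Ob.P).hom := by
    have e : σ x ≫ del = ComonObj.counit := IsComonHom.hom_counit (σ x)
    have e' : lift (tuple σ zs) (curry k) ≫ ev _ _ = lift (tuple σ zs) (𝟙 X) ≫ k := by
      rw [← curry_beta k, ← Category.assoc, lift_whiskerLeft, Category.id_comp, curry_beta]
    have : IsComonHom (lift (tuple σ zs) (𝟙 X)) := isComonHom_lift _ _
    rw [lift_map_assoc, e, lift_counit_left, e', hk, Proc.comp_denote, Proc.denote_subs]
    refine Q.denote_congr _ fun w _ => ?_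
    refine ((map_asg (fun f => lift (tuple σ zs) (𝟙 X) ≫ f) _ ys _ w).trans ?_).symm
    refine Eq.trans ?_ (asg_streamOf σ (ComonObj.counit ≫ fresh) id ys zs w hl)
    congr 1
    · funext y
      refine (Category.assoc _ _ _).symm.trans ?_
      exact (congrArg (· ≫ σ y) (lift_snd (tuple σ zs) (𝟙 X))).trans (Category.id_comp _)
    · funext i
      refine (Category.assoc _ _ _).symm.trans ?_
      exact (congrArg (· ≫ proj zs.length i) (lift_fst (tuple σ zs) (𝟙 X))).trans (tuple_proj hz i)
  rw [h1, h2, withCOMM_comp (lift _ _), withCOMM_comp (lift (σ x) _)]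
  exact (OneComm.comm zs.length).comp_left _

/-- A communication at the surface is a single `comm_n` at top level: binders `new` are
precompositions, and `COMM` can be moved next to the redex. -/
theorem Surface.oneComm {P P' : Proc Name} (h : Surface P P') : ∀ (X : Ob Name) [ComonObj X]
    [IsCommComonObj X] (σ : Name → (X ⟶ Ob.N)), (∀ x ∈ P.fn, IsComonHom (σ x)) →
    OneComm (withCOMM (P.denote X σ)) (withCOMM (P'.denote X σ)) := by
  induction h with
  | comm x zs ys nd Q R hl =>
    intro X _ _ σ h
    change OneComm (withCOMM (lift _ (lift _ _ ≫ par) ≫ par)) (withCOMM (lift _ _ ≫ par))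
    rw [← lift_par_assoc, withCOMM_lift_par _ (R.denote X σ), withCOMM_lift_par _ (R.denote X σ)]
    exact (denote_comm x nd hl Q (h x (by simp [Proc.fn]))
      fun z hz => h z (by simp [Proc.fn, hz])).lift_par _
  | new x _ ih =>
    intro X _ _ σ h
    rw [Proc.denote, Proc.denote]
    simp only [withCOMM_comp]
    refine ((ih _ _ fun w hw => ?_).comp_left _).comp_left _
    by_cases hwx : w = x
    · subst hwx
      rw [Function.update_self]
      infer_instance
    · rw [Function.update_of_ne hwx]
      have := h w (by simp [Proc.fn, hw, hwx])
      infer_instance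

theorem Surface.commStep {P P' : Proc Name} (h : Surface P P') {Γ : List Name} (hP : P.InScope Γ) :
    CommStep Γ (P.den Γ) (P'.den Γ) := by
  obtain ⟨s, h1, h2⟩ : OneComm (top Γ (P.den Γ)) (top Γ (P'.den Γ)) := by
    rw [top, top, close, close, withCOMM_comp, withCOMM_comp, P.den_eq_denote, P'.den_eq_denote]
    exact (h.oneComm _ _ fun x hx => isComonHom_lookup (hP x hx)).comp_left _
  exact ⟨Quotient.mk _ s, s, rfl, h1, h2⟩

theorem Rearr.den_eq {P Q : Proc Name} (h : Rearr P Q) (Γ : List Name) : P.den Γ = Q.den Γ := by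
  rw [P.den_eq_denote, Q.den_eq_denote, h.denote_eq]

end Steps

/-! ### Bisimilarity -/

section Bisimilarity

/-- An injective sequence of numbers that leaves infinitely many numbers unused, so that there is
room for the further new names of congruent processes. -/
def Sparse (i : ℕ → ℕ) : Prop := ∃ w : ℕ → ℕ, Function.Injective (Sum.elim i w)

theorem sparse_evens : Sparse evens := ⟨odds, evens_odds_injective⟩

theorem Sparse.injective {i : ℕ → ℕ} (h : Sparse i) : Function.Injective i := by
  obtain ⟨w, h⟩ := h
  exact h.comp Sum.inl_injective

theorem Sparse.comp {i t : ℕ → ℕ} (h : Sparse i) (ht : Function.Injective t) : Sparse (i ∘ t) := by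
  obtain ⟨w, h⟩ := h
  refine ⟨w, ?_⟩
  have := h.comp (ht.sumMap Function.injective_id)
  rwa [Sum.elim_comp_map] at this

/-- A sparse choice `i` of new names for a process that has the part `i'` of a stream comes from a
choice `p` for the whole stream, which is sparse on the part `j'`. -/
theorem Sparse.exists_extension {i i' j' : ℕ → ℕ} (h : Sparse i) (hi : Function.Injective i')
    (hj : Function.Injective j') : ∃ p : ℕ → ℕ, p ∘ i' = i ∧ Sparse (p ∘ j') := by
  classical
  obtain ⟨w, h⟩ := h
  have hd : ∀ m n, i m ≠ w n := fun m n e => by simpa using h (a₁ := .inl m) (a₂ := .inr n) e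
  have hi' : Function.Injective i := h.comp Sum.inl_injective
  have hw : Function.Injective w := h.comp Sum.inr_injective
  -- Off the range of `i'`, every second value of `w` is used, and the others are left over.
  let p : ℕ → ℕ := fun n => if hn : ∃ k, i' k = n then i hn.choose else w (evens n)
  have p1 : ∀ k, p (i' k) = i k := fun k => by
    have hk : ∃ l, i' l = i' k := ⟨k, rfl⟩
    simp only [p, dif_pos hk]
    exact congrArg i (hi hk.choose_spec)
  have p2 : ∀ n, (¬ ∃ k, i' k = n) → p n = w (evens n) := fun n hn => dif_neg hn
  have hp : Function.Injective p := by
    intro m n e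
    by_cases hm : ∃ k, i' k = m <;> by_cases hn : ∃ k, i' k = n
    · obtain ⟨k, rfl⟩ := hm
      obtain ⟨l, rfl⟩ := hn
      rw [p1, p1] at e
      rw [hi' e]
    · obtain ⟨k, rfl⟩ := hm
      rw [p1, p2 n hn] at e
      exact (hd _ _ e).elim
    · obtain ⟨k, rfl⟩ := hn
      rw [p1, p2 m hm] at e
      exact (hd _ _ e.symm).elim
    · rw [p2 m hm, p2 n hn] at e
      exact evens_injective (hw e)
  refine ⟨p, funext p1, w ∘ odds, (hp.comp hj).sumElim (hw.comp odds_injective) fun m n => ?_⟩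
  by_cases hm : ∃ k, i' k = j' m
  · obtain ⟨k, hk⟩ := hm
    simp only [Function.comp, ← hk, p1]
    exact hd _ _
  · simp only [Function.comp, p2 _ hm]
    exact fun e => by
      have := hw e
      simp only [evens, odds] at this
      omega

variable {Name : Type u} [DecidableEq Name]

/-- The behaviours of two processes agree for suitable choices of new names. -/
def BehEquiv (P Q : Proc Name) : Prop := ∃ i j : ℕ → ℕ, Sparse i ∧ Sparse j ∧
  P.beh Sum.inl (Sum.inr ∘ i) = Q.beh Sum.inl (Sum.inr ∘ j)

theorem BehEquiv.refl (P : Proc Name) : BehEquiv P P :=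
  ⟨evens, evens, sparse_evens, sparse_evens, rfl⟩

theorem BehEquiv.symm {P Q : Proc Name} : BehEquiv P Q → BehEquiv Q P :=
  fun ⟨i, j, hi, hj, h⟩ => ⟨j, i, hj, hi, h.symm⟩

/-- Barbs can be read off behaviours; new channels are not confused with names. -/
theorem Barb.of_beh_eq {P Q : Proc Name} {x : Name} {i j : ℕ → ℕ}
    (h : P.beh Sum.inl (Sum.inr ∘ i) = Q.beh Sum.inl (Sum.inr ∘ j)) (hP : Barb P x) : Barb Q x := by
  obtain ⟨zs, hz⟩ := hP.mem_flat Sum.inl (Sum.inr ∘ i)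
  rw [h] at hz
  rcases barb_of_mem_flat hz with ⟨y, hy, hb⟩ | ⟨n, hn⟩
  · rwa [← Sum.inl_injective hy]
  · simp at hn

/-- `P` can communicate and become `P'`, as far as behaviours tell. -/
def Communicates (P P' : Proc Name) : Prop := ∃ i j : ℕ → ℕ, Function.Injective i ∧
  Function.Injective j ∧ ∀ a : ℕ → Val Name,
    Beh.Comm Val.default (P.beh Sum.inl (a ∘ i)) (P'.beh Sum.inl (a ∘ j))

/-- Barbs depend on the closed interpretation only. -/
theorem Barb.of_close_den_eq {P Q : Proc Name} {x : Name} {Γ Γ' : List Name}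
    (h : close Γ (P.den Γ) = close Γ' (Q.den Γ')) (hP : Barb P x) : Barb Q x := by
  obtain ⟨i, j, _, _, e⟩ := (h ▸ P.interp_close_den Γ).same (Q.interp_close_den Γ')
  exact hP.of_beh_eq (congrFun (e Sum.inr) PUnit.unit)

theorem Barb.semBarb {P : Proc Name} {x : Name} (h : Barb P x) : ∀ {Γ : List Name}, P.InScope Γ →
    SemBarb (close Γ (P.den Γ)) (name x) := by
  induction h with
  | out x ys => exact fun h => .out _ x ys h
  | par_left Q _ ih => exact fun h => .par_left Q _ h (ih fun w hw => h w (by simp [Proc.fn, hw]))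
  | par_right P _ ih => exact fun h => .par_right P _ h (ih fun w hw => h w (by simp [Proc.fn, hw]))
  | new y _ hxy ih =>
    refine fun h => .new y _ h (ih fun w hw => ?_) hxy
    by_cases hwy : w = y
    · simp [hwy]
    · exact List.mem_cons_of_mem _ (h w (by simp [Proc.fn, hw, hwy]))

/-- Semantic observation is observation. The semantic relation is inductively defined through
representatives `P`, `Γ` of a 1-morphism; by `Barb.of_close_den_eq` their choice is immaterial. -/
theorem semBarb_iff {P : Proc Name} {Γ : List Name} (hP : P.InScope Γ) (x : Name) :
    SemBarb (close Γ (P.den Γ)) (name x) ↔ Barb P x := by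
  refine ⟨fun h => ?_, fun h => h.semBarb hP⟩
  generalize hf : close Γ (P.den Γ) = f at h
  generalize hv : name x = v at h
  clear hP
  induction h generalizing P Γ x with
  | out Γ' y ys _ =>
    rw [name_injective hv]
    exact (Barb.out y ys).of_close_den_eq hf.symm
  | par_left Q Γ' _ _ ih =>
    rw [name_injective hv]
    exact ((ih _ rfl rfl).par_left Q).of_close_den_eq hf.symm
  | par_right P' Γ' _ _ ih =>
    rw [name_injective hv]
    exact ((ih _ rfl rfl).par_right P').of_close_den_eq hf.symm
  | new y Γ' _ _ hxy ih =>
    rw [name_injective hv]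
    exact ((ih _ rfl rfl).new y hxy).of_close_den_eq hf.symm

variable [Infinite Name]

/-- Communications of behaviours are realized, by any process of equivalent behaviour, as
communications at the surface of a rearrangement. -/
theorem Communicates.exists_surface {P P' Q : Proc Name} (h : Communicates P P')
    (hPQ : BehEquiv P Q) : ∃ N Q', Rearr Q N ∧ Surface N Q' ∧ BehEquiv P' Q' := by
  obtain ⟨i', j', hi', hj', h⟩ := h
  obtain ⟨i, j, hi, hj, e⟩ := hPQ
  obtain ⟨p, hpi, hpj⟩ := hi.exists_extension hi' hj'
  have h := h (Sum.inr ∘ p)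
  rw [Function.comp_assoc, hpi, e, Function.comp_assoc] at h
  have ha : Apart (Sum.inl : Name → Val Name) (Sum.inr ∘ j) := by
    refine Sum.inl_injective.sumElim (Sum.inr_injective.comp hj.injective) fun _ _ => ?_
    simp
  obtain ⟨N, Q', t, h1, h2, ht, h3⟩ := Q.exists_surface ha h
  exact ⟨N, Q', h1, h2, p ∘ j', j ∘ t, hpj, hj.comp ht, h3.symm⟩

theorem Red.communicates {P P' : Proc Name} (h : Red P P') : Communicates P P' := by
  obtain ⟨i, j, hi, hj, h⟩ := h.comm_beh
  exact ⟨i, j, hi, hj, fun a => h a _⟩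

theorem Communicates.exists_red {P P' Q : Proc Name} (h : Communicates P P')
    (hPQ : BehEquiv P Q) : ∃ Q', Red Q Q' ∧ BehEquiv P' Q' := by
  obtain ⟨N, Q', h1, h2, h3⟩ := h.exists_surface hPQ
  exact ⟨Q', .equiv h1.structCong h2.red (.refl _), h3⟩

/-- Equality of behaviours is a barbed bisimulation. -/
theorem BehEquiv.bisimilar {P Q : Proc Name} (h : BehEquiv P Q) : Bisimilar P Q :=
  ⟨BehEquiv, ⟨fun _ _ => BehEquiv.symm, fun _ _ h => ⟨fun _ hr => hr.communicates.exists_red h,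
    fun _ hb => by
      obtain ⟨i, j, _, _, e⟩ := h
      exact hb.of_beh_eq e⟩⟩, h⟩

theorem Bisimilar.symm {P Q : Proc Name} : Bisimilar P Q → Bisimilar Q P :=
  fun ⟨S, hS, h⟩ => ⟨S, hS, hS.1 _ _ h⟩

theorem Bisimilar.red {P Q P' : Proc Name} (h : Bisimilar P Q) (hr : Red P P') :
    ∃ Q', Red Q Q' ∧ Bisimilar P' Q' := by
  obtain ⟨S, hS, h⟩ := h
  obtain ⟨Q', h1, h2⟩ := (hS.2 _ _ h).1 _ hr
  exact ⟨Q', h1, S, hS, h2⟩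

theorem Bisimilar.barb {P Q : Proc Name} {x : Name} (h : Bisimilar P Q) (hb : Barb P x) :
    Barb Q x := by
  obtain ⟨S, hS, h⟩ := h
  exact (hS.2 _ _ h).2 _ hb

theorem Bisimilar.trans {P Q R : Proc Name} (h : Bisimilar P Q) (h' : Bisimilar Q R) :
    Bisimilar P R := by
  refine ⟨fun P R => ∃ Q, Bisimilar P Q ∧ Bisimilar Q R, ⟨?_, ?_⟩, Q, h, h'⟩
  · exact fun _ _ ⟨Q, h, h'⟩ => ⟨Q, h'.symm, h.symm⟩
  · rintro P R ⟨Q, h, h'⟩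
    refine ⟨fun P' hr => ?_, fun x hb => h'.barb (h.barb hb)⟩
    obtain ⟨Q', h1, h2⟩ := h.red hr
    obtain ⟨R', h3, h4⟩ := h'.red h1
    exact ⟨R', h3, Q', h2, h4⟩

/-- Reductions are semantic reductions, up to bisimilarity of the results. The result itself need
not be reached, since structural congruence has laws that fail in the theory. -/
theorem Red.exists_commStep {P P' : Proc Name} (h : Red P P') {Γ : List Name} (hP : P.InScope Γ) :
    ∃ P'' : Proc Name, P''.InScope Γ ∧ CommStep Γ (P.den Γ) (P''.den Γ) ∧ Bisimilar P' P'' := by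
  obtain ⟨N, P'', h1, h2, h3⟩ := h.communicates.exists_surface (.refl P)
  have hN : N.InScope Γ := fun x hx => hP x (h1.fn_subset hx)
  exact ⟨P'', fun x hx => hN x (h2.fn_subset hx), h1.den_eq Γ ▸ h2.commStep hN, h3.bisimilar⟩

/-- Semantic reductions between interpretations of processes are reductions, up to bisimilarity of
the results. -/
theorem CommStep.exists_red {P P' : Proc Name} {Γ : List Name}
    (h : CommStep Γ (P.den Γ) (P'.den Γ)) : ∃ P'', Red P P'' ∧ Bisimilar P' P'' := by
  obtain ⟨P'', h1, h2⟩ := Communicates.exists_red h.exists_comm (.refl P)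
  exact ⟨P'', h1, h2.bisimilar⟩

/-- Bisimilarity of processes is semantic bisimilarity of their interpretations. -/
theorem bisimilar_iff_semBisimilar {P Q : Proc Name} {Γ : List Name} (hP : P.InScope Γ)
    (hQ : Q.InScope Γ) : Bisimilar P Q ↔ SemBisimilar Γ (P.den Γ) (Q.den Γ) := by
  constructor
  · intro h
    refine ⟨fun f g => ∃ P Q : Proc Name, P.InScope Γ ∧ Q.InScope Γ ∧ f = P.den Γ ∧ g = Q.den Γ ∧
      Bisimilar P Q, ⟨?_, ?_⟩, P, Q, hP, hQ, rfl, rfl, h⟩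
    · rintro _ _ ⟨P, Q, hP, hQ, rfl, rfl, h⟩
      exact ⟨Q, P, hQ, hP, rfl, rfl, h.symm⟩
    · rintro _ _ ⟨P, Q, hP, hQ, rfl, rfl, h⟩
      refine ⟨fun P' hP' hs => ?_, fun x hb => ?_⟩
      · obtain ⟨P1, h1, h2⟩ := hs.exists_red
        obtain ⟨Q1, h3, h4⟩ := h.red h1
        obtain ⟨Q', hQ', h5, h6⟩ := h3.exists_commStep hQ
        exact ⟨Q', hQ', h5, P', Q', hP', hQ', rfl, rfl, h2.trans (h4.trans h6)⟩
      · exact (semBarb_iff hQ x).2 (h.barb ((semBarb_iff hP x).1 hb))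
  · rintro ⟨S, hS, h⟩
    refine ⟨fun P Q => ∃ P1 Q1 : Proc Name, P1.InScope Γ ∧ Q1.InScope Γ ∧ Bisimilar P P1 ∧
      S (P1.den Γ) (Q1.den Γ) ∧ Bisimilar Q1 Q, ⟨?_, ?_⟩, P, Q, hP, hQ,
      (BehEquiv.refl P).bisimilar, h, (BehEquiv.refl Q).bisimilar⟩
    · rintro P Q ⟨P1, Q1, hP, hQ, h1, h, h2⟩
      exact ⟨Q1, P1, hQ, hP, h2.symm, hS.1 _ _ h, h1.symm⟩
    · rintro P Q ⟨P1, Q1, hP, hQ, h1, h, h2⟩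
      refine ⟨fun P' hr => ?_, fun x hb => ?_⟩
      · obtain ⟨P2, r1, e1⟩ := h1.red hr
        obtain ⟨P3, hP3, s1, e2⟩ := r1.exists_commStep hP
        obtain ⟨Q3, hQ3, s2, h3⟩ := (hS.2 _ _ h).1 P3 hP3 s1
        obtain ⟨Q2, r2, e3⟩ := s2.exists_red
        obtain ⟨Q', r3, e4⟩ := h2.red r2
        exact ⟨Q', r3, P3, Q3, hP3, hQ3, e1.trans e2, h3, e3.trans e4⟩
      · exact h2.barb ((semBarb_iff hQ x).1 ((hS.2 _ _ h).2 x ((semBarb_iff hP x).2 (h1.barb hb))))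

end Bisimilarity

end PiCalc

theorem mainTheorem2 {Name : Type*} [DecidableEq Name] [Infinite Name]
    (P Q : PiCalc.Proc Name) (Δ : List Name) (hP : P.InScope Δ) (hQ : Q.InScope Δ) :
    PiCalc.ContextualCongruent P Q ↔
      PiCalc.SemContextualCongruent Δ (P.den Δ) (Q.den Δ) := by
  constructor
  · intro h C Γ hC
    rw [C.den_obj_den hP Γ hC, C.den_obj_den hQ Γ hC]
    exact (PiCalc.bisimilar_iff_semBisimilar (hC.fill hP) (hC.fill hQ)).1 (h C)
  · intro h C
    obtain ⟨Γ, hC⟩ := C.exists_inScope Δ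
    have h' := h C Γ hC
    rw [C.den_obj_den hP Γ hC, C.den_obj_den hQ Γ hC] at h'
    exact (PiCalc.bisimilar_iff_semBisimilar (hC.fill hP) (hC.fill hQ)).2 h'
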